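/- Fix an infinite set of names. **The model $\mathbb{C}$.** Its processes are given by $P ::= 0 \mid \Omega \mid \overline{a}(\underline{i}) \mid F_a^b(f) \mid P\,|\,P$, where $a,b$ are names, $i\in\mathbb{N}$ and $f:\mathbb{N}\rightharpoonup\mathbb{N}$ is a partial computable function (taken extensionally). Its transitions are $\overline{a}(\underline{i})\xrightarrow{\overline{a}(\underline{i})}0$; $\;\Omega\xrightarrow{\tau}\Omega$; $\;F_a^b(f)\xrightarrow{a(\underline{m})}\overline{b}(\underline{n})$ if $f(m)=n$; $\;F_a^b(f)\xrightarrow{a(\underline{m})}\Omega$ if $f(m)$ is undefined; closure under parallel composition; and $P|Q\xrightarrow{\tau}P'|Q'$ if $P\xrightarrow{\overline{a}(\underline{i})}P'$ and $Q\xrightarrow{a(\underline{i})}Q'$, or symmetrically. $\equiv_{\mathbb{C}}$ is the least congruence with $0|P\equiv P$, $P|Q\equiv Q|P$, $(P|Q)|R\equiv P|(Q|R)$ and $\Omega|\Omega\equiv\Omega$. **The calculus $\Pi^d$.** Its terms are $E ::= 0 \mid X \mid a(X).E \mid \overline{a}E'.E \mid E\,|\,E' \mid (a)E \mid \langle x_1,\dots,x_r\rangle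 E \mid E\langle m_1,\dots,m_r\rangle$ with $r\ge 1$, up to renaming of bound names and variables. No typing discipline is imposed: an application whose number of arguments does not fit is inert. Processes are the closed terms. $\equiv$ is the least congruence containing the commutative monoid laws for $|$, $(c)(d)E\equiv(d)(c)E$, $(c)(E|F)\equiv(c)E\,|\,F$ for $c\notin fn(F)$, and $(\langle\tilde x\rangle E)\langle\tilde m\rangle\equiv E\{\tilde m/\tilde x\}$ for $|\tilde m|=|\tilde x|$. The transitions, with the actions $\tau$, $a(E)$ (input of a process $E$) and $(\tilde c)\overline{a}[E]$ (output of $E$ extruding the names $\tilde c$), are the usual ones, closed under $\equiv$: $a(X).F\xrightarrow{a(E)}F\{E/X\}$; $\overline{a}E.F\xrightarrow{\overline{a}[E]}F$; parallel composition and restriction as in the $\pi$-calculus; scope opening $(d)E\xrightarrow{(d)(\tilde c)\overline{a}[E_1]}E'$ if $E\xrightarrow{(\tilde c)\overline{a}[E_1]}E'$ and $d\in fn(E_1)\setminus\{\tilde c,a\}$; and $E|F\xrightarrow{\tau}(\tilde c)(E'|F')$ if $E\xrightarrow{a(E_1)}E'$ and $F\xrightarrow{(\tilde c)\overline{a}[E_1]}F'$,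 or symmetrically. In both models $\Rightarrow$ is the reflexive transitive closure of $\xrightarrow{\tau}$, $\overset{\lambda}{\Rightarrow}$ is $\Rightarrow\xrightarrow{\lambda}\Rightarrow$, and a process diverges if it has an infinite sequence of $\tau$-transitions. The subject of an input or output action is the name on which it takes place; $\tau$ has no subject. *Divergence-sensitive context bisimilarity* $\approx$ on $\Pi^d$ is the union of all symmetric relations $\mathcal{R}$ on processes such that, whenever $E\,\mathcal{R}\,F$: (i) if $E\xrightarrow{\tau}E'$ then $F\Rightarrow F'$ and $E'\,\mathcal{R}\,F'$ for some $F'$; (ii) if $E\xrightarrow{a(E_1)}E'$ then $F\overset{a(E_1)}{\Rightarrow}F'$ and $E'\,\mathcal{R}\,F'$ for some $F'$; (iii) if $E\xrightarrow{(\tilde c)\overline{a}[E_1]}E'$ then for some $\tilde d,E_2,F'$ one has $F\overset{(\tilde d)\overline{a}[E_2]}{\Longrightarrow}F'$ and, for every $G[X]$ with $\tilde c\tilde d\cap fn(G)=\emptyset$, $(\tilde c)(G[E_1]|E')\,\mathcal{R}\,(\tilde d)(G[E_2]|F')$; (iv) if $F$ diverges then so does $E$. **Proposition.** There is a map $[\![\cdot]\!]$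 from the processes of $\mathbb{C}$ to the processes of $\Pi^d$ with all of the following properties. 1. Soundness: $P\equiv_{\mathbb{C}}Q$ implies $[\![P]\!]\approx[\![Q]\!]$. 2. Completeness: $[\![P]\!]\approx[\![Q]\!]$ implies $P\equiv_{\mathbb{C}}Q$. 3. Compositionality: for every $k$-ary operator $op$ of $\mathbb{C}$ there is a context $C_{op}[X_1,\dots,X_k]$ of $\Pi^d$ with $[\![op(P_1,\dots,P_k)]\!]=C_{op}[[\![P_1]\!],\dots,[\![P_k]\!]]$ for all $P_1,\dots,P_k$. 4. Name invariance: $[\![P\sigma]\!]=[\![P]\!]\sigma$ for every injective substitution $\sigma$ of names. 5. Forth operational correspondence: whenever $P\overset{\lambda}{\Rightarrow}P'$, there are an action $\lambda'$ with the same subject as $\lambda$ and a $T$ with $[\![P]\!]\overset{\lambda'}{\Rightarrow}T\approx[\![P']\!]$. 6. Divergence reflection: if $[\![P]\!]$ diverges, so does $P$. 7. Back operational correspondence fails: it is not the case that, whenever $[\![P]\!]\overset{\lambda'}{\Rightarrow}T$, there are an action $\lambda$ with the same subject as $\lambda'$ and $P',T'$ with $P\overset{\lambda}{\Rightarrow}P'$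 and $T\Rightarrow T'\approx[\![P']\!]$. -/

import Mathlib

/-! ## Generic notions -/

/-- `x` diverges for the one-step relation `step`: it starts an infinite sequence of steps. -/
def Diverges {α : Type} (step : α → α → Prop) (x : α) : Prop :=
  ∃ s : ℕ → α, s 0 = x ∧ ∀ n, step (s n) (s (n + 1))

/-! ## The elementary interactive model `ℂ`

Names are natural numbers. -/

/-- The (unary, partial) computable functions, taken extensionally. -/
def CompFun : Type := {f : ℕ →. ℕ // Nat.Partrec f}

inductive CProc : Type
  | nil : CProc
  | omega : CProc
  /-- output of the number `i` on `a` -/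
  | out (a i : ℕ) : CProc
  /-- `F_a^b(f(x))`: input on `a`, computation of `f`, output on `b` -/
  | fn (a b : ℕ) (f : CompFun) : CProc
  | par (P Q : CProc) : CProc

inductive CAct : Type
  | tau : CAct
  | inp (a i : ℕ) : CAct
  | out (a i : ℕ) : CAct

/-- The subject of an action; `τ` has none. -/
def CAct.subject : CAct → Option ℕ
  | .tau => none
  | .inp a _ => some a
  | .out a _ => some a

namespace CProc

/-- Substitution of names. -/
def rename (σ : ℕ → ℕ) : CProc → CProc
  | nil => nil
  | omega => omega
  | out a i => out (σ a) i
  | fn a b f => fn (σ a) (σ b) f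
  | par P Q => par (rename σ P) (rename σ Q)

/-- The labelled transition system of `ℂ`. -/
inductive Step : CProc → CAct → CProc → Prop
  | out (a i : ℕ) : Step (out a i) (.out a i) nil
  | omega : Step omega .tau omega
  | fnDef (a b : ℕ) (f : CompFun) (m n : ℕ) (h : n ∈ f.1 m) :
      Step (fn a b f) (.inp a m) (CProc.out b n)
  | fnUndef (a b : ℕ) (f : CompFun) (m : ℕ) (h : ¬ (f.1 m).Dom) :
      Step (fn a b f) (.inp a m) CProc.omega
  | comL {P P' Q Q' : CProc} {a i : ℕ} (hP : Step P (.out a i) P') (hQ : Step Q (.inp a i) Q') :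
      Step (par P Q) .tau (par P' Q')
  | comR {P P' Q Q' : CProc} {a i : ℕ} (hP : Step P (.inp a i) P') (hQ : Step Q (.out a i) Q') :
      Step (par P Q) .tau (par P' Q')
  | parL {P P' : CProc} {l : CAct} (Q : CProc) (hP : Step P l P') : Step (par P Q) l (par P' Q)
  | parR {Q Q' : CProc} {l : CAct} (P : CProc) (hQ : Step Q l Q') : Step (par P Q) l (par P Q')

def Tau (P Q : CProc) : Prop := Step P .tau Q

/-- `P ⟹ Q`. -/
def Taus : CProc → CProc → Prop := Relation.ReflTransGen Tau

/-- `P ⟹ -l-> ⟹ Q` (for `l = τ` at least one step). -/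
def Weak (P : CProc) (l : CAct) (Q : CProc) : Prop :=
  ∃ P₁ P₂, Taus P P₁ ∧ Step P₁ l P₂ ∧ Taus P₂ Q

/-- The structural congruence `≡_ℂ`: the least equivalence and congruence with the laws below. -/
inductive Cong : CProc → CProc → Prop
  | refl (P : CProc) : Cong P P
  | symm {P Q : CProc} : Cong P Q → Cong Q P
  | trans {P Q R : CProc} : Cong P Q → Cong Q R → Cong P R
  | par {P P' Q Q' : CProc} : Cong P P' → Cong Q Q' → Cong (par P Q) (par P' Q')
  | nil_par (P : CProc) : Cong (CProc.par nil P) P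
  | par_comm (P Q : CProc) : Cong (CProc.par P Q) (CProc.par Q P)
  | par_assoc (P Q R : CProc) :
      Cong (CProc.par (CProc.par P Q) R) (CProc.par P (CProc.par Q R))
  | omega_omega : Cong (CProc.par omega omega) omega

end CProc

/-- The operators of `ℂ`. -/
inductive COp : Type
  | nil : COp
  | omega : COp
  | out (a i : ℕ) : COp
  | fn (a b : ℕ) (f : CompFun) : COp
  | par : COp

def COp.arity : COp → ℕ
  | .par => 2
  | _ => 0

def COp.apply : (op : COp) → (Fin op.arity → CProc) → CProc
  | .nil, _ => .nil
  | .omega, _ => .omega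
  | .out a i, _ => .out a i
  | .fn a b f, _ => .fn a b f
  | .par, P => .par (P (0 : Fin 2)) (P (1 : Fin 2))

/-! ## The calculus `Π^d`

Terms are considered up to renaming of bound names and bound variables, which is achieved by
de Bruijn indices. Names are natural numbers: in the scope of `k` name binders the indices
`0, …, k - 1` are the bound names (`0` the innermost one) and the index `k + a` stands for the free
name constant `a`. Since name variables can only be bound (by a parameterization) in a closed
term, the free names are constants. Free variables for terms are counted in the type, so that
`HTerm 0` is the type of closed terms and a term `G : HTerm 1` is a `G[X]`. -/

inductive HTerm : ℕ → Type
  | nil {n : ℕ} : HTerm n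
  | var {n : ℕ} (X : Fin n) : HTerm n
  /-- `a(X).E`; in `E` the variable `X` is `0` -/
  | inp {n : ℕ} (a : ℕ) (E : HTerm (n + 1)) : HTerm n
  /-- the output of `E` on `a` with continuation `F` -/
  | out {n : ℕ} (a : ℕ) (E F : HTerm n) : HTerm n
  | par {n : ℕ} (E F : HTerm n) : HTerm n
  /-- the restriction `(c)E`; in `E` the name `c` is `0` -/
  | res {n : ℕ} (E : HTerm n) : HTerm n
  /-- the parameterization `⟨x₀, …, x_r⟩E` by `r + 1` names; in `E` the name `x_i` is `i` -/
  | abs {n : ℕ} (r : ℕ) (E : HTerm n) : HTerm n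
  /-- the application `E⟨m₀, …, m_r⟩` to `r + 1` names -/
  | app {n r : ℕ} (E : HTerm n) (m : Fin (r + 1) → ℕ) : HTerm n

/-- The renaming `ρ` below `k` name binders. -/
def liftName (k : ℕ) (ρ : ℕ → ℕ) (i : ℕ) : ℕ := if i < k then i else ρ (i - k) + k

/-- Exchange of the names of two adjacent binders. -/
def swapName : ℕ → ℕ
  | 0 => 1
  | 1 => 0
  | i => i

/-- Moves the name `k` below the `k` innermost names `0, …, k - 1`, to the innermost position. -/
def rotName (k i : ℕ) : ℕ := if i < k then i + 1 else if i = k then 0 else i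

/-- Instantiation of the `r + 1` innermost names by `m`. -/
def instName {r : ℕ} (m : Fin (r + 1) → ℕ) (i : ℕ) : ℕ :=
  if h : i < r + 1 then m ⟨i, h⟩ else i - (r + 1)

namespace HTerm

/-- Substitution of names (capture-avoiding). -/
def rename {n : ℕ} (ρ : ℕ → ℕ) : HTerm n → HTerm n
  | nil => nil
  | var X => var X
  | inp a E => inp (ρ a) (rename ρ E)
  | out a E F => out (ρ a) (rename ρ E) (rename ρ F)
  | par E F => par (rename ρ E) (rename ρ F)
  | res E => res (rename (liftName 1 ρ) E)
  | abs r E => abs r (rename (liftName (r + 1) ρ) E)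
  | app E m => app (rename ρ E) (fun i => ρ (m i))

/-- Makes room for `k` new innermost names, which do not occur in the result. -/
def shift {n : ℕ} (k : ℕ) (E : HTerm n) : HTerm n := rename (fun i => i + k) E

/-- Renaming of variables. -/
def renameVar {n m : ℕ} (ξ : Fin n → Fin m) : HTerm n → HTerm m
  | nil => nil
  | var X => var (ξ X)
  | inp a E => inp a (renameVar (Fin.cases 0 (fun i => (ξ i).succ)) E)
  | out a E F => out a (renameVar ξ E) (renameVar ξ F)
  | par E F => par (renameVar ξ E) (renameVar ξ F)
  | res E => res (renameVar ξ E)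
  | abs r E => abs r (renameVar ξ E)
  | app E k => app (renameVar ξ E) k

/-- Substitution of terms for variables (capture-avoiding). -/
def subst {n m : ℕ} (θ : Fin n → HTerm m) : HTerm n → HTerm m
  | nil => nil
  | var X => θ X
  | inp a E => inp a (subst (Fin.cases (var 0) (fun i => renameVar Fin.succ (θ i))) E)
  | out a E F => out a (subst θ E) (subst θ F)
  | par E F => par (subst θ E) (subst θ F)
  | res E => res (subst (fun i => shift 1 (θ i)) E)
  | abs r E => abs r (subst (fun i => shift (r + 1) (θ i)) E)
  | app E k => app (subst θ E) k

/-- `G[A]`, that is `G{A/X}`. -/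
def inst (G : HTerm 1) (A : HTerm 0) : HTerm 0 := subst (fun _ => A) G

/-- `a ∈ fn(E)`. -/
def Free {n : ℕ} (a : ℕ) : HTerm n → Prop
  | nil => False
  | var _ => False
  | inp b E => a = b ∨ Free a E
  | out b E F => a = b ∨ Free a E ∨ Free a F
  | par E F => Free a E ∨ Free a F
  | res E => Free (a + 1) E
  | abs r E => Free (a + (r + 1)) E
  | app E m => Free a E ∨ ∃ i, m i = a

/-- `(c₁) ⋯ (c_k) E`, binding the `k` innermost names of `E`. -/
def resN : ℕ → HTerm 0 → HTerm 0
  | 0, E => E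
  | k + 1, E => res (resN k E)

/-- The structural congruence `≡`. -/
inductive Cong : {n : ℕ} → HTerm n → HTerm n → Prop
  | refl {n : ℕ} (E : HTerm n) : Cong E E
  | symm {n : ℕ} {E F : HTerm n} : Cong E F → Cong F E
  | trans {n : ℕ} {E F G : HTerm n} : Cong E F → Cong F G → Cong E G
  | inp {n : ℕ} (a : ℕ) {E E' : HTerm (n + 1)} : Cong E E' → Cong (inp a E) (inp a E')
  | out {n : ℕ} (a : ℕ) {E E' F F' : HTerm n} :
      Cong E E' → Cong F F' → Cong (out a E F) (out a E' F')
  | par {n : ℕ} {E E' F F' : HTerm n} : Cong E E' → Cong F F' → Cong (par E F) (par E' F')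
  | res {n : ℕ} {E E' : HTerm n} : Cong E E' → Cong (res E) (res E')
  | abs {n : ℕ} (r : ℕ) {E E' : HTerm n} : Cong E E' → Cong (abs r E) (abs r E')
  | app {n r : ℕ} {E E' : HTerm n} (m : Fin (r + 1) → ℕ) : Cong E E' → Cong (app E m) (app E' m)
  | par_nil {n : ℕ} (E : HTerm n) : Cong (HTerm.par E nil) E
  | par_comm {n : ℕ} (E F : HTerm n) : Cong (HTerm.par E F) (HTerm.par F E)
  | par_assoc {n : ℕ} (E F G : HTerm n) :
      Cong (HTerm.par (HTerm.par E F) G) (HTerm.par E (HTerm.par F G))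
  /-- `(c)(d)E ≡ (d)(c)E` -/
  | res_comm {n : ℕ} (E : HTerm n) :
      Cong (HTerm.res (HTerm.res E)) (HTerm.res (HTerm.res (rename swapName E)))
  /-- `(c)(E | F) ≡ (c)E | F` for `c ∉ fn(F)` -/
  | res_par {n : ℕ} (E F : HTerm n) :
      Cong (HTerm.res (HTerm.par E (shift 1 F))) (HTerm.par (HTerm.res E) F)
  /-- `(⟨x₀, …, x_r⟩E)⟨m₀, …, m_r⟩ ≡ E{m₀/x₀, …, m_r/x_r}` -/
  | beta {n r : ℕ} (E : HTerm n) (m : Fin (r + 1) → ℕ) :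
      Cong (HTerm.app (HTerm.abs r E) m) (rename (instName m) E)

end HTerm

/-- Actions of `Π^d`. The action `out k a E₁` is the output of `E₁` on `a` with `k` extruded
bound names: `a` is a name outside the scope of these, while in `E₁`, and in the target of a
transition with this label, the names `0, …, k - 1` are the extruded ones. -/
inductive HAct : Type
  | tau : HAct
  | inp (a : ℕ) (E₁ : HTerm 0) : HAct
  | out (k a : ℕ) (E₁ : HTerm 0) : HAct

/-- The subject of an action; `τ` has none. -/
def HAct.subject : HAct → Option ℕ
  | .tau => none
  | .inp a _ => some a
  | .out _ a _ => some a

/-- The number of bound names of an action. -/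
def HAct.bound : HAct → ℕ
  | .out k _ _ => k
  | _ => 0

namespace HTerm

/-- The labelled transition system of `Π^d`. -/
inductive Step : HTerm 0 → HAct → HTerm 0 → Prop
  | inp (a : ℕ) (F : HTerm 1) (E : HTerm 0) : Step (inp a F) (.inp a E) (inst F E)
  | out (a : ℕ) (E F : HTerm 0) : Step (out a E F) (.out 0 a E) F
  | parL {E E' : HTerm 0} {l : HAct} (F : HTerm 0) (h : Step E l E') :
      Step (par E F) l (par E' (shift l.bound F))
  | parR {F F' : HTerm 0} {l : HAct} (E : HTerm 0) (h : Step F l F') :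
      Step (par E F) l (par (shift l.bound E) F')
  | comL {E E' F F' E₁ : HTerm 0} {k a : ℕ} (hE : Step (shift k E) (.inp (a + k) E₁) E')
      (hF : Step F (.out k a E₁) F') : Step (par E F) .tau (resN k (par E' F'))
  | comR {E E' F F' E₁ : HTerm 0} {k a : ℕ} (hE : Step E (.out k a E₁) E')
      (hF : Step (shift k F) (.inp (a + k) E₁) F') : Step (par E F) .tau (resN k (par E' F'))
  /-- scope opening; in the scope of the extruded names the restricted name is `k` -/
  | opn {E E' E₁ : HTerm 0} {k a : ℕ} (h : Step E (.out k (a + 1) E₁) E') (hd : Free k E₁) :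
      Step (res E) (.out (k + 1) a E₁) E'
  /-- the restricted name does not occur in the action: three cases -/
  | resTau {E E' : HTerm 0} (h : Step E .tau E') : Step (res E) .tau (res E')
  | resInp {E E' E₁ : HTerm 0} {a : ℕ} (h : Step E (.inp (a + 1) (shift 1 E₁)) E') :
      Step (res E) (.inp a E₁) (res E')
  | resOut {E E' E₁ : HTerm 0} {k a : ℕ}
      (h : Step E (.out k (a + 1) (rename (liftName k (fun i => i + 1)) E₁)) E') :
      Step (res E) (.out k a E₁) (res (rename (rotName k) E'))
  | cong {E E' F F' : HTerm 0} {l : HAct} (h : Cong F E) (hE : Step E l E') (h' : Cong E' F') :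
      Step F l F'

def Tau (E F : HTerm 0) : Prop := Step E .tau F

/-- `E ⟹ F`. -/
def Taus : HTerm 0 → HTerm 0 → Prop := Relation.ReflTransGen Tau

/-- `E ⟹ -l-> ⟹ F` (for `l = τ` at least one step). -/
def Weak (E : HTerm 0) (l : HAct) (F : HTerm 0) : Prop :=
  ∃ E₁ E₂, Taus E E₁ ∧ Step E₁ l E₂ ∧ Taus E₂ F

/-- `(c₁) ⋯ (c_k)(G[E₁] | E')`, where the `c_i` are the `k` innermost names of `E₁` and `E'` and
do not occur in `G`. -/
def plug (G : HTerm 1) (k : ℕ) (E₁ E' : HTerm 0) : HTerm 0 :=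
  resN k (par (inst (shift k G) E₁) E')

/-- `R` is a (weak) context bisimulation. -/
structure IsContextBisimulation (R : HTerm 0 → HTerm 0 → Prop) : Prop where
  symm : ∀ E F, R E F → R F E
  tau : ∀ E F E', R E F → Step E .tau E' → ∃ F', Taus F F' ∧ R E' F'
  inp : ∀ E F a E₁ E', R E F → Step E (.inp a E₁) E' →
    ∃ F', Weak F (.inp a E₁) F' ∧ R E' F'
  out : ∀ E F k a E₁ E', R E F → Step E (.out k a E₁) E' →
    ∃ l E₂ F', Weak F (.out l a E₂) F' ∧ ∀ G : HTerm 1, R (plug G k E₁ E') (plug G l E₂ F')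

def IsDivergenceSensitive (R : HTerm 0 → HTerm 0 → Prop) : Prop :=
  ∀ E F, R E F → Diverges Tau F → Diverges Tau E

/-- Divergence-sensitive context bisimilarity: the union of all divergence-sensitive context
bisimulations. -/
def Bisimilar (E F : HTerm 0) : Prop :=
  ∃ R : HTerm 0 → HTerm 0 → Prop, IsContextBisimulation R ∧ IsDivergenceSensitive R ∧ R E F

end HTerm

/-! ## Criteria for an encoding of `ℂ` into `Π^d` -/

namespace Encoding

variable (enc : CProc → HTerm 0)

def Sound : Prop := ∀ P Q, CProc.Cong P Q → HTerm.Bisimilar (enc P) (enc Q)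

def Complete : Prop := ∀ P Q, HTerm.Bisimilar (enc P) (enc Q) → CProc.Cong P Q

/-- Every operator is translated by a context that depends on the operator only. A `k`-ary context
is a term with `k` free variables as holes. -/
def Compositional : Prop :=
  ∀ op : COp, ∃ C : HTerm op.arity, ∀ P : Fin op.arity → CProc,
    enc (op.apply P) = HTerm.subst (fun i => enc (P i)) C

def NameInvariant : Prop :=
  ∀ σ : ℕ → ℕ, Function.Injective σ → ∀ P, enc (P.rename σ) = (enc P).rename σ

/-- The target `T` of an action with bound names lies in the scope of these names, whence the
shift of the encoding that it is compared with. -/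
def ForthCorrespondence : Prop :=
  ∀ P l P', CProc.Weak P l P' →
    ∃ (l' : HAct) (T : HTerm 0), l'.subject = l.subject ∧ HTerm.Weak (enc P) l' T ∧
      HTerm.Bisimilar T (HTerm.shift l'.bound (enc P'))

def BackCorrespondence : Prop :=
  ∀ P l' T, HTerm.Weak (enc P) l' T →
    ∃ (P' : CProc) (l : CAct) (T' : HTerm 0), l.subject = l'.subject ∧ CProc.Weak P l P' ∧
      HTerm.Taus T T' ∧ HTerm.Bisimilar T' (HTerm.shift l'.bound (enc P'))

def DivergenceReflecting : Prop :=
  ∀ P, Diverges HTerm.Tau (enc P) → Diverges CProc.Tau P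

end Encoding

/-! ## Renaming and substitution -/

/-! A number is translated as an abstraction of two names that performs its own case distinction by
communicating on them. `F_a^b(f)` becomes an input on `a` followed by `server`, which runs a program
for `f` in continuation-passing style and outputs the result on `b`; `Ω` becomes a process that
sends itself to itself. Parallel composition is translated homomorphically, so compositionality and
name invariance are easy.

Completeness has to recover `b` even when `f` is nowhere defined. Therefore `server` also applies
the received process to `b` alone. On a number this application is inert, the arity being wrong, but
on the unary abstraction `probe` it yields an output on `b` (`server_probe`). The same device
refutes back correspondence: probed, the server of the constant function `1` emits `0`.

Transitions of `Π^d` are closed under `≡`, so they cannot be inverted directly. Normal forms absorb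
the unit and β laws; on them commitments are defined by structure and shown to be invariant under
the remaining laws (`NCong.sim`). An output commitment matters only through its effect `plug G k M
C` on a receiver `G`, which hides how many names are extruded. `Step.commits`, `step_tau_iff`,
`step_inp_iff` and `COut.step` translate between the two views.

Compiled programs run deterministically and without visible actions, leaving only dead garbage; they
reach their continuation if the value is defined and run forever otherwise (`runSpec`).

Up to `≡_ℂ` a process of `ℂ` is a multiset of atoms together with the information whether `Ω` occurs
(`Cong.atoms_eq`, `cong_of_atoms_eq`). `Rep` relates such configurations to terms of `Π^d`, counting
the computation steps still pending. An internal step of a representing term is a pending step, a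
step of the divergent part, or a communication as in `ℂ` (`Rep.cTau`). Soundness holds because two
representations with nothing pending differ in silent parts of equal divergence only
(`bisimilar_of_silent`). Forth correspondence combines `exists_inp`, `exists_out`, `exists_comm` and
`exists_omega` with `settle`. For divergence reflection, pending steps run out and communications
lower a weight, so an infinite run requires `Ω`.

Completeness is `eq_of_bisimilar`. Outputs weigh `1` and functions `2`, hence every communication
loses weight. Bisimilar terms have equal weight (`size_le`), so a partner answering a challenge
cannot afford a communication of its own. Successive challenges then expose all data: a receiver
defined at a single number identifies a message, `probe` identifies the output name of a function,
and numeric inputs identify its graph. Once no atom is left, sensitivity to divergence detects `Ω`.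
-/

theorem liftName_zero (ρ : ℕ → ℕ) : liftName 0 ρ = ρ := by
  funext i; simp [liftName]

theorem liftName_id (k : ℕ) : liftName k (fun i => i) = fun i => i := by
  funext i; simp only [liftName]; split <;> omega

theorem liftName_comp (k : ℕ) (ρ ξ : ℕ → ℕ) :
    liftName k (fun i => ρ (ξ i)) = fun i => liftName k ρ (liftName k ξ i) := by
  funext i
  by_cases h : i < k
  · simp [liftName, h]
  · simp [liftName, h]

theorem liftName_liftName (k l : ℕ) (ρ : ℕ → ℕ) :
    liftName k (liftName l ρ) = liftName (k + l) ρ := by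
  funext i
  by_cases h : i < k
  · simp [liftName, h, Nat.lt_add_right l h]
  · by_cases h' : i < k + l
    · have : i - k < l := by omega
      simp [liftName, h, h', this]; omega
    · have : ¬ i - k < l := by omega
      have e : i - k - l = i - (k + l) := by omega
      simp [liftName, h, h', this, e]; omega

theorem liftName_add (k : ℕ) (ρ : ℕ → ℕ) (i : ℕ) : liftName k ρ (i + k) = ρ i + k := by
  simp [liftName]

theorem liftName_injective (k : ℕ) {ρ : ℕ → ℕ} (h : Function.Injective ρ) :
    Function.Injective (liftName k ρ) := by
  intro i j hij
  simp only [liftName] at hij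
  split at hij <;> split at hij
  · exact hij
  · omega
  · omega
  · have := h (Nat.add_right_cancel hij); omega

theorem swapName_swapName (i : ℕ) : swapName (swapName i) = i := by
  match i with
  | 0 => rfl
  | 1 => rfl
  | i + 2 => rfl

theorem swapName_add_two (i : ℕ) : swapName (i + 2) = i + 2 := rfl

theorem liftName_swapName (ρ : ℕ → ℕ) (i : ℕ) :
    liftName 2 ρ (swapName i) = swapName (liftName 2 ρ i) := by
  match i with
  | 0 => rfl
  | 1 => rfl
  | i + 2 => rw [swapName_add_two, liftName_add, swapName_add_two]

/-- The inductive step for moving a restriction inwards past one more binder, in `Cong.res_resN`. -/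
theorem rotName_liftName_swapName (k i : ℕ) :
    rotName k (liftName k swapName i) = rotName (k + 1) i := by
  by_cases h : i < k
  · have h1 : i < k + 1 := by omega
    simp [liftName, rotName, h, h1]
  · obtain ⟨j, rfl⟩ : ∃ j, i = j + k := ⟨i - k, by omega⟩
    rw [liftName_add]
    match j with
    | 0 => simp [swapName, rotName, Nat.add_comm]
    | 1 =>
      have : ¬ 1 + k < k + 1 := by omega
      have h2 : 1 + k = k + 1 := by omega
      simp [swapName, rotName, h2]
    | j + 2 =>
      rw [swapName_add_two]
      have h1 : ¬ j + 2 + k < k := by omega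
      have h2 : ¬ j + 2 + k < k + 1 := by omega
      have h4 : j + 2 + k ≠ k + 1 := by omega
      simp [rotName, h1, h2, h4]

theorem instName_add {r : ℕ} (m : Fin (r + 1) → ℕ) (i : ℕ) : instName m (i + (r + 1)) = i := by
  rw [instName, dif_neg (by omega), Nat.add_sub_cancel]

theorem instName_liftName {r : ℕ} (m : Fin (r + 1) → ℕ) (ρ : ℕ → ℕ) (i : ℕ) :
    instName (fun j => ρ (m j)) (liftName (r + 1) ρ i) = ρ (instName m i) := by
  by_cases h : i < r + 1
  · simp only [liftName, if_pos h, instName, dif_pos h]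
  · rw [liftName, if_neg h, instName_add, instName, dif_neg h]

namespace HTerm

theorem rename_id' {n : ℕ} (E : HTerm n) : rename (fun i => i) E = E := by
  induction E with
  | nil => rfl
  | var X => rfl
  | inp a E ih => simp [rename, ih]
  | out a E F ih1 ih2 => simp [rename, ih1, ih2]
  | par E F ih1 ih2 => simp [rename, ih1, ih2]
  | res E ih => simp [rename, liftName_id, ih]
  | abs r E ih => simp [rename, liftName_id, ih]
  | app E m ih => simp [rename, ih]

theorem rename_rename {n : ℕ} (E : HTerm n) (ρ ξ : ℕ → ℕ) :
    rename ρ (rename ξ E) = rename (fun i => ρ (ξ i)) E := by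
  induction E generalizing ρ ξ with
  | nil => rfl
  | var X => rfl
  | inp a E ih => simp [rename, ih]
  | out a E F ih1 ih2 => simp [rename, ih1, ih2]
  | par E F ih1 ih2 => simp [rename, ih1, ih2]
  | res E ih => simp [rename, ih, liftName_comp]
  | abs r E ih => simp [rename, ih, liftName_comp]
  | app E m ih => simp [rename, ih]

/-- Needed for messages in which a restricted name does not occur: such names may be renumbered at
will. -/
theorem rename_congr_of_free {n : ℕ} (E : HTerm n) {ρ ξ : ℕ → ℕ}
    (h : ∀ i, Free i E → ρ i = ξ i) : rename ρ E = rename ξ E := by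
  induction E generalizing ρ ξ with
  | nil => rfl
  | var X => rfl
  | inp a E ih =>
    simp only [rename, Free] at h ⊢
    rw [ih fun i hi => h i (Or.inr hi), h a (Or.inl rfl)]
  | out a E F ih1 ih2 =>
    simp only [rename, Free] at h ⊢
    rw [ih1 fun i hi => h i (Or.inr (Or.inl hi)), ih2 fun i hi => h i (Or.inr (Or.inr hi)),
      h a (Or.inl rfl)]
  | par E F ih1 ih2 =>
    simp only [rename, Free] at h ⊢
    rw [ih1 fun i hi => h i (Or.inl hi), ih2 fun i hi => h i (Or.inr hi)]
  | res E ih =>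
    simp only [rename, Free] at h ⊢
    rw [ih]
    intro i hi
    simp only [liftName]
    split
    · rfl
    · rw [h (i - 1)]
      rwa [Nat.sub_add_cancel (by omega)]
  | abs r E ih =>
    simp only [rename, Free] at h ⊢
    rw [ih]
    intro i hi
    simp only [liftName]
    split
    · rfl
    · rw [h (i - (r + 1))]
      rwa [Nat.sub_add_cancel (by omega)]
  | app E m ih =>
    simp only [rename, Free] at h ⊢
    rw [ih fun i hi => h i (Or.inl hi)]
    congr 1
    funext i
    exact h _ (Or.inr ⟨i, rfl⟩)

theorem shift_zero {n : ℕ} (E : HTerm n) : shift 0 E = E := rename_id' E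

theorem shift_shift {n : ℕ} (k l : ℕ) (E : HTerm n) : shift k (shift l E) = shift (l + k) E := by
  simp only [shift, rename_rename, Nat.add_assoc]

theorem rename_shift {n : ℕ} (k : ℕ) (ρ : ℕ → ℕ) (E : HTerm n) :
    rename (liftName k ρ) (shift k E) = shift k (rename ρ E) := by
  simp only [shift, rename_rename, liftName_add]

theorem rename_shift_of {n : ℕ} {k l : ℕ} {ρ : ℕ → ℕ} (h : ∀ i, ρ (i + k) = i + l) (E : HTerm n) :
    rename ρ (shift k E) = shift l E := by
  simp only [shift, rename_rename, h]

theorem rename_renameVar {n m : ℕ} (E : HTerm n) (ρ : ℕ → ℕ) (ξ : Fin n → Fin m) :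
    rename ρ (renameVar ξ E) = renameVar ξ (rename ρ E) := by
  induction E generalizing ρ m with
  | nil => rfl
  | var X => rfl
  | inp a E ih => simp [rename, renameVar, ih]
  | out a E F ih1 ih2 => simp [rename, renameVar, ih1, ih2]
  | par E F ih1 ih2 => simp [rename, renameVar, ih1, ih2]
  | res E ih => simp [rename, renameVar, ih]
  | abs r E ih => simp [rename, renameVar, ih]
  | app E m ih => simp [rename, renameVar, ih]

theorem renameVar_eq_subst {n m : ℕ} (E : HTerm n) (ξ : Fin n → Fin m) :
    renameVar ξ E = subst (fun i => var (ξ i)) E := by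
  induction E generalizing m with
  | nil => rfl
  | var X => rfl
  | inp a E ih =>
    simp only [renameVar, subst, ih]
    congr 2
    funext i
    refine Fin.cases ?_ (fun i => ?_) i <;> rfl
  | out a E F ih1 ih2 => simp [renameVar, subst, ih1, ih2]
  | par E F ih1 ih2 => simp [renameVar, subst, ih1, ih2]
  | res E ih => simp [renameVar, subst, ih, shift, rename]
  | abs r E ih => simp [renameVar, subst, ih, shift, rename]
  | app E m ih => simp [renameVar, subst, ih]

/-- The substitution `θ` below a variable binder. -/
def up {n m : ℕ} (θ : Fin n → HTerm m) : Fin (n + 1) → HTerm (m + 1) :=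
  Fin.cases (var 0) (fun i => renameVar Fin.succ (θ i))

@[simp] theorem up_succ {n m : ℕ} (θ : Fin n → HTerm m) (i : Fin n) :
    up θ i.succ = renameVar Fin.succ (θ i) := rfl

theorem subst_inp {n m : ℕ} (θ : Fin n → HTerm m) (a : ℕ) (E : HTerm (n + 1)) :
    subst θ (inp a E) = inp a (subst (up θ) E) := rfl

theorem subst_renameVar {n m l : ℕ} (E : HTerm n) (ξ : Fin n → Fin m) (θ : Fin m → HTerm l) :
    subst θ (renameVar ξ E) = subst (fun i => θ (ξ i)) E := by
  induction E generalizing m l with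
  | nil => rfl
  | var X => rfl
  | inp a E ih =>
    simp only [renameVar, subst_inp, ih]
    congr 2
    funext i
    refine Fin.cases ?_ (fun i => ?_) i <;> rfl
  | out a E F ih1 ih2 => simp [renameVar, subst, ih1, ih2]
  | par E F ih1 ih2 => simp [renameVar, subst, ih1, ih2]
  | res E ih => simp [renameVar, subst, ih]
  | abs r E ih => simp [renameVar, subst, ih]
  | app E m ih => simp [renameVar, subst, ih]

theorem renameVar_renameVar {n m l : ℕ} (E : HTerm n) (ξ : Fin n → Fin m) (ζ : Fin m → Fin l) :
    renameVar ζ (renameVar ξ E) = renameVar (fun i => ζ (ξ i)) E := by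
  rw [renameVar_eq_subst _ ζ, subst_renameVar, renameVar_eq_subst]

theorem shift_renameVar {n m : ℕ} (k : ℕ) (ξ : Fin n → Fin m) (E : HTerm n) :
    shift k (renameVar ξ E) = renameVar ξ (shift k E) := rename_renameVar _ _ _

theorem renameVar_subst {n m l : ℕ} (E : HTerm n) (θ : Fin n → HTerm m) (ξ : Fin m → Fin l) :
    renameVar ξ (subst θ E) = subst (fun i => renameVar ξ (θ i)) E := by
  induction E generalizing m l with
  | nil => rfl
  | var X => rfl
  | inp a E ih =>
    simp only [renameVar, subst_inp, ih]
    congr 2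
    funext i
    refine Fin.cases ?_ (fun i => ?_) i
    · rfl
    · simp only [up_succ, renameVar_renameVar]; rfl
  | out a E F ih1 ih2 => simp [renameVar, subst, ih1, ih2]
  | par E F ih1 ih2 => simp [renameVar, subst, ih1, ih2]
  | res E ih => simp [renameVar, subst, ih, shift_renameVar]
  | abs r E ih => simp [renameVar, subst, ih, shift_renameVar]
  | app E m ih => simp [renameVar, subst, ih]

theorem rename_subst {n m : ℕ} (E : HTerm n) (θ : Fin n → HTerm m) (ρ : ℕ → ℕ) :
    rename ρ (subst θ E) = subst (fun i => rename ρ (θ i)) (rename ρ E) := by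
  induction E generalizing m ρ with
  | nil => rfl
  | var X => rfl
  | inp a E ih =>
    simp only [rename, subst_inp, ih]
    congr 2
    funext i
    refine Fin.cases ?_ (fun i => ?_) i
    · rfl
    · simp only [up_succ, rename_renameVar]
  | out a E F ih1 ih2 => simp [rename, subst, ih1, ih2]
  | par E F ih1 ih2 => simp [rename, subst, ih1, ih2]
  | res E ih => simp [rename, subst, ih, rename_shift]
  | abs r E ih => simp [rename, subst, ih, rename_shift]
  | app E m ih => simp [rename, subst, ih]

theorem shift_subst {n m : ℕ} (k : ℕ) (θ : Fin n → HTerm m) (E : HTerm n) :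
    shift k (subst θ E) = subst (fun i => shift k (θ i)) (shift k E) := rename_subst _ _ _

/-- Below an input, lifted variables are treated by `subst_renameVar` and `renameVar_subst`; below a
name binder the shifts move by `shift_subst`. -/
theorem subst_subst {n m l : ℕ} (E : HTerm n) (θ : Fin n → HTerm m) (η : Fin m → HTerm l) :
    subst η (subst θ E) = subst (fun i => subst η (θ i)) E := by
  induction E generalizing m l with
  | nil => rfl
  | var X => rfl
  | inp a E ih =>
    simp only [subst_inp, ih]
    congr 2
    funext i
    refine Fin.cases ?_ (fun i => ?_) i
    · rfl
    · simp only [up_succ, subst_renameVar, renameVar_subst]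
  | out a E F ih1 ih2 => simp [subst, ih1, ih2]
  | par E F ih1 ih2 => simp [subst, ih1, ih2]
  | res E ih => simp [subst, ih, shift_subst]
  | abs r E ih => simp [subst, ih, shift_subst]
  | app E m ih => simp [subst, ih]

theorem up_var {n : ℕ} : up (var : Fin n → HTerm n) = var := by
  funext i
  refine Fin.cases ?_ (fun i => ?_) i <;> rfl

theorem subst_var {n : ℕ} (E : HTerm n) : subst var E = E := by
  induction E with
  | nil => rfl
  | var X => rfl
  | inp a E ih =>
    rw [subst_inp, up_var, ih]
  | out a E F ih1 ih2 => simp [subst, ih1, ih2]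
  | par E F ih1 ih2 => simp [subst, ih1, ih2]
  | res E ih => simpa [subst, shift, rename] using ih
  | abs r E ih => simpa [subst, shift, rename] using ih
  | app E m ih => simp [subst, ih]

theorem subst_closed (θ : Fin 0 → HTerm 0) (E : HTerm 0) : subst θ E = E := by
  rw [show θ = var from funext fun i => i.elim0, subst_var]

/-! ### Contexts with one hole -/

/-- The closed term `F` as a context that ignores its argument. -/
def const (F : HTerm 0) : HTerm 1 := renameVar Fin.elim0 F

theorem inst_const (F A : HTerm 0) : inst (const F) A = F := by
  rw [inst, const, subst_renameVar, subst_closed]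

theorem rename_const (ρ : ℕ → ℕ) (F : HTerm 0) : rename ρ (const F) = const (rename ρ F) :=
  rename_renameVar _ _ _

theorem rename_inst (ρ : ℕ → ℕ) (G : HTerm 1) (A : HTerm 0) :
    rename ρ (inst G A) = inst (rename ρ G) (rename ρ A) := rename_subst _ _ _

theorem shift_inst (k : ℕ) (G : HTerm 1) (A : HTerm 0) :
    shift k (inst G A) = inst (shift k G) (shift k A) := rename_inst _ _ _

theorem shift_const (k : ℕ) (F : HTerm 0) : shift k (const F) = const (shift k F) :=
  rename_const _ _

theorem rename_resN (ρ : ℕ → ℕ) (k : ℕ) (E : HTerm 0) :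
    rename ρ (resN k E) = resN k (rename (liftName k ρ) E) := by
  induction k generalizing ρ with
  | zero => simp [resN, liftName_zero]
  | succ k ih => simp [resN, rename, ih, liftName_liftName]

theorem rename_plug (ρ : ℕ → ℕ) (G : HTerm 1) (k : ℕ) (M C : HTerm 0) :
    rename ρ (plug G k M C) =
      plug (rename ρ G) k (rename (liftName k ρ) M) (rename (liftName k ρ) C) := by
  simp [plug, rename_resN, rename, rename_inst, rename_shift]

/-! ## Closure properties of the structural congruence -/

theorem Cong.rename {n : ℕ} {E F : HTerm n} (h : Cong E F) (ρ : ℕ → ℕ) :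
    Cong (E.rename ρ) (F.rename ρ) := by
  induction h generalizing ρ with
  | refl => exact .refl _
  | symm _ ih => exact .symm (ih ρ)
  | trans _ _ ih1 ih2 => exact .trans (ih1 ρ) (ih2 ρ)
  | inp a _ ih => exact .inp _ (ih ρ)
  | out a _ _ ih1 ih2 => exact .out _ (ih1 ρ) (ih2 ρ)
  | par _ _ ih1 ih2 => exact .par (ih1 ρ) (ih2 ρ)
  | res _ ih => exact .res (ih _)
  | abs r _ ih => exact .abs r (ih _)
  | app m _ ih => exact .app _ (ih _)
  | par_nil E => exact .par_nil _
  | par_comm E F => exact .par_comm _ _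
  | par_assoc E F G => exact .par_assoc _ _ _
  | res_comm E =>
    simp only [HTerm.rename, rename_rename, liftName_liftName]
    have := Cong.res_comm (HTerm.rename (liftName 2 ρ) E)
    simpa only [rename_rename, ← liftName_swapName] using this
  | res_par E F =>
    simp only [HTerm.rename, rename_shift]
    exact .res_par _ _
  | @beta _ r E m =>
    simp only [HTerm.rename, rename_rename, ← instName_liftName]
    have := Cong.beta (HTerm.rename (liftName (r + 1) ρ) E) (fun j => ρ (m j))
    simpa only [rename_rename] using this

theorem Cong.shift {n : ℕ} {E F : HTerm n} (h : Cong E F) (k : ℕ) :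
    Cong (E.shift k) (F.shift k) := h.rename _

theorem Cong.subst {n m : ℕ} {E F : HTerm n} (h : Cong E F) (θ : Fin n → HTerm m) :
    Cong (E.subst θ) (F.subst θ) := by
  induction h generalizing m with
  | refl => exact .refl _
  | symm _ ih => exact .symm (ih θ)
  | trans _ _ ih1 ih2 => exact .trans (ih1 θ) (ih2 θ)
  | inp a _ ih => exact .inp _ (ih _)
  | out a _ _ ih1 ih2 => exact .out _ (ih1 θ) (ih2 θ)
  | par _ _ ih1 ih2 => exact .par (ih1 θ) (ih2 θ)
  | res _ ih => exact .res (ih _)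
  | abs r _ ih => exact .abs r (ih _)
  | app m _ ih => exact .app _ (ih _)
  | par_nil E => exact .par_nil _
  | par_comm E F => exact .par_comm _ _
  | par_assoc E F G => exact .par_assoc _ _ _
  | res_comm E =>
    simp only [HTerm.subst, shift_shift]
    have := Cong.res_comm (HTerm.subst (fun i => HTerm.shift (1 + 1) (θ i)) E)
    rw [rename_subst] at this
    simpa only [rename_shift_of swapName_add_two] using this
  | res_par E F =>
    simp only [HTerm.subst, ← shift_subst]
    exact .res_par _ _
  | @beta _ r E k =>
    simp only [HTerm.subst]
    refine (Cong.beta _ k).trans ?_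
    rw [rename_subst]
    have : ∀ i, HTerm.rename (instName k) (HTerm.shift (r + 1) (θ i)) = θ i := fun i => by
      rw [rename_shift_of (l := 0) (instName_add k), shift_zero]
    simp only [this]
    exact .refl _

theorem subst_cong {n m : ℕ} (E : HTerm n) {θ η : Fin n → HTerm m} (h : ∀ i, Cong (θ i) (η i)) :
    Cong (subst θ E) (subst η E) := by
  induction E generalizing m with
  | nil => exact .refl _
  | var X => exact h X
  | inp a E ih =>
    refine .inp _ (ih fun i => ?_)
    refine Fin.cases (.refl _) (fun i => ?_) i
    simp only [Fin.cases_succ, renameVar_eq_subst]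
    exact (h i).subst _
  | out a E F ih1 ih2 => exact .out _ (ih1 h) (ih2 h)
  | par E F ih1 ih2 => exact .par (ih1 h) (ih2 h)
  | res E ih => exact .res (ih fun i => (h i).shift 1)
  | abs r E ih => exact .abs _ (ih fun i => (h i).shift _)
  | app E m ih => exact .app _ (ih h)

theorem Cong.inst {G G' : HTerm 1} {A A' : HTerm 0} (h : Cong G G') (h' : Cong A A') :
    Cong (G.inst A) (G'.inst A') :=
  (h.subst _).trans (subst_cong _ fun _ => h')

theorem Cong.const {E F : HTerm 0} (h : Cong E F) : Cong (HTerm.const E) (HTerm.const F) := by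
  simp only [HTerm.const, renameVar_eq_subst]; exact h.subst _

theorem Cong.resN {E F : HTerm 0} (h : Cong E F) (k : ℕ) : Cong (resN k E) (resN k F) := by
  induction k with
  | zero => exact h
  | succ k ih => exact ih.res

theorem Cong.plug {G G' : HTerm 1} {M M' C C' : HTerm 0} (k : ℕ) (hG : Cong G G')
    (hM : Cong M M') (hC : Cong C C') : Cong (plug G k M C) (plug G' k M' C') :=
  ((((hG.shift k).inst hM).par hC)).resN k

theorem Cong.nil_par {n : ℕ} (E : HTerm n) : Cong (HTerm.par nil E) E :=
  (Cong.par_comm _ _).trans (.par_nil _)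

theorem Cong.parL {n : ℕ} {E E' : HTerm n} (h : Cong E E') (F : HTerm n) :
    Cong (HTerm.par E F) (HTerm.par E' F) := h.par (.refl _)

theorem Cong.parR {n : ℕ} (E : HTerm n) {F F' : HTerm n} (h : Cong F F') :
    Cong (HTerm.par E F) (HTerm.par E F') := .par (.refl _) h

theorem Cong.par_left_comm {n : ℕ} (E F G : HTerm n) :
    Cong (HTerm.par E (HTerm.par F G)) (HTerm.par F (HTerm.par E G)) :=
  (Cong.par_assoc _ _ _).symm.trans (((Cong.par_comm _ _).parL _).trans (.par_assoc _ _ _))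

theorem Cong.par_right_comm {n : ℕ} (E F G : HTerm n) :
    Cong (HTerm.par (HTerm.par E F) G) (HTerm.par (HTerm.par E G) F) :=
  (Cong.par_assoc _ _ _).trans (((Cong.par_comm _ _).parR _).trans (Cong.par_assoc _ _ _).symm)

theorem Cong.par_par_par_comm {n : ℕ} (A B C D : HTerm n) :
    Cong (HTerm.par (HTerm.par A B) (HTerm.par C D))
      (HTerm.par (HTerm.par A C) (HTerm.par B D)) :=
  (Cong.par_assoc _ _ _).trans
    (((Cong.par_left_comm _ _ _).parR _).trans (Cong.par_assoc _ _ _).symm)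

theorem Cong.res_par' {n : ℕ} (F E : HTerm n) :
    Cong (HTerm.res (HTerm.par (HTerm.shift 1 F) E)) (HTerm.par F (HTerm.res E)) :=
  (Cong.par_comm _ _).res.trans ((Cong.res_par _ _).trans (.par_comm _ _))

/-! ### Scope laws for several restrictions and for `plug` -/

theorem Cong.resN_par (k : ℕ) (E F : HTerm 0) :
    Cong (HTerm.resN k (HTerm.par E (HTerm.shift k F))) (HTerm.par (HTerm.resN k E) F) := by
  induction k generalizing F with
  | zero => simp only [HTerm.resN, shift_zero]; exact .refl _
  | succ k ih =>
    simp only [HTerm.resN]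
    rw [show HTerm.shift (k + 1) F = HTerm.shift k (HTerm.shift 1 F) by
      rw [shift_shift, Nat.add_comm]]
    exact (ih _).res.trans (.res_par _ _)

theorem Cong.resN_par' (k : ℕ) (F E : HTerm 0) :
    Cong (HTerm.resN k (HTerm.par (HTerm.shift k F) E)) (HTerm.par F (HTerm.resN k E)) :=
  ((Cong.par_comm _ _).resN k).trans ((Cong.resN_par _ _ _).trans (.par_comm _ _))

/-- Iterated exchange of adjacent restrictions; `rotName` is the resulting renumbering. -/
theorem Cong.res_resN (k : ℕ) (E : HTerm 0) :
    Cong (HTerm.res (HTerm.resN k E))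
      (HTerm.resN k (HTerm.res (HTerm.rename (rotName k) E))) := by
  induction k generalizing E with
  | zero =>
    have : rotName 0 = fun i => i := by funext i; simp only [rotName]; split <;> simp_all
    simp only [HTerm.resN, this, rename_id']
    exact .refl _
  | succ k ih =>
    simp only [HTerm.resN]
    refine (Cong.res_comm _).trans ?_
    rw [rename_resN]
    refine (ih _).res.trans ?_
    simp only [rename_rename, rotName_liftName_swapName]
    exact .refl _

/-- A component beside the sender does not know the extruded names, so it leaves their scope. -/
theorem plug_par (G : HTerm 1) (k : ℕ) (M C F : HTerm 0) :
    Cong (plug G k M (par C (shift k F))) (par (plug G k M C) F) :=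
  ((Cong.par_assoc _ _ _).symm.resN k).trans (.resN_par _ _ _)

theorem plug_par' (G : HTerm 1) (k : ℕ) (M C F : HTerm 0) :
    Cong (plug G k M (par (shift k F) C)) (par F (plug G k M C)) :=
  (Cong.plug k (.refl _) (.refl _) (.par_comm _ _)).trans ((plug_par _ _ _ _ _).trans
    (.par_comm _ _))

theorem plug_par_const (G : HTerm 1) (k : ℕ) (M C F : HTerm 0) :
    Cong (plug (par G (const F)) k M C) (par (plug G k M C) F) := by
  simp only [plug]
  have : inst (shift k (par G (const F))) M = par (inst (shift k G) M) (shift k F) := by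
    change par _ (inst (shift k (const F)) M) = _
    rw [shift_const, inst_const]
    rfl
  rw [this]
  exact ((Cong.par_right_comm _ _ _).resN k).trans (.resN_par _ _ _)

theorem plug_const_par (G : HTerm 1) (k : ℕ) (M C F : HTerm 0) :
    Cong (plug (par (const F) G) k M C) (par F (plug G k M C)) :=
  (Cong.plug k (.par_comm _ _) (.refl _) (.refl _)).trans ((plug_par_const _ _ _ _ _).trans
    (.par_comm _ _))

theorem rename_rotName_lift {n : ℕ} (k : ℕ) (M : HTerm n) :
    rename (rotName k) (rename (liftName k (fun i => i + 1)) M) = shift 1 M := by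
  rw [rename_rename, shift]
  congr 1
  funext i
  simp only [liftName, rotName]
  split
  · simp_all
  · rw [if_neg (by omega), if_neg (by omega)]; omega

theorem plug_succ (G : HTerm 1) (k : ℕ) (M C : HTerm 0) :
    plug G (k + 1) M C = res (plug (shift 1 G) k M C) := by
  simp only [plug, resN, shift_shift, Nat.add_comm]

/-- A restricted name absent from the message can stay with the sender's continuation. This
reconciles `Step.resOut` with commitments, which extrude every restriction. -/
theorem plug_res_cont (G : HTerm 1) (k : ℕ) (M C : HTerm 0) :
    Cong (res (plug (shift 1 G) k (rename (liftName k (fun i => i + 1)) M) C))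
      (plug G k M (res (rename (rotName k) C))) := by
  simp only [plug]
  refine (Cong.res_resN _ _).trans (.resN ?_ k)
  simp only [rename, rename_inst, rename_rotName_lift]
  have : rename (rotName k) (shift k (shift 1 G)) = shift 1 (shift k G) := by
    simp only [shift, rename_rename]
    congr 1
    funext i
    simp only [rotName]
    rw [if_neg (by omega), if_neg (by omega)]; omega
  rw [this, ← shift_inst]
  exact .res_par' _ _

theorem plug_res (G : HTerm 1) (k : ℕ) (M C : HTerm 0) :
    Cong (plug (res G) k M C)
      (res (plug G k (rename (liftName k (fun i => i + 1)) M)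
        (rename (liftName k (fun i => i + 1)) C))) := by
  refine .symm ?_
  simp only [plug]
  refine (Cong.res_resN _ _).trans (.resN ?_ k)
  simp only [rename, rename_inst, rename_rotName_lift]
  refine (Cong.res_par _ _).trans (.parL ?_ _)
  have : rename (rotName k) (shift k G) = rename (liftName 1 (fun i => i + k)) G := by
    simp only [shift, rename_rename]
    congr 1
    funext i
    simp only [rotName, liftName]
    rw [if_neg (by omega)]
    split <;> split <;> omega
  rw [this]
  exact .refl _

end HTerm

/-! ## Normal forms

`nf` contracts the applications and removes the inactive processes that are not below a prefix. -/

namespace HTerm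

open Classical in
/-- Parallel composition with `nil` as a unit. -/
noncomputable def npar {n : ℕ} (E F : HTerm n) : HTerm n :=
  if E = nil then F else if F = nil then E else par E F

/-- Application, contracted if possible. -/
def napp {n r : ℕ} (E : HTerm n) (m : Fin (r + 1) → ℕ) : HTerm n :=
  match E with
  | abs r' E₀ => if r' = r then rename (instName m) E₀ else app (abs r' E₀) m
  | E => app E m

noncomputable def nf {n : ℕ} : HTerm n → HTerm n
  | nil => nil
  | var X => var X
  | inp a E => inp a E
  | out a E F => out a E F
  | par E F => npar (nf E) (nf F)
  | res E => res (nf E)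
  | abs r E => abs r (nf E)
  | app E m => napp (nf E) m

/-- Structural congruence of normal forms. -/
inductive NCong : {n : ℕ} → HTerm n → HTerm n → Prop
  | refl {n : ℕ} (E : HTerm n) : NCong E E
  | symm {n : ℕ} {E F : HTerm n} : NCong E F → NCong F E
  | trans {n : ℕ} {E F G : HTerm n} : NCong E F → NCong F G → NCong E G
  | inp {n : ℕ} (a : ℕ) {E E' : HTerm (n + 1)} : Cong E E' → NCong (inp a E) (inp a E')
  | out {n : ℕ} (a : ℕ) {E E' F F' : HTerm n} :
      Cong E E' → Cong F F' → NCong (out a E F) (out a E' F')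
  | par {n : ℕ} {E E' F F' : HTerm n} : NCong E E' → NCong F F' → NCong (par E F) (par E' F')
  | res {n : ℕ} {E E' : HTerm n} : NCong E E' → NCong (res E) (res E')
  | abs {n : ℕ} (r : ℕ) {E E' : HTerm n} : NCong E E' → NCong (abs r E) (abs r E')
  | app {n r : ℕ} {E E' : HTerm n} (m : Fin (r + 1) → ℕ) :
      NCong E E' → NCong (app E m) (app E' m)
  | par_comm {n : ℕ} (E F : HTerm n) : NCong (HTerm.par E F) (HTerm.par F E)
  | par_assoc {n : ℕ} (E F G : HTerm n) :
      NCong (HTerm.par (HTerm.par E F) G) (HTerm.par E (HTerm.par F G))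
  | res_comm {n : ℕ} (E : HTerm n) :
      NCong (HTerm.res (HTerm.res E)) (HTerm.res (HTerm.res (rename swapName E)))
  | res_par {n : ℕ} (E F : HTerm n) :
      NCong (HTerm.res (HTerm.par E (shift 1 F))) (HTerm.par (HTerm.res E) F)
  | res_shift {n : ℕ} (F : HTerm n) :
      NCong (HTerm.res (shift 1 F)) (HTerm.par (HTerm.res nil) F)

theorem NCong.cong {n : ℕ} {E F : HTerm n} (h : NCong E F) : Cong E F := by
  induction h with
  | refl => exact .refl _
  | symm _ ih => exact .symm ih
  | trans _ _ ih1 ih2 => exact .trans ih1 ih2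
  | inp a h => exact .inp _ h
  | out a h1 h2 => exact .out _ h1 h2
  | par _ _ ih1 ih2 => exact .par ih1 ih2
  | res _ ih => exact .res ih
  | abs r _ ih => exact .abs r ih
  | app m _ ih => exact .app _ ih
  | par_comm E F => exact .par_comm _ _
  | par_assoc E F G => exact .par_assoc _ _ _
  | res_comm E => exact .res_comm _
  | res_par E F => exact .res_par _ _
  | res_shift F => exact (Cong.nil_par _).symm.res.trans (.res_par _ _)

theorem NCong.rename {n : ℕ} {E F : HTerm n} (h : NCong E F) (ρ : ℕ → ℕ) :
    NCong (E.rename ρ) (F.rename ρ) := by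
  induction h generalizing ρ with
  | refl => exact .refl _
  | symm _ ih => exact .symm (ih ρ)
  | trans _ _ ih1 ih2 => exact .trans (ih1 ρ) (ih2 ρ)
  | inp a h => exact .inp _ (h.rename ρ)
  | out a h1 h2 => exact .out _ (h1.rename ρ) (h2.rename ρ)
  | par _ _ ih1 ih2 => exact .par (ih1 ρ) (ih2 ρ)
  | res _ ih => exact .res (ih _)
  | abs r _ ih => exact .abs r (ih _)
  | app m _ ih => exact .app _ (ih _)
  | par_comm E F => exact .par_comm _ _
  | par_assoc E F G => exact .par_assoc _ _ _
  | res_comm E =>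
    simp only [HTerm.rename, rename_rename, liftName_liftName]
    have := NCong.res_comm (HTerm.rename (liftName 2 ρ) E)
    simpa only [rename_rename, ← liftName_swapName] using this
  | res_par E F =>
    simp only [HTerm.rename, rename_shift]
    exact .res_par _ _
  | res_shift F =>
    simp only [HTerm.rename, rename_shift]
    exact .res_shift _

/-- No law on normal forms creates or erases an inactive process; hence `npar` takes the same branch
on both sides. -/
theorem NCong.nil_iff {n : ℕ} {E F : HTerm n} (h : NCong E F) : E = nil ↔ F = nil := by
  induction h with
  | refl => rfl
  | symm _ ih => exact ih.symm
  | trans _ _ ih1 ih2 => exact ih1.trans ih2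
  | _ => simp

/-- Ensures that `napp` contracts on both sides or on neither. Both directions are carried along for
the sake of symmetry. -/
theorem NCong.abs_inv {n : ℕ} {E F : HTerm n} (h : NCong E F) :
    (∀ r E₀, E = HTerm.abs r E₀ → ∃ F₀, F = HTerm.abs r F₀ ∧ NCong E₀ F₀) ∧
      (∀ r F₀, F = HTerm.abs r F₀ → ∃ E₀, E = HTerm.abs r E₀ ∧ NCong F₀ E₀) := by
  induction h with
  | refl E => exact ⟨fun r E₀ h => ⟨E₀, h, .refl _⟩, fun r E₀ h => ⟨E₀, h, .refl _⟩⟩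
  | symm _ ih => exact ih.symm
  | trans _ _ ih1 ih2 =>
    constructor
    · intro r E₀ h
      obtain ⟨F₀, h1, h2⟩ := ih1.1 r E₀ h
      obtain ⟨G₀, h3, h4⟩ := ih2.1 r F₀ h1
      exact ⟨G₀, h3, h2.trans h4⟩
    · intro r E₀ h
      obtain ⟨F₀, h1, h2⟩ := ih2.2 r E₀ h
      obtain ⟨G₀, h3, h4⟩ := ih1.2 r F₀ h1
      exact ⟨G₀, h3, h2.trans h4⟩
  | abs r h =>
    constructor
    · rintro r' E₀ h'
      cases h'
      exact ⟨_, rfl, h⟩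
    · rintro r' E₀ h'
      cases h'
      exact ⟨_, rfl, h.symm⟩
  | _ => simp

theorem npar_nil {n : ℕ} (E : HTerm n) : npar E nil = E := by
  by_cases h : E = nil <;> simp [npar, h]

theorem nil_npar {n : ℕ} (E : HTerm n) : npar nil E = E := by simp [npar]

theorem npar_of_ne {n : ℕ} {E F : HTerm n} (hE : E ≠ nil) (hF : F ≠ nil) :
    npar E F = par E F := by simp [npar, hE, hF]

theorem NCong.npar {n : ℕ} {E E' F F' : HTerm n} (h : NCong E E') (h' : NCong F F') :
    NCong (npar E F) (npar E' F') := by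
  have h1 := h.nil_iff
  have h2 := h'.nil_iff
  by_cases hE : E = nil
  · rw [hE, h1.1 hE, nil_npar, nil_npar]; exact h'
  by_cases hF : F = nil
  · rw [hF, h2.1 hF, npar_nil, npar_nil]; exact h
  rw [npar_of_ne hE hF, npar_of_ne (fun h => hE (h1.2 h)) (fun h => hF (h2.2 h))]
  exact h.par h'

theorem NCong.napp {n r : ℕ} {E E' : HTerm n} (m : Fin (r + 1) → ℕ) (h : NCong E E') :
    NCong (napp E m) (napp E' m) := by
  by_cases hE : ∃ r' E₀, E = HTerm.abs r' E₀
  · obtain ⟨r', E₀, rfl⟩ := hE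
    obtain ⟨F₀, rfl, h'⟩ := h.abs_inv.1 r' E₀ rfl
    simp only [HTerm.napp]
    split
    · exact h'.rename _
    · exact h.app m
  · have hE' : ¬ ∃ r' E₀, E' = HTerm.abs r' E₀ := by
      rintro ⟨r', E₀, rfl⟩
      obtain ⟨F₀, rfl, -⟩ := h.abs_inv.2 r' E₀ rfl
      exact hE ⟨_, _, rfl⟩
    have aux : ∀ F : HTerm n, (¬ ∃ r' F₀, F = HTerm.abs r' F₀) →
        HTerm.napp F m = HTerm.app F m := by
      intro F hF
      cases F <;> first | rfl | exact absurd ⟨_, _, rfl⟩ hF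
    rw [aux E hE, aux E' hE']
    exact h.app m

theorem rename_eq_nil {n : ℕ} (ρ : ℕ → ℕ) (E : HTerm n) : rename ρ E = nil ↔ E = nil := by
  cases E <;> simp [rename]

theorem rename_npar {n : ℕ} (ρ : ℕ → ℕ) (E F : HTerm n) :
    rename ρ (npar E F) = npar (rename ρ E) (rename ρ F) := by
  by_cases hE : E = nil
  · simp [hE, nil_npar, rename]
  by_cases hF : F = nil
  · simp [hF, npar_nil, rename]
  rw [npar_of_ne hE hF, npar_of_ne (by rwa [Ne, rename_eq_nil]) (by rwa [Ne, rename_eq_nil])]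
  rfl

theorem rename_napp {n r : ℕ} (ρ : ℕ → ℕ) (E : HTerm n) (m : Fin (r + 1) → ℕ) :
    rename ρ (napp E m) = napp (rename ρ E) (fun i => ρ (m i)) := by
  cases E with
  | abs r' E₀ =>
    simp only [napp, rename]
    split
    · subst r'
      simp only [rename_rename, instName_liftName]
    · rfl
  | _ => rfl

theorem nf_rename {n : ℕ} (E : HTerm n) (ρ : ℕ → ℕ) : nf (rename ρ E) = rename ρ (nf E) := by
  induction E generalizing ρ with
  | nil => rfl
  | var X => rfl
  | inp a E ih => rfl
  | out a E F ih1 ih2 => rfl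
  | par E F ih1 ih2 => simp [rename, nf, rename_npar, ih1, ih2]
  | res E ih => simp [rename, nf, ih]
  | abs r E ih => simp [rename, nf, ih]
  | app E m ih => simp [rename, nf, ih, rename_napp]

theorem nf_shift {n : ℕ} (k : ℕ) (E : HTerm n) : nf (shift k E) = shift k (nf E) :=
  nf_rename _ _

theorem cong_npar {n : ℕ} (E F : HTerm n) : Cong (par E F) (npar E F) := by
  by_cases hE : E = nil
  · subst hE; rw [nil_npar]; exact .nil_par _
  by_cases hF : F = nil
  · subst hF; rw [npar_nil]; exact .par_nil _
  rw [npar_of_ne hE hF]; exact .refl _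

theorem cong_napp {n r : ℕ} (E : HTerm n) (m : Fin (r + 1) → ℕ) :
    Cong (app E m) (napp E m) := by
  cases E with
  | abs r' E₀ =>
    simp only [napp]
    split
    · subst r'; exact .beta _ _
    · exact .refl _
  | _ => exact .refl _

theorem cong_nf {n : ℕ} (E : HTerm n) : Cong E (nf E) := by
  induction E with
  | nil => exact .refl _
  | var X => exact .refl _
  | inp a E ih => exact .refl _
  | out a E F ih1 ih2 => exact .refl _
  | par E F ih1 ih2 => exact (ih1.par ih2).trans (cong_npar _ _)
  | res E ih => exact ih.res
  | abs r E ih => exact ih.abs r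
  | app E m ih => exact (ih.app m).trans (cong_napp _ _)

theorem NCong.npar_comm {n : ℕ} (E F : HTerm n) : NCong (HTerm.npar E F) (HTerm.npar F E) := by
  by_cases hE : E = nil
  · subst hE; rw [nil_npar, npar_nil]; exact .refl _
  by_cases hF : F = nil
  · subst hF; rw [nil_npar, npar_nil]; exact .refl _
  rw [npar_of_ne hE hF, npar_of_ne hF hE]; exact .par_comm _ _

theorem npar_ne_nil {n : ℕ} {E F : HTerm n} (hE : E ≠ nil) : npar E F ≠ nil := by
  by_cases hF : F = nil
  · subst hF; rwa [npar_nil]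
  rw [npar_of_ne hE hF]; simp

theorem NCong.npar_assoc {n : ℕ} (E F G : HTerm n) :
    NCong (HTerm.npar (HTerm.npar E F) G) (HTerm.npar E (HTerm.npar F G)) := by
  by_cases hE : E = nil
  · subst hE; rw [nil_npar, nil_npar]; exact .refl _
  by_cases hF : F = nil
  · subst hF; rw [nil_npar, npar_nil]; exact .refl _
  by_cases hG : G = nil
  · subst hG; rw [npar_nil, npar_nil]; exact .refl _
  rw [npar_of_ne (npar_ne_nil hE) hG, npar_of_ne hE (npar_ne_nil hF), npar_of_ne hE hF,
    npar_of_ne hF hG]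
  exact .par_assoc _ _ _

/-- The unit and β laws become equalities of normal forms. Bodies of prefixes are not normalized and
remain related by `Cong`. -/
theorem Cong.nf {n : ℕ} {E F : HTerm n} (h : Cong E F) : NCong (nf E) (nf F) := by
  induction h with
  | refl => exact .refl _
  | symm _ ih => exact .symm ih
  | trans _ _ ih1 ih2 => exact .trans ih1 ih2
  | inp a h ih => exact .inp _ h
  | out a h1 h2 ih1 ih2 => exact .out _ h1 h2
  | par _ _ ih1 ih2 => exact .npar ih1 ih2
  | res _ ih => exact .res ih
  | abs r _ ih => exact .abs r ih
  | app m _ ih => exact .napp _ ih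
  | par_nil E => simp only [HTerm.nf, npar_nil]; exact .refl _
  | par_comm E F => exact .npar_comm _ _
  | par_assoc E F G => exact .npar_assoc _ _ _
  | res_comm E => simp only [HTerm.nf, nf_rename]; exact .res_comm _
  | res_par E F =>
    simp only [HTerm.nf, nf_shift]
    by_cases hF : HTerm.nf F = nil
    · simp only [hF, npar_nil, HTerm.shift, HTerm.rename]; exact .refl _
    -- There is no law `(c)0 ≡ 0`: when the left part vanishes, an empty restriction remains. This
    -- is the reason for the constructor `res_shift`.
    by_cases hE : HTerm.nf E = nil
    · rw [hE, nil_npar, npar_of_ne (by simp) hF]; exact .res_shift _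
    rw [npar_of_ne hE (by rwa [Ne, HTerm.shift, rename_eq_nil]), npar_of_ne (by simp) hF]
    exact .res_par _ _
  | @beta _ r E m =>
    simp only [HTerm.nf, HTerm.napp, if_true, nf_rename]
    exact .refl _

/-! ## Commitments -/

/-- The input commitments of a normal form. -/
inductive SIn : HTerm 0 → ℕ → HTerm 1 → Prop
  | inp (a : ℕ) (G : HTerm 1) : SIn (inp a G) a G
  | parL {E : HTerm 0} {a : ℕ} {G : HTerm 1} (F : HTerm 0) (h : SIn E a G) :
      SIn (par E F) a (par G (const F))
  | parR {F : HTerm 0} {a : ℕ} {G : HTerm 1} (E : HTerm 0) (h : SIn F a G) :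
      SIn (par E F) a (par (const E) G)
  | res {E : HTerm 0} {a : ℕ} {G : HTerm 1} (h : SIn E (a + 1) G) : SIn (res E) a (res G)

/-- The output commitments of a normal form. All restrictions around the output are extruded. -/
inductive SOut : HTerm 0 → ℕ → ℕ → HTerm 0 → HTerm 0 → Prop
  | out (a : ℕ) (M C : HTerm 0) : SOut (out a M C) a 0 M C
  | parL {E M C : HTerm 0} {a k : ℕ} (F : HTerm 0) (h : SOut E a k M C) :
      SOut (par E F) a k M (par C (shift k F))
  | parR {F M C : HTerm 0} {a k : ℕ} (E : HTerm 0) (h : SOut F a k M C) :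
      SOut (par E F) a k M (par (shift k E) C)
  | res {E M C : HTerm 0} {a k : ℕ} (h : SOut E (a + 1) k M C) : SOut (res E) a (k + 1) M C

/-- The internal steps of a normal form. -/
inductive STau : HTerm 0 → HTerm 0 → Prop
  | parL {E E' : HTerm 0} (F : HTerm 0) (h : STau E E') : STau (par E F) (par E' F)
  | parR {F F' : HTerm 0} (E : HTerm 0) (h : STau F F') : STau (par E F) (par E F')
  | res {E E' : HTerm 0} (h : STau E E') : STau (res E) (res E')
  | comL {E F M C : HTerm 0} {G : HTerm 1} {a k : ℕ} (hE : SIn E a G) (hF : SOut F a k M C) :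
      STau (par E F) (plug G k M C)
  | comR {E F M C : HTerm 0} {G : HTerm 1} {a k : ℕ} (hE : SOut E a k M C) (hF : SIn F a G) :
      STau (par E F) (plug G k M C)

theorem SIn.rename {E : HTerm 0} {a : ℕ} {G : HTerm 1} (h : SIn E a G) (ρ : ℕ → ℕ) :
    SIn (E.rename ρ) (ρ a) (G.rename ρ) := by
  induction h generalizing ρ with
  | inp a G => exact .inp _ _
  | parL F h ih => simp only [HTerm.rename, rename_const]; exact .parL _ (ih ρ)
  | parR F h ih => simp only [HTerm.rename, rename_const]; exact .parR _ (ih ρ)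
  | res h ih =>
    refine .res ?_
    have := ih (liftName 1 ρ)
    rwa [liftName_add] at this

theorem SOut.rename {E M C : HTerm 0} {a k : ℕ} (h : SOut E a k M C) (ρ : ℕ → ℕ) :
    SOut (E.rename ρ) (ρ a) k (M.rename (liftName k ρ)) (C.rename (liftName k ρ)) := by
  induction h generalizing ρ with
  | out a M C => simp only [liftName_zero]; exact .out _ _ _
  | parL F h ih => simp only [HTerm.rename, rename_shift]; exact .parL _ (ih ρ)
  | parR F h ih => simp only [HTerm.rename, rename_shift]; exact .parR _ (ih ρ)
  | res h ih =>
    refine .res ?_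
    have := ih (liftName 1 ρ)
    rwa [liftName_add, liftName_liftName] at this

theorem STau.rename {E E' : HTerm 0} (h : STau E E') (ρ : ℕ → ℕ) :
    STau (E.rename ρ) (E'.rename ρ) := by
  induction h generalizing ρ with
  | parL F h ih => exact .parL _ (ih ρ)
  | parR F h ih => exact .parR _ (ih ρ)
  | res h ih => exact .res (ih _)
  | comL h h' => rw [rename_plug]; exact .comL (h.rename ρ) (h'.rename ρ)
  | comR h h' => rw [rename_plug]; exact .comR (h.rename ρ) (h'.rename ρ)

theorem SIn.of_rename {E₁ : HTerm 0} {b : ℕ} {G₁ : HTerm 1} (h : SIn E₁ b G₁) :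
    ∀ {E : HTerm 0} {ρ : ℕ → ℕ}, E₁ = E.rename ρ →
      ∃ a G, b = ρ a ∧ G₁ = G.rename ρ ∧ SIn E a G := by
  induction h with
  | inp a G =>
    rintro E ρ e
    cases E <;> simp only [HTerm.rename, reduceCtorEq, HTerm.inp.injEq] at e
    exact ⟨_, _, e.1, e.2, .inp _ _⟩
  | parL F h ih =>
    rintro E ρ e
    cases E <;> simp only [HTerm.rename, reduceCtorEq, HTerm.par.injEq] at e
    obtain ⟨a, G, rfl, rfl, h'⟩ := ih e.1
    exact ⟨a, _, rfl, by rw [e.2, ← rename_const]; rfl, .parL _ h'⟩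
  | parR F h ih =>
    rintro E ρ e
    cases E <;> simp only [HTerm.rename, reduceCtorEq, HTerm.par.injEq] at e
    obtain ⟨a, G, rfl, rfl, h'⟩ := ih e.2
    exact ⟨a, _, rfl, by rw [e.1, ← rename_const]; rfl, .parR _ h'⟩
  | res h ih =>
    rintro E ρ e
    cases E <;> simp only [HTerm.rename, reduceCtorEq, HTerm.res.injEq] at e
    obtain ⟨a, G, h1, rfl, h'⟩ := ih e
    -- The lifted renaming fixes the bound name `0`, so only a successor can be sent to a successor.
    obtain ⟨c, rfl⟩ : ∃ c, a = c + 1 := by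
      refine ⟨a - 1, ?_⟩
      by_contra hc
      obtain rfl : a = 0 := by omega
      simp [liftName] at h1
    rw [liftName_add] at h1
    exact ⟨c, _, by omega, rfl, .res h'⟩

theorem SOut.of_rename {E₁ M₁ C₁ : HTerm 0} {b k : ℕ} (h : SOut E₁ b k M₁ C₁) :
    ∀ {E : HTerm 0} {ρ : ℕ → ℕ}, E₁ = E.rename ρ →
      ∃ a M C, b = ρ a ∧ M₁ = M.rename (liftName k ρ) ∧ C₁ = C.rename (liftName k ρ) ∧
        SOut E a k M C := by
  induction h with
  | out a M C =>
    rintro E ρ e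
    cases E <;> simp only [HTerm.rename, reduceCtorEq, HTerm.out.injEq] at e
    simp only [liftName_zero]
    exact ⟨_, _, _, e.1, e.2.1, e.2.2, .out _ _ _⟩
  | parL F h ih =>
    rintro E ρ e
    cases E <;> simp only [HTerm.rename, reduceCtorEq, HTerm.par.injEq] at e
    obtain ⟨a, M, C, rfl, rfl, rfl, h'⟩ := ih e.1
    exact ⟨a, M, _, rfl, rfl, by rw [e.2, ← rename_shift]; rfl, .parL _ h'⟩
  | parR F h ih =>
    rintro E ρ e
    cases E <;> simp only [HTerm.rename, reduceCtorEq, HTerm.par.injEq] at e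
    obtain ⟨a, M, C, rfl, rfl, rfl, h'⟩ := ih e.2
    exact ⟨a, M, _, rfl, rfl, by rw [e.1, ← rename_shift]; rfl, .parR _ h'⟩
  | res h ih =>
    rintro E ρ e
    cases E <;> simp only [HTerm.rename, reduceCtorEq, HTerm.res.injEq] at e
    obtain ⟨a, M, C, h1, rfl, rfl, h'⟩ := ih e
    obtain ⟨c, rfl⟩ : ∃ c, a = c + 1 := by
      refine ⟨a - 1, ?_⟩
      by_contra hc
      obtain rfl : a = 0 := by omega
      simp [liftName] at h1
    rw [liftName_add] at h1
    exact ⟨c, M, C, by omega, by rw [liftName_liftName], by rw [liftName_liftName], .res h'⟩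

/-- Injectivity excludes communications on names that the renaming has identified. -/
theorem STau.of_rename {E₁ E₂ : HTerm 0} (h : STau E₁ E₂) :
    ∀ {E : HTerm 0} {ρ : ℕ → ℕ}, Function.Injective ρ → E₁ = E.rename ρ →
      ∃ E', E₂ = E'.rename ρ ∧ STau E E' := by
  induction h with
  | parL F h ih =>
    rintro E ρ hρ e
    cases E <;> simp only [HTerm.rename, reduceCtorEq, HTerm.par.injEq] at e
    obtain ⟨E', rfl, h'⟩ := ih hρ e.1
    exact ⟨_, by rw [e.2]; rfl, .parL _ h'⟩
  | parR F h ih =>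
    rintro E ρ hρ e
    cases E <;> simp only [HTerm.rename, reduceCtorEq, HTerm.par.injEq] at e
    obtain ⟨E', rfl, h'⟩ := ih hρ e.2
    exact ⟨_, by rw [e.1]; rfl, .parR _ h'⟩
  | res h ih =>
    rintro E ρ hρ e
    cases E <;> simp only [HTerm.rename, reduceCtorEq, HTerm.res.injEq] at e
    obtain ⟨E', rfl, h'⟩ := ih (liftName_injective 1 hρ) e
    exact ⟨_, rfl, .res h'⟩
  | comL hE hF =>
    rintro E ρ hρ e
    cases E <;> simp only [HTerm.rename, reduceCtorEq, HTerm.par.injEq] at e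
    obtain ⟨a, G, rfl, rfl, h'⟩ := hE.of_rename e.1
    obtain ⟨a', M, C, h1, rfl, rfl, h''⟩ := hF.of_rename e.2
    obtain rfl := hρ h1
    exact ⟨_, (rename_plug _ _ _ _ _).symm, .comL h' h''⟩
  | comR hE hF =>
    rintro E ρ hρ e
    cases E <;> simp only [HTerm.rename, reduceCtorEq, HTerm.par.injEq] at e
    obtain ⟨a, G, rfl, rfl, h'⟩ := hF.of_rename e.2
    obtain ⟨a', M, C, h1, rfl, rfl, h''⟩ := hE.of_rename e.1
    obtain rfl := hρ h1
    exact ⟨_, (rename_plug _ _ _ _ _).symm, .comR h'' h'⟩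

/-! ### Invariance of commitments under structural congruence -/

/-- `F` has all commitments of `E`, up to structural congruence. -/
structure Sim (E F : HTerm 0) : Prop where
  inp : ∀ a G, SIn E a G → ∃ G', SIn F a G' ∧ Cong G G'
  out : ∀ a k M C, SOut E a k M C →
    ∃ l N D, SOut F a l N D ∧ ∀ G, Cong (plug G k M C) (plug G l N D)
  tau : ∀ E', STau E E' → ∃ F', STau F F' ∧ Cong E' F'

theorem Sim.refl (E : HTerm 0) : Sim E E :=
  ⟨fun _ G h => ⟨G, h, .refl _⟩, fun _ _ _ _ h => ⟨_, _, _, h, fun _ => .refl _⟩,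
    fun _ h => ⟨_, h, .refl _⟩⟩

theorem Sim.trans {E F H : HTerm 0} (h : Sim E F) (h' : Sim F H) : Sim E H := by
  refine ⟨fun a G hG => ?_, fun a k M C hC => ?_, fun E' hE => ?_⟩
  · obtain ⟨G', h1, h2⟩ := h.inp a G hG
    obtain ⟨G'', h3, h4⟩ := h'.inp a G' h1
    exact ⟨G'', h3, h2.trans h4⟩
  · obtain ⟨l, N, D, h1, h2⟩ := h.out a k M C hC
    obtain ⟨l', N', D', h3, h4⟩ := h'.out _ _ _ _ h1
    exact ⟨_, _, _, h3, fun G => (h2 G).trans (h4 G)⟩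
  · obtain ⟨F', h1, h2⟩ := h.tau E' hE
    obtain ⟨F'', h3, h4⟩ := h'.tau F' h1
    exact ⟨F'', h3, h2.trans h4⟩

/-- The congruences are needed because a component that does not move survives in the target. -/
theorem Sim.par {E E' F F' : HTerm 0} (h : Sim E E') (h' : Sim F F') (hE : Cong E E')
    (hF : Cong F F') : Sim (par E F) (par E' F') := by
  refine ⟨fun a G hG => ?_, fun a k M C hC => ?_, fun E' hE => ?_⟩
  · cases hG with
    | parL _ hG =>
      obtain ⟨G', h1, h2⟩ := h.inp _ _ hG
      exact ⟨_, .parL _ h1, h2.par hF.const⟩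
    | parR _ hG =>
      obtain ⟨G', h1, h2⟩ := h'.inp _ _ hG
      exact ⟨_, .parR _ h1, hE.const.par h2⟩
  · cases hC with
    | parL _ hC =>
      obtain ⟨l, N, D, h1, h2⟩ := h.out _ _ _ _ hC
      exact ⟨_, _, _, .parL _ h1, fun G => (plug_par _ _ _ _ _).trans
        (((h2 G).par hF).trans (plug_par _ _ _ _ _).symm)⟩
    | parR _ hC =>
      obtain ⟨l, N, D, h1, h2⟩ := h'.out _ _ _ _ hC
      exact ⟨_, _, _, .parR _ h1, fun G => (plug_par' _ _ _ _ _).trans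
        ((hE.par (h2 G)).trans (plug_par' _ _ _ _ _).symm)⟩
  · cases hE with
    | parL _ hE =>
      obtain ⟨E'', h1, h2⟩ := h.tau _ hE
      exact ⟨_, .parL _ h1, h2.par hF⟩
    | parR _ hE =>
      obtain ⟨E'', h1, h2⟩ := h'.tau _ hE
      exact ⟨_, .parR _ h1, .par ‹_› h2⟩
    | comL hG hC =>
      obtain ⟨G', h1, h2⟩ := h.inp _ _ hG
      obtain ⟨l, N, D, h3, h4⟩ := h'.out _ _ _ _ hC
      exact ⟨_, .comL h1 h3, (Cong.plug _ h2 (.refl _) (.refl _)).trans (h4 _)⟩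
    | comR hC hG =>
      obtain ⟨G', h1, h2⟩ := h'.inp _ _ hG
      obtain ⟨l, N, D, h3, h4⟩ := h.out _ _ _ _ hC
      exact ⟨_, .comR h3 h1, (Cong.plug _ h2 (.refl _) (.refl _)).trans (h4 _)⟩

theorem Sim.res {E E' : HTerm 0} (h : Sim E E') : Sim (res E) (res E') := by
  refine ⟨fun a G hG => ?_, fun a k M C hC => ?_, fun E' hE => ?_⟩
  · cases hG with
    | res hG =>
      obtain ⟨G', h1, h2⟩ := h.inp _ _ hG
      exact ⟨_, .res h1, h2.res⟩
  · cases hC with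
    | res hC =>
      obtain ⟨l, N, D, h1, h2⟩ := h.out _ _ _ _ hC
      refine ⟨_, _, _, .res h1, fun G => ?_⟩
      rw [plug_succ, plug_succ]
      exact (h2 _).res
  · cases hE with
    | res hE =>
      obtain ⟨E'', h1, h2⟩ := h.tau _ hE
      exact ⟨_, .res h1, h2.res⟩

theorem Sim.par_comm (E F : HTerm 0) : Sim (HTerm.par E F) (HTerm.par F E) := by
  refine ⟨fun a G hG => ?_, fun a k M C hC => ?_, fun E' hE => ?_⟩
  · cases hG with
    | parL _ hG => exact ⟨_, .parR _ hG, .par_comm _ _⟩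
    | parR _ hG => exact ⟨_, .parL _ hG, .par_comm _ _⟩
  · cases hC with
    | parL _ hC =>
      exact ⟨_, _, _, .parR _ hC, fun G => .plug _ (.refl _) (.refl _) (.par_comm _ _)⟩
    | parR _ hC =>
      exact ⟨_, _, _, .parL _ hC, fun G => .plug _ (.refl _) (.refl _) (.par_comm _ _)⟩
  · cases hE with
    | parL _ hE => exact ⟨_, .parR _ hE, .par_comm _ _⟩
    | parR _ hE => exact ⟨_, .parL _ hE, .par_comm _ _⟩
    | comL hG hC => exact ⟨_, .comR hC hG, .refl _⟩
    | comR hC hG => exact ⟨_, .comL hG hC, .refl _⟩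

theorem Sim.par_assoc (E F H : HTerm 0) :
    Sim (HTerm.par (HTerm.par E F) H) (HTerm.par E (HTerm.par F H)) := by
  refine ⟨fun a G hG => ?_, fun a k M C hC => ?_, fun E' hE => ?_⟩
  · cases hG with
    | parL _ hG =>
      cases hG with
      | parL _ hG => exact ⟨_, .parL _ hG, .par_assoc _ _ _⟩
      | parR _ hG => exact ⟨_, .parR _ (.parL _ hG), .par_assoc _ _ _⟩
    | parR _ hG => exact ⟨_, .parR _ (.parR _ hG), .par_assoc _ _ _⟩
  · cases hC with
    | parL _ hC =>
      cases hC with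
      | parL _ hC =>
        exact ⟨_, _, _, .parL _ hC, fun G => .plug _ (.refl _) (.refl _) (.par_assoc _ _ _)⟩
      | parR _ hC =>
        exact ⟨_, _, _, .parR _ (.parL _ hC),
          fun G => .plug _ (.refl _) (.refl _) (.par_assoc _ _ _)⟩
    | parR _ hC =>
      exact ⟨_, _, _, .parR _ (.parR _ hC),
        fun G => .plug _ (.refl _) (.refl _) (.par_assoc _ _ _)⟩
  · cases hE with
    | parL _ hE =>
      cases hE with
      | parL _ hE => exact ⟨_, .parL _ hE, .par_assoc _ _ _⟩
      | parR _ hE => exact ⟨_, .parR _ (.parL _ hE), .par_assoc _ _ _⟩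
      | comL hG hC => exact ⟨_, .comL hG (.parL _ hC), (plug_par _ _ _ _ _).symm⟩
      | comR hC hG => exact ⟨_, .comR hC (.parL _ hG), (plug_par_const _ _ _ _ _).symm⟩
    | parR _ hE => exact ⟨_, .parR _ (.parR _ hE), .par_assoc _ _ _⟩
    | comL hG hC =>
      cases hG with
      | parL _ hG =>
        exact ⟨_, .comL hG (.parR _ hC), (plug_par_const _ _ _ _ _).trans
          ((Cong.par_comm _ _).trans (plug_par' _ _ _ _ _).symm)⟩
      | parR _ hG => exact ⟨_, .parR _ (.comL hG hC), plug_const_par _ _ _ _ _⟩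
    | comR hC hG =>
      cases hC with
      | parL _ hC =>
        exact ⟨_, .comR hC (.parR _ hG), (plug_par _ _ _ _ _).trans
          ((Cong.par_comm _ _).trans (plug_const_par _ _ _ _ _).symm)⟩
      | parR _ hC => exact ⟨_, .parR _ (.comR hC hG), plug_par' _ _ _ _ _⟩

/-- The case analysis is done for one orientation only; the other follows from it by commutativity.
-/
theorem Sim.par_assoc' (E F H : HTerm 0) :
    Sim (HTerm.par E (HTerm.par F H)) (HTerm.par (HTerm.par E F) H) := by
  have c1 := Sim.par_comm E (HTerm.par F H)
  have c2 := Sim.par_assoc F H E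
  have c3 := Sim.par_comm F (HTerm.par H E)
  have c4 := Sim.par_assoc H E F
  have c5 := Sim.par_comm H (HTerm.par E F)
  exact c1.trans (c2.trans (c3.trans (c4.trans c5)))

theorem Sim.res_comm (E : HTerm 0) :
    Sim (HTerm.res (HTerm.res E)) (HTerm.res (HTerm.res (rename swapName E))) := by
  refine ⟨fun a G hG => ?_, fun a k M C hC => ?_, fun E' hE => ?_⟩
  · cases hG with
    | res hG =>
      cases hG with
      | res hG => exact ⟨_, .res (.res (hG.rename swapName)), .res_comm _⟩
  · cases hC with
    | res hC =>
      cases hC with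
      | res hC =>
        refine ⟨_, _, _, .res (.res (hC.rename swapName)), fun G => ?_⟩
        simp only [plug_succ]
        refine (Cong.res_comm _).trans ?_
        rw [rename_plug, shift_shift, rename_shift_of swapName_add_two]
        exact .refl _
  · cases hE with
    | res hE =>
      cases hE with
      | res hE => exact ⟨_, .res (.res (hE.rename swapName)), .res_comm _⟩

theorem Sim.res_comm' (E : HTerm 0) :
    Sim (HTerm.res (HTerm.res (rename swapName E))) (HTerm.res (HTerm.res E)) := by
  have := Sim.res_comm (rename swapName E)
  simpa only [rename_rename, swapName_swapName, rename_id'] using this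

theorem plug_shift (G : HTerm 1) (k : ℕ) (M C : HTerm 0) :
    plug (shift 1 G) k (rename (liftName k (fun i => i + 1)) M)
      (rename (liftName k (fun i => i + 1)) C) = shift 1 (plug G k M C) :=
  (rename_plug _ _ _ _ _).symm

theorem succ_injective' : Function.Injective fun i : ℕ => i + 1 := fun _ _ h => Nat.succ.inj h

theorem Sim.res_par (E F : HTerm 0) :
    Sim (HTerm.res (HTerm.par E (shift 1 F))) (HTerm.par (HTerm.res E) F) := by
  refine ⟨fun a G hG => ?_, fun a k M C hC => ?_, fun E' hE => ?_⟩
  · cases hG with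
    | res hG =>
      cases hG with
      | parL _ hG =>
        refine ⟨_, .parL _ (.res hG), ?_⟩
        rw [← shift_const]
        exact .res_par _ _
      | parR _ hG =>
        obtain ⟨b, G', h1, rfl, h'⟩ := hG.of_rename rfl
        obtain rfl : a = b := by omega
        exact ⟨_, .parR _ h', .res_par _ _⟩
  · cases hC with
    | res hC =>
      cases hC with
      | parL _ hC =>
        refine ⟨_, _, _, .parL _ (.res hC), fun G => ?_⟩
        rw [shift_shift, Nat.add_comm]
        exact .refl _
      | parR _ hC =>
        obtain ⟨b, M', C', h1, rfl, rfl, h'⟩ := hC.of_rename rfl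
        obtain rfl : a = b := by omega
        refine ⟨_, _, _, .parR _ h', fun G => ?_⟩
        rw [plug_succ]
        refine (plug_par' _ _ _ _ _).res.trans ?_
        rw [plug_shift]
        exact (Cong.res_par _ _).trans (plug_par' _ _ _ _ _).symm
  · cases hE with
    | res hE =>
      cases hE with
      | parL _ hE => exact ⟨_, .parL _ (.res hE), .res_par _ _⟩
      | parR _ hE =>
        -- A step of a shifted component is a shifted step, so it cannot involve the restricted
        -- name.
        obtain ⟨F', rfl, h'⟩ := hE.of_rename succ_injective' rfl
        exact ⟨_, .parR _ h', .res_par _ _⟩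
      | comL hG hC =>
        obtain ⟨b, M', C', rfl, rfl, rfl, h'⟩ := hC.of_rename rfl
        exact ⟨_, .comL (.res hG) h', (plug_res _ _ _ _).symm⟩
      | comR hC hG =>
        obtain ⟨b, G', rfl, rfl, h'⟩ := hG.of_rename rfl
        refine ⟨_, .comR (.res hC) h', ?_⟩
        rw [plug_succ]
        exact .refl _

theorem Sim.res_par' (E F : HTerm 0) :
    Sim (HTerm.par (HTerm.res E) F) (HTerm.res (HTerm.par E (shift 1 F))) := by
  refine ⟨fun a G hG => ?_, fun a k M C hC => ?_, fun E' hE => ?_⟩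
  · cases hG with
    | parL _ hG =>
      cases hG with
      | res hG =>
        refine ⟨_, .res (.parL _ hG), ?_⟩
        rw [← shift_const]
        exact (Cong.res_par _ _).symm
    | parR _ hG => exact ⟨_, .res (.parR _ (hG.rename _)), (Cong.res_par _ _).symm⟩
  · cases hC with
    | parL _ hC =>
      cases hC with
      | res hC =>
        refine ⟨_, _, _, .res (.parL _ hC), fun G => ?_⟩
        rw [shift_shift, Nat.add_comm]
        exact .refl _
    | parR _ hC =>
      refine ⟨_, _, _, .res (.parR _ (hC.rename _)), fun G => ?_⟩
      rw [plug_succ]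
      refine .symm ((plug_par' _ _ _ _ _).res.trans ?_)
      rw [plug_shift]
      exact (Cong.res_par _ _).trans (plug_par' _ _ _ _ _).symm
  · cases hE with
    | parL _ hE =>
      cases hE with
      | res hE => exact ⟨_, .res (.parL _ hE), (Cong.res_par _ _).symm⟩
    | parR _ hE => exact ⟨_, .res (.parR _ (hE.rename _)), (Cong.res_par _ _).symm⟩
    | comL hG hC =>
      cases hG with
      | res hG => exact ⟨_, .res (.comL hG (hC.rename _)), plug_res _ _ _ _⟩
    | comR hC hG =>
      cases hC with
      | res hC =>
        refine ⟨_, .res (.comR hC (hG.rename _)), ?_⟩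
        rw [plug_succ]
        exact .refl _

theorem Sim.nil_par (F : HTerm 0) : Sim (HTerm.par nil F) F := by
  refine ⟨fun a G hG => ?_, fun a k M C hC => ?_, fun E' hE => ?_⟩
  · cases hG with
    | parL _ hG => cases hG
    | parR _ hG => exact ⟨_, hG, .nil_par _⟩
  · cases hC with
    | parL _ hC => cases hC
    | parR _ hC => exact ⟨_, _, _, hC, fun G => .plug _ (.refl _) (.refl _) (.nil_par _)⟩
  · cases hE with
    | parL _ hE => cases hE
    | parR _ hE => exact ⟨_, hE, .nil_par _⟩
    | comL hG hC => cases hG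
    | comR hC hG => cases hC

theorem Sim.nil_par' (F : HTerm 0) : Sim F (HTerm.par nil F) :=
  ⟨fun _ _ h => ⟨_, .parR _ h, (Cong.nil_par _).symm⟩,
    fun _ _ _ _ h => ⟨_, _, _, .parR _ h,
      fun _ => .plug _ (.refl _) (.refl _) (Cong.nil_par _).symm⟩,
    fun _ h => ⟨_, .parR _ h, (Cong.nil_par _).symm⟩⟩

/-- Both simulations are proved together so that the symmetry rule is immediate. -/
theorem NCong.sim {E F : HTerm 0} (h : NCong E F) : Sim E F ∧ Sim F E := by
  induction h with
  | refl E => exact ⟨.refl _, .refl _⟩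
  | symm _ ih => exact ih.symm
  | trans _ _ ih1 ih2 => exact ⟨ih1.1.trans ih2.1, ih2.2.trans ih1.2⟩
  | inp a h =>
    constructor
    · exact ⟨fun _ _ hG => (by cases hG; exact ⟨_, .inp _ _, h⟩), nofun,
        nofun⟩
    · exact ⟨fun _ _ hG => (by cases hG; exact ⟨_, .inp _ _, h.symm⟩),
        nofun, nofun⟩
  | out a h h' =>
    constructor
    · refine ⟨nofun, fun _ _ _ _ hC => ?_, nofun⟩
      cases hC
      exact ⟨_, _, _, .out _ _ _, fun G => .plug _ (.refl _) h h'⟩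
    · refine ⟨nofun, fun _ _ _ _ hC => ?_, nofun⟩
      cases hC
      exact ⟨_, _, _, .out _ _ _, fun G => .plug _ (.refl _) h.symm h'.symm⟩
  | par h h' ih1 ih2 =>
    exact ⟨ih1.1.par ih2.1 h.cong h'.cong, ih1.2.par ih2.2 h.cong.symm h'.cong.symm⟩
  | res h ih => exact ⟨ih.1.res, ih.2.res⟩
  | abs r h ih =>
    constructor <;> exact ⟨nofun, nofun,
      nofun⟩
  | app m h ih =>
    constructor <;> exact ⟨nofun, nofun,
      nofun⟩
  | par_comm E F => exact ⟨.par_comm _ _, .par_comm _ _⟩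
  | par_assoc E F G => exact ⟨.par_assoc _ _ _, .par_assoc' _ _ _⟩
  | res_comm E => exact ⟨.res_comm _, .res_comm' _⟩
  | res_par E F => exact ⟨.res_par _ _, .res_par' _ _⟩
  | res_shift F =>
    exact ⟨(Sim.nil_par' _).res.trans (.res_par _ _), (Sim.res_par' _ _).trans (Sim.nil_par _).res⟩

theorem Cong.sim {E F : HTerm 0} (h : Cong E F) : Sim (HTerm.nf E) (HTerm.nf F) := h.nf.sim.1

end HTerm

namespace HTerm

/-! ## Transitions and commitments -/

theorem sim_npar (E F : HTerm 0) : Sim (par E F) (npar E F) := by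
  by_cases hE : E = nil
  · subst hE; rw [nil_npar]; exact .nil_par _
  by_cases hF : F = nil
  · subst hF; rw [npar_nil]; exact (Sim.par_comm _ _).trans (.nil_par _)
  rw [npar_of_ne hE hF]; exact .refl _

theorem npar_sim (E F : HTerm 0) : Sim (npar E F) (par E F) := by
  by_cases hE : E = nil
  · subst hE; rw [nil_npar]; exact .nil_par' _
  by_cases hF : F = nil
  · subst hF; rw [npar_nil]; exact (Sim.nil_par' _).trans (.par_comm _ _)
  rw [npar_of_ne hE hF]; exact .refl _

/-- `E` can input on `a` and continue as `G`, applied to the received process. -/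
def CIn (E : HTerm 0) (a : ℕ) (G : HTerm 1) : Prop := ∃ G₀, SIn (nf E) a G₀ ∧ Cong G G₀

/-- `E` can output on `a` and continue as `κ G` if `G` is the continuation of the receiver. -/
def COut (E : HTerm 0) (a : ℕ) (κ : HTerm 1 → HTerm 0) : Prop :=
  ∃ k M C, SOut (nf E) a k M C ∧ ∀ G, Cong (κ G) (plug G k M C)

def CTau (E E' : HTerm 0) : Prop := ∃ E₀, STau (nf E) E₀ ∧ Cong E' E₀

theorem CIn.of_cong {E F : HTerm 0} {a : ℕ} {G G' : HTerm 1} (h : CIn E a G) (hE : Cong E F)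
    (hG : Cong G G') : CIn F a G' := by
  obtain ⟨G₀, h1, h2⟩ := h
  obtain ⟨G₁, h3, h4⟩ := hE.sim.inp _ _ h1
  exact ⟨G₁, h3, hG.symm.trans (h2.trans h4)⟩

theorem COut.of_cong {E F : HTerm 0} {a : ℕ} {κ κ' : HTerm 1 → HTerm 0} (h : COut E a κ)
    (hE : Cong E F) (hκ : ∀ G, Cong (κ G) (κ' G)) : COut F a κ' := by
  obtain ⟨k, M, C, h1, h2⟩ := h
  obtain ⟨l, N, D, h3, h4⟩ := hE.sim.out _ _ _ _ h1
  exact ⟨l, N, D, h3, fun G => (hκ G).symm.trans ((h2 G).trans (h4 G))⟩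

theorem CTau.of_cong {E F E' F' : HTerm 0} (h : CTau E E') (hE : Cong E F) (hE' : Cong E' F') :
    CTau F F' := by
  obtain ⟨E₀, h1, h2⟩ := h
  obtain ⟨E₁, h3, h4⟩ := hE.sim.tau _ h1
  exact ⟨E₁, h3, hE'.symm.trans (h2.trans h4)⟩

theorem CIn.of_shift {E : HTerm 0} {k a : ℕ} {G : HTerm 1} (h : CIn (shift k E) (a + k) G) :
    ∃ G', CIn E a G' ∧ Cong G (shift k G') := by
  obtain ⟨G₀, h1, h2⟩ := h
  rw [nf_shift] at h1
  obtain ⟨b, G', h3, rfl, h4⟩ := h1.of_rename rfl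
  obtain rfl : a = b := by omega
  exact ⟨G', ⟨G', h4, .refl _⟩, h2⟩

/-! ### Commitments of the operators -/

theorem cIn_inp {b a : ℕ} {F G : HTerm 1} : CIn (inp b F) a G ↔ a = b ∧ Cong G F := by
  constructor
  · rintro ⟨G₀, h1, h2⟩
    cases h1
    exact ⟨rfl, h2⟩
  · rintro ⟨rfl, h⟩
    exact ⟨_, .inp _ _, h⟩

theorem not_cIn_out {b a : ℕ} {M C : HTerm 0} {G : HTerm 1} : ¬ CIn (out b M C) a G := by
  rintro ⟨_, ⟨⟩, _⟩

theorem not_cIn_nil {a : ℕ} {G : HTerm 1} : ¬ CIn nil a G := by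
  rintro ⟨_, ⟨⟩, _⟩

theorem not_cOut_nil {a : ℕ} {κ : HTerm 1 → HTerm 0} : ¬ COut nil a κ := by
  rintro ⟨_, _, _, ⟨⟩, _⟩

theorem not_cTau_nil {E : HTerm 0} : ¬ CTau nil E := by
  rintro ⟨_, ⟨⟩, _⟩

theorem not_cTau_inp {b : ℕ} {F : HTerm 1} {E : HTerm 0} : ¬ CTau (inp b F) E := by
  rintro ⟨_, ⟨⟩, _⟩

theorem not_cTau_out {b : ℕ} {M C E : HTerm 0} : ¬ CTau (out b M C) E := by
  rintro ⟨_, ⟨⟩, _⟩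

theorem not_cOut_inp {b a : ℕ} {F : HTerm 1} {κ : HTerm 1 → HTerm 0} : ¬ COut (inp b F) a κ := by
  rintro ⟨_, _, _, ⟨⟩, _⟩

theorem plug_zero (G : HTerm 1) (M C : HTerm 0) : plug G 0 M C = par (inst G M) C := by
  simp only [plug, shift_zero, resN]

theorem cOut_out {b a : ℕ} {M C : HTerm 0} {κ : HTerm 1 → HTerm 0} :
    COut (out b M C) a κ ↔ a = b ∧ ∀ G, Cong (κ G) (par (inst G M) C) := by
  constructor
  · rintro ⟨k, N, D, h1, h2⟩
    cases h1
    simp only [plug_zero] at h2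
    exact ⟨rfl, h2⟩
  · rintro ⟨rfl, h⟩
    exact ⟨0, M, C, .out _ _ _, by simpa only [plug_zero] using h⟩

/-- Normalization may erase a side of the composition, so commitments are transferred between `npar`
and `par`, where they can be inverted by constructors. -/
theorem cIn_par {E F : HTerm 0} {a : ℕ} {G : HTerm 1} :
    CIn (par E F) a G ↔ (∃ G', CIn E a G' ∧ Cong G (par G' (const F))) ∨
      (∃ G', CIn F a G' ∧ Cong G (par (const E) G')) := by
  constructor
  · rintro ⟨G₀, h1, h2⟩
    obtain ⟨G₁, h3, h4⟩ := (npar_sim _ _).inp _ _ h1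
    cases h3 with
    | parL _ h => exact .inl ⟨_, ⟨_, h, .refl _⟩, h2.trans (h4.trans ((cong_nf _).symm.const.parR _))⟩
    | parR _ h => exact .inr ⟨_, ⟨_, h, .refl _⟩, h2.trans (h4.trans ((cong_nf _).symm.const.parL _))⟩
  · rintro (⟨G', ⟨G₀, h1, h2⟩, h3⟩ | ⟨G', ⟨G₀, h1, h2⟩, h3⟩)
    · obtain ⟨G₁, h4, h5⟩ := (sim_npar _ _).inp _ _ (.parL (nf F) h1)
      exact ⟨G₁, h4, h3.trans ((h2.par (cong_nf _).const).trans h5)⟩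
    · obtain ⟨G₁, h4, h5⟩ := (sim_npar _ _).inp _ _ (.parR (nf E) h1)
      exact ⟨G₁, h4, h3.trans (((cong_nf _).const.par h2).trans h5)⟩

theorem cOut_par {E F : HTerm 0} {a : ℕ} {κ : HTerm 1 → HTerm 0} :
    COut (par E F) a κ ↔ (∃ κ', COut E a κ' ∧ ∀ G, Cong (κ G) (par (κ' G) F)) ∨
      (∃ κ', COut F a κ' ∧ ∀ G, Cong (κ G) (par E (κ' G))) := by
  constructor
  · rintro ⟨k, M, C, h1, h2⟩
    obtain ⟨l, N, D, h3, h4⟩ := (npar_sim _ _).out _ _ _ _ h1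
    cases h3 with
    | parL _ h =>
      exact .inl ⟨_, ⟨_, _, _, h, fun _ => .refl _⟩, fun G => (h2 G).trans ((h4 G).trans
        ((plug_par _ _ _ _ _).trans ((cong_nf _).symm.parR _)))⟩
    | parR _ h =>
      exact .inr ⟨_, ⟨_, _, _, h, fun _ => .refl _⟩, fun G => (h2 G).trans ((h4 G).trans
        ((plug_par' _ _ _ _ _).trans ((cong_nf _).symm.parL _)))⟩
  · rintro (⟨κ', ⟨k, M, C, h1, h2⟩, h3⟩ | ⟨κ', ⟨k, M, C, h1, h2⟩, h3⟩)
    · obtain ⟨l, N, D, h4, h5⟩ := (sim_npar _ _).out _ _ _ _ (.parL (nf F) h1)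
      exact ⟨_, _, _, h4, fun G => (h3 G).trans (((h2 G).par (cong_nf _)).trans
        ((plug_par _ _ _ _ _).symm.trans (h5 G)))⟩
    · obtain ⟨l, N, D, h4, h5⟩ := (sim_npar _ _).out _ _ _ _ (.parR (nf E) h1)
      exact ⟨_, _, _, h4, fun G => (h3 G).trans (((cong_nf _).par (h2 G)).trans
        ((plug_par' _ _ _ _ _).symm.trans (h5 G)))⟩

theorem cTau_par {E F E' : HTerm 0} :
    CTau (par E F) E' ↔ (∃ E₁, CTau E E₁ ∧ Cong E' (par E₁ F)) ∨
      (∃ F₁, CTau F F₁ ∧ Cong E' (par E F₁)) ∨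
      (∃ a G κ, CIn E a G ∧ COut F a κ ∧ Cong E' (κ G)) ∨
      (∃ a G κ, COut E a κ ∧ CIn F a G ∧ Cong E' (κ G)) := by
  constructor
  · rintro ⟨E₀, h1, h2⟩
    obtain ⟨E₁, h3, h4⟩ := (npar_sim _ _).tau _ h1
    cases h3 with
    | parL _ h => exact .inl ⟨_, ⟨_, h, .refl _⟩, h2.trans (h4.trans ((cong_nf _).symm.parR _))⟩
    | parR _ h =>
      exact .inr (.inl ⟨_, ⟨_, h, .refl _⟩, h2.trans (h4.trans ((cong_nf _).symm.parL _))⟩)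
    | comL h h' =>
      exact .inr (.inr (.inl ⟨_, _, _, ⟨_, h, .refl _⟩, ⟨_, _, _, h', fun _ => .refl _⟩,
        h2.trans h4⟩))
    | comR h h' =>
      exact .inr (.inr (.inr ⟨_, _, _, ⟨_, _, _, h, fun _ => .refl _⟩, ⟨_, h', .refl _⟩,
        h2.trans h4⟩))
  · rintro (⟨E₁, ⟨E₀, h1, h2⟩, h3⟩ | ⟨F₁, ⟨E₀, h1, h2⟩, h3⟩ |
      ⟨a, G, κ, ⟨G₀, h1, h2⟩, ⟨k, M, C, h3, h4⟩, h5⟩ |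
      ⟨a, G, κ, ⟨k, M, C, h3, h4⟩, ⟨G₀, h1, h2⟩, h5⟩)
    · obtain ⟨E₂, h4, h5⟩ := (sim_npar _ _).tau _ (.parL (nf F) h1)
      exact ⟨_, h4, h3.trans ((h2.par (cong_nf _)).trans h5)⟩
    · obtain ⟨E₂, h4, h5⟩ := (sim_npar _ _).tau _ (.parR (nf E) h1)
      exact ⟨_, h4, h3.trans (((cong_nf _).par h2).trans h5)⟩
    · obtain ⟨E₂, h6, h7⟩ := (sim_npar _ _).tau _ (.comL h1 h3)
      exact ⟨_, h6, h5.trans ((h4 G).trans ((Cong.plug _ h2 (.refl _) (.refl _)).trans h7))⟩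
    · obtain ⟨E₂, h6, h7⟩ := (sim_npar _ _).tau _ (.comR h3 h1)
      exact ⟨_, h6, h5.trans ((h4 G).trans ((Cong.plug _ h2 (.refl _) (.refl _)).trans h7))⟩

theorem cIn_res {E : HTerm 0} {a : ℕ} {G : HTerm 1} :
    CIn (res E) a G ↔ ∃ G', CIn E (a + 1) G' ∧ Cong G (res G') := by
  constructor
  · rintro ⟨G₀, h1, h2⟩
    cases h1 with
    | res h => exact ⟨_, ⟨_, h, .refl _⟩, h2⟩
  · rintro ⟨G', ⟨G₀, h1, h2⟩, h3⟩
    exact ⟨_, .res h1, h3.trans h2.res⟩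

theorem cOut_res {E : HTerm 0} {a : ℕ} {κ : HTerm 1 → HTerm 0} :
    COut (res E) a κ ↔ ∃ κ', COut E (a + 1) κ' ∧ ∀ G, Cong (κ G) (res (κ' (shift 1 G))) := by
  constructor
  · rintro ⟨k, M, C, h1, h2⟩
    cases h1 with
    | res h =>
      exact ⟨_, ⟨_, _, _, h, fun _ => .refl _⟩, fun G => by simpa only [plug_succ] using h2 G⟩
  · rintro ⟨κ', ⟨k, M, C, h1, h2⟩, h3⟩
    exact ⟨_, _, _, .res h1, fun G => by rw [plug_succ]; exact (h3 G).trans (h2 _).res⟩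

theorem cTau_res {E E' : HTerm 0} : CTau (res E) E' ↔ ∃ E₁, CTau E E₁ ∧ Cong E' (res E₁) := by
  constructor
  · rintro ⟨E₀, h1, h2⟩
    cases h1 with
    | res h => exact ⟨_, ⟨_, h, .refl _⟩, h2⟩
  · rintro ⟨E₁, ⟨E₀, h1, h2⟩, h3⟩
    exact ⟨_, .res h1, h3.trans h2.res⟩

/-! ### From transitions to commitments and back -/

/-- The commitment that corresponds to a transition. -/
def Commits (E : HTerm 0) (l : HAct) (E' : HTerm 0) : Prop :=
  match l with
  | .tau => CTau E E'
  | .inp a A => ∃ G, CIn E a G ∧ Cong E' (inst G A)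
  | .out k a M => COut E a (fun G => plug G k M E')

theorem inst_par (G H : HTerm 1) (A : HTerm 0) :
    inst (par G H) A = par (inst G A) (inst H A) := rfl

theorem inst_res (G : HTerm 1) (A : HTerm 0) : inst (res G) A = res (inst G (shift 1 A)) := rfl

theorem Commits.of_cong {E F E' F' : HTerm 0} {l : HAct} (h : Commits E l E') (hE : Cong E F)
    (hE' : Cong E' F') : Commits F l F' := by
  cases l with
  | tau => exact CTau.of_cong h hE hE'
  | inp a A =>
    obtain ⟨G, h1, h2⟩ := h
    exact ⟨G, h1.of_cong hE (.refl _), hE'.symm.trans h2⟩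
  | out k a M => exact COut.of_cong h hE fun G => .plug _ (.refl _) (.refl _) hE'

/-- Commitments are invariant under `≡`, which disposes of the rule `cong`; each other rule is an
instance of the description of commitments of an operator. This is the inversion principle for
transitions. -/
theorem Step.commits {E E' : HTerm 0} {l : HAct} (h : Step E l E') : Commits E l E' := by
  induction h with
  | inp a F A => exact ⟨F, cIn_inp.2 ⟨rfl, .refl _⟩, .refl _⟩
  | out a M C => exact cOut_out.2 ⟨rfl, fun G => by rw [plug_zero]; exact .refl _⟩
  | @parL E E' l F h ih =>
    cases l with
    | tau =>
      simp only [HAct.bound, shift_zero]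
      exact cTau_par.2 (.inl ⟨_, ih, .refl _⟩)
    | inp a A =>
      obtain ⟨G, h1, h2⟩ := ih
      refine ⟨_, cIn_par.2 (.inl ⟨G, h1, .refl _⟩), ?_⟩
      rw [inst_par, inst_const]
      simp only [HAct.bound, shift_zero]
      exact h2.parL _
    | out k a M => exact cOut_par.2 (.inl ⟨_, ih, fun G => plug_par _ _ _ _ _⟩)
  | @parR F F' l E h ih =>
    cases l with
    | tau =>
      simp only [HAct.bound, shift_zero]
      exact cTau_par.2 (.inr (.inl ⟨_, ih, .refl _⟩))
    | inp a A =>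
      obtain ⟨G, h1, h2⟩ := ih
      refine ⟨_, cIn_par.2 (.inr ⟨G, h1, .refl _⟩), ?_⟩
      rw [inst_par, inst_const]
      simp only [HAct.bound, shift_zero]
      exact h2.parR _
    | out k a M => exact cOut_par.2 (.inr ⟨_, ih, fun G => plug_par' _ _ _ _ _⟩)
  | comL hE hF ihE ihF =>
    obtain ⟨G, h1, h2⟩ := ihE
    obtain ⟨G', h3, h4⟩ := h1.of_shift
    exact cTau_par.2 (.inr (.inr (.inl ⟨_, G', _, h3, ihF,
      ((h2.trans (h4.inst (.refl _))).parL _).resN _⟩)))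
  | comR hE hF ihE ihF =>
    obtain ⟨G, h1, h2⟩ := ihF
    obtain ⟨G', h3, h4⟩ := h1.of_shift
    exact cTau_par.2 (.inr (.inr (.inr ⟨_, G', _, ihE, h3,
      ((Cong.par_comm _ _).trans ((h2.trans (h4.inst (.refl _))).parL _)).resN _⟩)))
  | opn h hd ih => exact cOut_res.2 ⟨_, ih, fun G => by rw [plug_succ]; exact .refl _⟩
  | resTau h ih => exact cTau_res.2 ⟨_, ih, .refl _⟩
  | resInp h ih =>
    obtain ⟨G, h1, h2⟩ := ih
    exact ⟨_, cIn_res.2 ⟨G, h1, .refl _⟩, by rw [inst_res]; exact h2.res⟩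
  | resOut h ih => exact cOut_res.2 ⟨_, ih, fun G => (plug_res_cont _ _ _ _).symm⟩
  | cong h hE h' ih => exact ih.of_cong h.symm h'

theorem Step.of_cong {E F E' F' : HTerm 0} {l : HAct} (h : Step E l E') (hE : Cong E F)
    (hE' : Cong E' F') : Step F l F' := .cong hE.symm h hE'

theorem SIn.step {E : HTerm 0} {a : ℕ} {G : HTerm 1} (h : SIn E a G) (A : HTerm 0) :
    Step E (.inp a A) (inst G A) := by
  induction h generalizing A with
  | inp a G => exact .inp _ _ _
  | parL F h ih =>
    rw [inst_par, inst_const]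
    simpa only [HAct.bound, shift_zero] using Step.parL F (ih A)
  | parR F h ih =>
    rw [inst_par, inst_const]
    simpa only [HAct.bound, shift_zero] using Step.parR F (ih A)
  | res h ih => rw [inst_res]; exact .resInp (ih _)

/-- A transition extrudes only the names that occur in the message, a commitment all of them; the
difference disappears after plugging. -/
theorem SOut.step {E M C : HTerm 0} {a k : ℕ} (h : SOut E a k M C) :
    ∃ l N D, Step E (.out l a N) D ∧ ∀ G, Cong (plug G l N D) (plug G k M C) := by
  induction h with
  | out a M C => exact ⟨_, _, _, .out _ _ _, fun _ => .refl _⟩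
  | parL F h ih =>
    obtain ⟨l, N, D, h1, h2⟩ := ih
    exact ⟨_, _, _, .parL F h1, fun G => (plug_par _ _ _ _ _).trans
      (((h2 G).parL _).trans (plug_par _ _ _ _ _).symm)⟩
  | parR F h ih =>
    obtain ⟨l, N, D, h1, h2⟩ := ih
    exact ⟨_, _, _, .parR F h1, fun G => (plug_par' _ _ _ _ _).trans
      (((h2 G).parR _).trans (plug_par' _ _ _ _ _).symm)⟩
  | @res E M C a k h ih =>
    obtain ⟨l, N, D, h1, h2⟩ := ih
    by_cases hN : Free l N
    · refine ⟨_, _, _, .opn h1 hN, fun G => ?_⟩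
      rw [plug_succ, plug_succ]
      exact (h2 _).res
    · have hN' : N = HTerm.rename (liftName l (fun i => i + 1))
          (HTerm.rename (liftName l (fun i => i - 1)) N) := by
        conv_lhs => rw [← rename_id' N]
        rw [rename_rename]
        refine rename_congr_of_free _ fun i hi => ?_
        have : i ≠ l := fun e => hN (e ▸ hi)
        simp only [liftName]
        by_cases h : i < l
        · simp [h]
        · rw [if_neg h, if_neg (by omega)]; omega
      rw [hN'] at h1
      refine ⟨_, _, _, .resOut h1, fun G => ?_⟩
      rw [plug_succ]
      refine (plug_res_cont _ _ _ _).symm.trans ?_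
      rw [← hN']
      exact (h2 _).res

theorem STau.step {E E' : HTerm 0} (h : STau E E') : ∃ E'', Step E .tau E'' ∧ Cong E'' E' := by
  induction h with
  | parL F h ih =>
    obtain ⟨E'', h1, h2⟩ := ih
    exact ⟨_, .parL F h1, by simpa only [HAct.bound, shift_zero] using h2.parL F⟩
  | parR F h ih =>
    obtain ⟨E'', h1, h2⟩ := ih
    exact ⟨_, .parR F h1, by simpa only [HAct.bound, shift_zero] using h2.parR F⟩
  | res h ih =>
    obtain ⟨E'', h1, h2⟩ := ih
    exact ⟨_, .resTau h1, h2.res⟩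
  | comL hE hF =>
    obtain ⟨l, N, D, h1, h2⟩ := hF.step
    exact ⟨_, .comL ((hE.rename (fun i => i + l)).step N) h1, h2 _⟩
  | comR hE hF =>
    obtain ⟨l, N, D, h1, h2⟩ := hE.step
    exact ⟨_, .comR h1 ((hF.rename (fun i => i + l)).step N),
      ((Cong.par_comm _ _).resN _).trans (h2 _)⟩

theorem step_tau_iff {E E' : HTerm 0} : Step E .tau E' ↔ CTau E E' := by
  refine ⟨fun h => h.commits, ?_⟩
  rintro ⟨E₀, h1, h2⟩
  obtain ⟨E₁, h3, h4⟩ := h1.step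
  exact h3.of_cong (cong_nf _).symm (h4.trans h2.symm)

theorem step_inp_iff {E E' A : HTerm 0} {a : ℕ} :
    Step E (.inp a A) E' ↔ ∃ G, CIn E a G ∧ Cong E' (inst G A) := by
  refine ⟨fun h => h.commits, ?_⟩
  rintro ⟨G, ⟨G₀, h1, h2⟩, h3⟩
  exact (h1.step A).of_cong (cong_nf _).symm ((h2.symm.inst (.refl _)).trans h3.symm)

theorem Step.cOut {E E' M : HTerm 0} {k a : ℕ} (h : Step E (.out k a M) E') :
    COut E a (fun G => plug G k M E') := h.commits

theorem COut.step {E : HTerm 0} {a : ℕ} {κ : HTerm 1 → HTerm 0} (h : COut E a κ) :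
    ∃ k M E', Step E (.out k a M) E' ∧ ∀ G, Cong (plug G k M E') (κ G) := by
  obtain ⟨k, M, C, h1, h2⟩ := h
  obtain ⟨l, N, D, h3, h4⟩ := h1.step
  exact ⟨_, _, _, h3.of_cong (cong_nf _).symm (.refl _), fun G => (h4 G).trans (h2 G).symm⟩

theorem CTau.step {E E' : HTerm 0} (h : CTau E E') : Step E .tau E' := step_tau_iff.2 h

theorem CIn.step {E : HTerm 0} {a : ℕ} {G : HTerm 1} (h : CIn E a G) (A : HTerm 0) :
    Step E (.inp a A) (inst G A) := step_inp_iff.2 ⟨G, h, .refl _⟩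

end HTerm

/-! ## Divergence -/

theorem diverges_of_forall {α : Type} {step : α → α → Prop} (P : α → Prop)
    (h : ∀ x, P x → ∃ y, step x y ∧ P y) {x : α} (hx : P x) : Diverges step x := by
  choose! f hf using h
  refine ⟨fun n => f^[n] x, rfl, fun n => ?_⟩
  have hP : ∀ n, P (f^[n] x) := by
    intro n
    induction n with
    | zero => exact hx
    | succ n ih => rw [Function.iterate_succ_apply']; exact (hf _ ih).2
  have := (hf _ (hP n)).1
  rwa [← Function.iterate_succ_apply' f n x] at this

theorem Diverges.exists_step {α : Type} {step : α → α → Prop} {x : α} (h : Diverges step x) :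
    ∃ y, step x y ∧ Diverges step y := by
  obtain ⟨s, rfl, hs⟩ := h
  exact ⟨s 1, hs 0, fun n => s (n + 1), rfl, fun n => hs (n + 1)⟩

theorem Diverges.of_step {α : Type} {step : α → α → Prop} {x y : α} (h : step x y)
    (hy : Diverges step y) : Diverges step x := by
  refine diverges_of_forall (fun z => z = x ∨ Diverges step z) ?_ (.inl rfl)
  rintro z (rfl | hz)
  · exact ⟨y, h, .inr hy⟩
  · obtain ⟨w, h1, h2⟩ := hz.exists_step
    exact ⟨w, h1, .inr h2⟩

namespace HTerm

theorem diverges_cong {E F : HTerm 0} (h : Diverges Tau E) (hE : Cong E F) : Diverges Tau F := by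
  obtain ⟨y, h1, h2⟩ := h.exists_step
  exact h2.of_step (Step.of_cong h1 hE (.refl _))

theorem Step.tau_parL {E E' : HTerm 0} (h : Step E .tau E') (F : HTerm 0) :
    Step (par E F) .tau (par E' F) :=
  step_tau_iff.2 (cTau_par.2 (.inl ⟨_, step_tau_iff.1 h, .refl _⟩))

theorem Step.tau_parR {F F' : HTerm 0} (E : HTerm 0) (h : Step F .tau F') :
    Step (par E F) .tau (par E F') :=
  step_tau_iff.2 (cTau_par.2 (.inr (.inl ⟨_, step_tau_iff.1 h, .refl _⟩)))

theorem Taus.parL {E E' : HTerm 0} (h : Taus E E') (F : HTerm 0) :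
    Taus (HTerm.par E F) (HTerm.par E' F) := by
  induction h with
  | refl => exact .refl
  | tail _ h ih => exact ih.tail (Step.tau_parL h F)

theorem Taus.parR (E : HTerm 0) {F F' : HTerm 0} (h : Taus F F') :
    Taus (HTerm.par E F) (HTerm.par E F') := by
  induction h with
  | refl => exact .refl
  | tail _ h ih => exact ih.tail (Step.tau_parR E h)

theorem Taus.resN {E E' : HTerm 0} (h : Taus E E') (k : ℕ) :
    Taus (HTerm.resN k E) (HTerm.resN k E') := by
  have aux : ∀ {E E' : HTerm 0} (k : ℕ), Step E .tau E' →
      Step (HTerm.resN k E) .tau (HTerm.resN k E') := by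
    intro E E' k h
    induction k with
    | zero => exact h
    | succ k ih => exact .resTau ih
  induction h with
  | refl => exact .refl
  | tail _ h ih => exact ih.tail (aux k h)

theorem Taus.plug {E E' : HTerm 0} (h : Taus E E') (G : HTerm 1) (k : ℕ) (M : HTerm 0) :
    Taus (plug G k M E) (plug G k M E') := (h.parR _).resN k

/-- Weak internal steps up to structural congruence. -/
def TausC (E F : HTerm 0) : Prop := ∃ F', Taus E F' ∧ Cong F' F

theorem TausC.of_cong {E F : HTerm 0} (h : Cong E F) : TausC E F := ⟨E, .refl, h⟩

theorem TausC.refl (E : HTerm 0) : TausC E E := .of_cong (.refl _)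

/-- An actual step absorbs the congruence, but the empty sequence leaves it over. Hence `TausC`
instead of `Taus`. -/
theorem Taus.cong_left {E F F' : HTerm 0} (h : Taus F F') (hE : Cong E F) : TausC E F' := by
  induction h with
  | refl => exact .of_cong hE
  | tail _ h ih =>
    obtain ⟨H, h1, h2⟩ := ih
    exact ⟨_, h1.tail (Step.of_cong h h2.symm (.refl _)), .refl _⟩

theorem TausC.trans {E F H : HTerm 0} (h : TausC E F) (h' : TausC F H) : TausC E H := by
  obtain ⟨F', h1, h2⟩ := h
  obtain ⟨H', h3, h4⟩ := h'
  obtain ⟨H'', h5, h6⟩ := h3.cong_left h2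
  exact ⟨H'', h1.trans h5, h6.trans h4⟩

theorem TausC.parL {E E' : HTerm 0} (h : TausC E E') (F : HTerm 0) :
    TausC (HTerm.par E F) (HTerm.par E' F) := by
  obtain ⟨H, h1, h2⟩ := h
  exact ⟨_, h1.parL F, h2.parL F⟩

theorem TausC.parR (E : HTerm 0) {F F' : HTerm 0} (h : TausC F F') :
    TausC (HTerm.par E F) (HTerm.par E F') := by
  obtain ⟨H, h1, h2⟩ := h
  exact ⟨_, h1.parR E, h2.parR E⟩

theorem CTau.tausC {E E' : HTerm 0} (h : CTau E E') : TausC E E' :=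
  ⟨E', .single h.step, .refl _⟩

/-! ## Processes without visible actions -/

/-- `E` has no visible action. -/
def NoVis (E : HTerm 0) : Prop := (∀ a G, ¬ CIn E a G) ∧ ∀ a κ, ¬ COut E a κ

/-- `E` has no action. -/
def Dead (E : HTerm 0) : Prop := NoVis E ∧ ∀ E', ¬ CTau E E'

/-- The only action of `E` is an internal step to `E'`. -/
def Det (E E' : HTerm 0) : Prop := NoVis E ∧ CTau E E' ∧ ∀ E'', CTau E E'' → Cong E'' E'

theorem NoVis.of_cong {E F : HTerm 0} (h : NoVis E) (hE : Cong E F) : NoVis F :=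
  ⟨fun a G hG => h.1 a G (hG.of_cong hE.symm (.refl _)),
    fun a κ hκ => h.2 a κ (hκ.of_cong hE.symm fun _ => .refl _)⟩

theorem NoVis.par {E F : HTerm 0} (h : NoVis E) (h' : NoVis F) : NoVis (par E F) := by
  constructor
  · intro a G hG
    rcases cIn_par.1 hG with ⟨G', h1, -⟩ | ⟨G', h1, -⟩
    exacts [h.1 _ _ h1, h'.1 _ _ h1]
  · intro a G hG
    rcases cOut_par.1 hG with ⟨G', h1, -⟩ | ⟨G', h1, -⟩
    exacts [h.2 _ _ h1, h'.2 _ _ h1]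

theorem NoVis.res {E : HTerm 0} (h : NoVis E) : NoVis (res E) := by
  constructor
  · intro a G hG
    obtain ⟨G', h1, -⟩ := cIn_res.1 hG
    exact h.1 _ _ h1
  · intro a G hG
    obtain ⟨G', h1, -⟩ := cOut_res.1 hG
    exact h.2 _ _ h1

theorem Dead.of_cong {E F : HTerm 0} (h : Dead E) (hE : Cong E F) : Dead F :=
  ⟨h.1.of_cong hE, fun E' hE' => h.2 E' (hE'.of_cong hE.symm (.refl _))⟩

/-- A component without visible actions cannot take part in a communication. -/
theorem NoVis.cTau_par {E F E' : HTerm 0} (h : NoVis F) (h' : CTau (HTerm.par E F) E') :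
    (∃ E₁, CTau E E₁ ∧ Cong E' (HTerm.par E₁ F)) ∨
      (∃ F₁, CTau F F₁ ∧ Cong E' (HTerm.par E F₁)) := by
  rcases HTerm.cTau_par.1 h' with h1 | h1 | ⟨a, G, κ, h1, h2, h3⟩ | ⟨a, G, κ, h1, h2, h3⟩
  · exact .inl h1
  · exact .inr h1
  · exact absurd h2 (h.2 _ _)
  · exact absurd h2 (h.1 _ _)

theorem Dead.par {E F : HTerm 0} (h : Dead E) (h' : Dead F) : Dead (par E F) := by
  refine ⟨h.1.par h'.1, fun E' hE' => ?_⟩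
  rcases h'.1.cTau_par hE' with ⟨_, h1, -⟩ | ⟨_, h1, -⟩
  exacts [h.2 _ h1, h'.2 _ h1]

theorem Dead.res {E : HTerm 0} (h : Dead E) : Dead (res E) := by
  refine ⟨h.1.res, fun E' hE' => ?_⟩
  obtain ⟨_, h1, -⟩ := cTau_res.1 hE'
  exact h.2 _ h1

theorem dead_nil : Dead nil :=
  ⟨⟨fun _ _ => not_cIn_nil, fun _ _ => not_cOut_nil⟩, fun _ => not_cTau_nil⟩

theorem Det.of_cong {E E' F F' : HTerm 0} (h : Det E E') (hE : Cong E F) (hE' : Cong E' F') :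
    Det F F' :=
  ⟨h.1.of_cong hE, h.2.1.of_cong hE hE',
    fun E'' hE'' => (h.2.2 E'' (hE''.of_cong hE.symm (.refl _))).trans hE'⟩

theorem Det.par {E E' D : HTerm 0} (h : Det E E') (hD : Dead D) : Det (par E D) (par E' D) := by
  refine ⟨h.1.par hD.1, cTau_par.2 (.inl ⟨_, h.2.1, .refl _⟩), fun E'' hE'' => ?_⟩
  rcases hD.1.cTau_par hE'' with ⟨_, h1, h2⟩ | ⟨_, h1, -⟩
  · exact h2.trans ((h.2.2 _ h1).parL _)
  · exact absurd h1 (hD.2 _)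

theorem Det.res {E E' : HTerm 0} (h : Det E E') : Det (res E) (res E') := by
  refine ⟨h.1.res, cTau_res.2 ⟨_, h.2.1, .refl _⟩, fun E'' hE'' => ?_⟩
  obtain ⟨_, h1, h2⟩ := cTau_res.1 hE''
  exact h2.trans (h.2.2 _ h1).res

/-! ### Deterministic runs -/

/-- `n` deterministic internal steps. -/
def DetN : ℕ → HTerm 0 → HTerm 0 → Prop
  | 0, E, F => Cong E F
  | n + 1, E, F => ∃ E₁, Det E E₁ ∧ DetN n E₁ F

theorem DetN.cong_left {n : ℕ} {E E' F : HTerm 0} (h : DetN n E F) (hE : Cong E E') :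
    DetN n E' F := by
  cases n with
  | zero => exact hE.symm.trans h
  | succ n =>
    obtain ⟨E₁, h1, h2⟩ := h
    exact ⟨E₁, h1.of_cong hE (.refl _), h2⟩

theorem DetN.cong_right {n : ℕ} {E F F' : HTerm 0} (h : DetN n E F) (hF : Cong F F') :
    DetN n E F' := by
  induction n generalizing E with
  | zero => exact Cong.trans h hF
  | succ n ih =>
    obtain ⟨E₁, h1, h2⟩ := h
    exact ⟨E₁, h1, ih h2⟩

theorem DetN.trans {m n : ℕ} {E F H : HTerm 0} (h : DetN m E F) (h' : DetN n F H) :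
    DetN (m + n) E H := by
  induction m generalizing E with
  | zero => rw [Nat.zero_add]; exact h'.cong_left (Cong.symm h)
  | succ m ih =>
    obtain ⟨E₁, h1, h2⟩ := h
    rw [Nat.add_right_comm]
    exact ⟨E₁, h1, ih h2⟩

theorem Det.detN {E E' : HTerm 0} (h : Det E E') : DetN 1 E E' := ⟨E', h, .refl _⟩

theorem DetN.par {n : ℕ} {E F D : HTerm 0} (h : DetN n E F) (hD : Dead D) :
    DetN n (par E D) (par F D) := by
  induction n generalizing E with
  | zero => exact Cong.parL h D
  | succ n ih =>
    obtain ⟨E₁, h1, h2⟩ := h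
    exact ⟨_, h1.par hD, ih h2⟩

theorem DetN.res {n : ℕ} {E F : HTerm 0} (h : DetN n E F) : DetN n (res E) (res F) := by
  induction n generalizing E with
  | zero => exact Cong.res h
  | succ n ih =>
    obtain ⟨E₁, h1, h2⟩ := h
    exact ⟨_, h1.res, ih h2⟩

theorem DetN.of_le {n : ℕ} {E F : HTerm 0} (h : DetN n E F) {m : ℕ} (hm : m ≤ n) :
    ∃ F', DetN m E F' := by
  induction m generalizing n E with
  | zero => exact ⟨E, Cong.refl _⟩
  | succ m ih =>
    cases n with
    | zero => omega
    | succ n =>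
      obtain ⟨E₁, h1, h2⟩ := h
      obtain ⟨F', h3⟩ := ih h2 (by omega)
      exact ⟨F', E₁, h1, h3⟩

/-- `E` makes internal steps forever, deterministically and without a visible action. -/
def Inf (E : HTerm 0) : Prop := ∀ n, ∃ F, DetN n E F

theorem Inf.of_cong {E F : HTerm 0} (h : Inf E) (hE : Cong E F) : Inf F := fun n =>
  let ⟨H, hH⟩ := h n
  ⟨H, hH.cong_left hE⟩

theorem Inf.of_detN {n : ℕ} {E F : HTerm 0} (h : DetN n E F) (hF : Inf F) : Inf E := fun m => by
  obtain ⟨H, hH⟩ := hF m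
  exact (h.trans hH).of_le (by omega)

theorem Inf.noVis {E : HTerm 0} (h : Inf E) : NoVis E := by
  obtain ⟨F, E₁, h1, -⟩ := h 1
  exact h1.1

/-- By determinism the given step is the first step of every deterministic run from `E`. -/
theorem Inf.cTau {E E' : HTerm 0} (h : Inf E) (h' : CTau E E') : Inf E' := by
  intro n
  obtain ⟨F, E₁, h1, h2⟩ := h (n + 1)
  exact ⟨F, h2.cong_left (h1.2.2 _ h').symm⟩

theorem Inf.par {E D : HTerm 0} (h : Inf E) (hD : Dead D) : Inf (par E D) := fun n =>
  let ⟨_, hH⟩ := h n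
  ⟨_, hH.par hD⟩

theorem Inf.res {E : HTerm 0} (h : Inf E) : Inf (res E) := fun n =>
  let ⟨_, hH⟩ := h n
  ⟨_, hH.res⟩

theorem Inf.diverges {E : HTerm 0} (h : Inf E) : Diverges Tau E :=
  diverges_of_forall Inf (fun E hE => by
    obtain ⟨F, E₁, h1, -⟩ := hE 1
    exact ⟨E₁, h1.2.1.step, hE.cTau h1.2.1⟩) h

theorem DetN.tausC {n : ℕ} {E F : HTerm 0} (h : DetN n E F) : TausC E F := by
  induction n generalizing E with
  | zero => exact .of_cong h
  | succ n ih =>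
    obtain ⟨E₁, h1, h2⟩ := h
    exact h1.2.1.tausC.trans (ih h2)

/-- `E` evolves deterministically to `F`, up to dead processes. -/
def Evolves (E F : HTerm 0) : Prop := ∃ n D, Dead D ∧ DetN n E (par F D)

theorem Evolves.of_cong {E F : HTerm 0} (h : Cong E F) : Evolves E F :=
  ⟨0, nil, dead_nil, h.trans (Cong.par_nil _).symm⟩

theorem Evolves.trans {E F H : HTerm 0} (h : Evolves E F) (h' : Evolves F H) : Evolves E H := by
  obtain ⟨n, D, hD, h1⟩ := h
  obtain ⟨m, D', hD', h2⟩ := h'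
  exact ⟨n + m, par D' D, hD'.par hD, (h1.trans (h2.par hD)).cong_right (.par_assoc _ _ _)⟩

theorem Evolves.of_det {E F D : HTerm 0} (h : Det E (par F D)) (hD : Dead D) : Evolves E F :=
  ⟨1, D, hD, h.detN⟩

theorem Evolves.inf {E F : HTerm 0} (h : Evolves E F) (hF : Inf F) : Inf E := by
  obtain ⟨n, D, hD, h1⟩ := h
  exact (hF.par hD).of_detN h1

/-! ## Silent processes -/

/-- `E` and all its derivatives have no visible action, and diverge. -/
def Spins (E : HTerm 0) : Prop := ∀ E', Taus E E' → NoVis E' ∧ Diverges Tau E'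

theorem Spins.of_forall (P : HTerm 0 → Prop)
    (h : ∀ E, P E → NoVis E ∧ Diverges Tau E ∧ ∀ E', CTau E E' → P E') {E : HTerm 0} (hE : P E) :
    Spins E := by
  intro E' hE'
  have : P E' := by
    induction hE' with
    | refl => exact hE
    | tail _ h1 ih => exact (h _ ih).2.2 _ (step_tau_iff.1 h1)
  exact ⟨(h _ this).1, (h _ this).2.1⟩

theorem Spins.noVis {E : HTerm 0} (h : Spins E) : NoVis E := (h E .refl).1

theorem Spins.diverges {E : HTerm 0} (h : Spins E) : Diverges Tau E := (h E .refl).2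

theorem Spins.cTau {E E' : HTerm 0} (h : Spins E) (h' : CTau E E') : Spins E' :=
  fun _ h1 => h _ (.head h'.step h1)

theorem Diverges.parL {E : HTerm 0} (h : Diverges Tau E) (F : HTerm 0) :
    Diverges Tau (par E F) := by
  obtain ⟨s, rfl, hs⟩ := h
  exact ⟨fun n => par (s n) F, rfl, fun n => Step.tau_parL (hs n) F⟩

theorem Diverges.parR (E : HTerm 0) {F : HTerm 0} (h : Diverges Tau F) :
    Diverges Tau (par E F) := diverges_cong (Diverges.parL h E) (.par_comm _ _)

theorem Spins.of_cong {E F : HTerm 0} (h : Spins E) (hE : Cong E F) : Spins F := by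
  refine Spins.of_forall (fun F => ∃ E, Spins E ∧ Cong E F) ?_ ⟨E, h, hE⟩
  rintro F ⟨E, h, hE⟩
  exact ⟨h.noVis.of_cong hE, diverges_cong h.diverges hE,
    fun E' h' => ⟨E', h.cTau (h'.of_cong hE.symm (.refl _)), .refl _⟩⟩

/-- Two infinite runs interleave nondeterministically, so `Inf` would not be stable here; `Spins` is
the property that survives composition. -/
theorem Spins.par {E F : HTerm 0} (h : Spins E) (h' : Spins F) : Spins (par E F) := by
  refine Spins.of_forall (fun H => ∃ E F, Spins E ∧ Spins F ∧ Cong (HTerm.par E F) H) ?_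
    ⟨E, F, h, h', .refl _⟩
  rintro H ⟨E, F, h, h', hH⟩
  refine ⟨(h.noVis.par h'.noVis).of_cong hH, diverges_cong (Diverges.parL h.diverges F) hH, ?_⟩
  intro H' hH'
  rcases h'.noVis.cTau_par (hH'.of_cong hH.symm (.refl _)) with ⟨E₁, h1, h2⟩ | ⟨E₁, h1, h2⟩
  · exact ⟨_, _, h.cTau h1, h', h2.symm⟩
  · exact ⟨_, _, h, h'.cTau h1, h2.symm⟩

theorem Spins.par_dead {E D : HTerm 0} (h : Spins E) (hD : Dead D) : Spins (HTerm.par E D) := by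
  refine Spins.of_forall (fun H => ∃ E, Spins E ∧ Cong (HTerm.par E D) H) ?_ ⟨E, h, .refl _⟩
  rintro H ⟨E, h, hH⟩
  refine ⟨(h.noVis.par hD.1).of_cong hH, diverges_cong (Diverges.parL h.diverges D) hH, ?_⟩
  intro H' hH'
  rcases hD.1.cTau_par (hH'.of_cong hH.symm (.refl _)) with ⟨E₁, h1, h2⟩ | ⟨E₁, h1, h2⟩
  · exact ⟨_, h.cTau h1, h2.symm⟩
  · exact absurd h1 (hD.2 _)

theorem Inf.spins {E : HTerm 0} (h : Inf E) : Spins E :=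
  Spins.of_forall Inf (fun _ h => ⟨h.noVis, h.diverges, fun _ => h.cTau⟩) h

/-- `S` is silent, and diverges if and only if `b` holds. -/
def Silent (b : Prop) (S : HTerm 0) : Prop := (b ∧ Spins S) ∨ (¬ b ∧ Dead S)

theorem Silent.noVis {b : Prop} {S : HTerm 0} (h : Silent b S) : NoVis S := by
  rcases h with ⟨-, h⟩ | ⟨-, h⟩
  exacts [h.noVis, h.1]

theorem Silent.cTau {b : Prop} {S S' : HTerm 0} (h : Silent b S) (h' : CTau S S') :
    Silent b S' := by
  rcases h with ⟨hb, h⟩ | ⟨hb, h⟩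
  exacts [.inl ⟨hb, h.cTau h'⟩, absurd h' (h.2 _)]

theorem Silent.par {b c : Prop} {S T : HTerm 0} (h : Silent b S) (h' : Silent c T) :
    Silent (b ∨ c) (par S T) := by
  rcases h with ⟨hb, h⟩ | ⟨hb, h⟩ <;> rcases h' with ⟨hc, h'⟩ | ⟨hc, h'⟩
  · exact .inl ⟨.inl hb, h.par h'⟩
  · exact .inl ⟨.inl hb, h.par_dead h'⟩
  · exact .inl ⟨.inr hc, (h'.par_dead h).of_cong (.par_comm _ _)⟩
  · exact .inr ⟨by tauto, h.par h'⟩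

theorem diverges_of_par_dead {E D : HTerm 0} (hD : Dead D) (h : Diverges Tau (par E D)) :
    Diverges Tau E := by
  refine diverges_of_forall (fun E => Diverges Tau (par E D)) ?_ h
  intro E h
  obtain ⟨H, h1, h2⟩ := h.exists_step
  rcases hD.1.cTau_par (step_tau_iff.1 h1) with ⟨E₁, h3, h4⟩ | ⟨E₁, h3, h4⟩
  · exact ⟨E₁, h3.step, diverges_cong h2 h4⟩
  · exact absurd h3 (hD.2 _)

/-! ## Context bisimilarity -/

theorem Step.weak {E E' : HTerm 0} {l : HAct} (h : Step E l E') : Weak E l E' :=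
  ⟨E, E', .refl, h, .refl⟩

/-- Silent components with the same divergence are exchangeable. -/
theorem bisimilar_of_silent {b : Prop} {A S T E F : HTerm 0} (hS : Silent b S) (hT : Silent b T)
    (hE : Cong E (par A S)) (hF : Cong F (par A T)) : Bisimilar E F := by
  refine ⟨fun E F => ∃ A S T, Silent b S ∧ Silent b T ∧ Cong E (par A S) ∧ Cong F (par A T),
    ⟨?_, ?_, ?_, ?_⟩, ?_, A, S, T, hS, hT, hE, hF⟩
  · rintro E F ⟨A, S, T, hS, hT, hE, hF⟩
    exact ⟨A, T, S, hT, hS, hF, hE⟩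
  · rintro E F E' ⟨A, S, T, hS, hT, hE, hF⟩ h
    rcases hS.noVis.cTau_par ((step_tau_iff.1 h).of_cong hE (.refl _)) with
      ⟨A₁, h1, h2⟩ | ⟨S₁, h1, h2⟩
    · exact ⟨par A₁ T, .single (Step.of_cong (h1.step.tau_parL T) hF.symm (.refl _)),
        A₁, S, T, hS, hT, h2, .refl _⟩
    · exact ⟨F, .refl, A, S₁, T, hS.cTau h1, hT, h2, hF⟩
  · rintro E F a M E' ⟨A, S, T, hS, hT, hE, hF⟩ h
    obtain ⟨G, h1, h2⟩ := step_inp_iff.1 h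
    rcases cIn_par.1 (h1.of_cong hE (.refl _)) with ⟨G', h3, h4⟩ | ⟨G', h3, h4⟩
    · have h5 : CIn F a (par G' (const T)) :=
        (cIn_par.2 (.inl ⟨G', h3, .refl _⟩)).of_cong hF.symm (.refl _)
      refine ⟨_, (h5.step M).weak, inst G' M, S, T, hS, hT, ?_, ?_⟩
      · refine h2.trans ((h4.inst (.refl _)).trans ?_)
        rw [inst_par, inst_const]
        exact .refl _
      · rw [inst_par, inst_const]
        exact .refl _
    · exact absurd h3 (hS.noVis.1 _ _)
  · rintro E F k a M E' ⟨A, S, T, hS, hT, hE, hF⟩ h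
    rcases cOut_par.1 (h.cOut.of_cong hE fun _ => .refl _) with ⟨κ, h3, h4⟩ | ⟨κ, h3, h4⟩
    · have h5 : COut F a fun G => par (κ G) T :=
        (cOut_par.2 (.inl ⟨κ, h3, fun _ => .refl _⟩)).of_cong hF.symm fun _ => .refl _
      obtain ⟨l, N, F', h6, h7⟩ := h5.step
      -- The common part in the relation is arbitrary, so `κ G` can take its place for every
      -- receiver `G`.
      exact ⟨l, N, F', h6.weak, fun G => ⟨κ G, S, T, hS, hT, h4 G, h7 G⟩⟩
    · exact absurd h3 (hS.noVis.2 _ _)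
  · rintro E F ⟨A, S, T, hS, hT, hE, hF⟩ h
    -- If `b` holds, `S` alone diverges; otherwise both silent parts are dead and the divergence
    -- comes from the common part.
    rcases hS with ⟨-, hS⟩ | ⟨hb, hS⟩
    · exact diverges_cong (Diverges.parR A hS.diverges) hE.symm
    · rcases hT with ⟨hb', -⟩ | ⟨-, hT⟩
      · exact absurd hb' hb
      · exact diverges_cong (Diverges.parL (diverges_of_par_dead hT (diverges_cong h hF)) S) hE.symm

/-! ### Using bisimilarity as a bisimulation -/

theorem Bisimilar.symm {E F : HTerm 0} (h : Bisimilar E F) : Bisimilar F E := by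
  obtain ⟨R, h1, h2, h3⟩ := h
  exact ⟨R, h1, h2, h1.symm _ _ h3⟩

theorem Bisimilar.tau {E F E' : HTerm 0} (h : Bisimilar E F) (h' : Step E .tau E') :
    ∃ F', Taus F F' ∧ Bisimilar E' F' := by
  obtain ⟨R, h1, h2, h3⟩ := h
  obtain ⟨F', h4, h5⟩ := h1.tau _ _ _ h3 h'
  exact ⟨F', h4, R, h1, h2, h5⟩

theorem Bisimilar.taus {E F E' : HTerm 0} (h : Bisimilar E F) (h' : Taus E E') :
    ∃ F', Taus F F' ∧ Bisimilar E' F' := by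
  induction h' with
  | refl => exact ⟨F, .refl, h⟩
  | tail _ h1 ih =>
    obtain ⟨F', h2, h3⟩ := ih
    obtain ⟨F'', h4, h5⟩ := h3.tau h1
    exact ⟨F'', h2.trans h4, h5⟩

theorem Bisimilar.inp {E F E' M : HTerm 0} {a : ℕ} (h : Bisimilar E F)
    (h' : Step E (.inp a M) E') : ∃ F', Weak F (.inp a M) F' ∧ Bisimilar E' F' := by
  obtain ⟨R, h1, h2, h3⟩ := h
  obtain ⟨F', h4, h5⟩ := h1.inp _ _ _ _ _ h3 h'
  exact ⟨F', h4, R, h1, h2, h5⟩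

theorem Bisimilar.out {E F E' M : HTerm 0} {k a : ℕ} (h : Bisimilar E F)
    (h' : Step E (.out k a M) E') : ∃ l N F', Weak F (.out l a N) F' ∧
      ∀ G, Bisimilar (plug G k M E') (plug G l N F') := by
  obtain ⟨R, h1, h2, h3⟩ := h
  obtain ⟨l, N, F', h4, h5⟩ := h1.out _ _ _ _ _ _ h3 h'
  exact ⟨l, N, F', h4, fun G => ⟨R, h1, h2, h5 G⟩⟩

theorem Bisimilar.diverges {E F : HTerm 0} (h : Bisimilar E F) (h' : Diverges Tau F) :
    Diverges Tau E := by
  obtain ⟨R, h1, h2, h3⟩ := h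
  exact h2 _ _ h3 h'

end HTerm

namespace HTerm

/-! ## Binary trees as processes -/

/-- The empty tree: it answers on its second argument. -/
def leaf {n : ℕ} : HTerm n := abs 1 (out 1 nil nil)

/-- The tree with the subtrees `H` and `T`: it sends them on its first argument. -/
def node {n : ℕ} (H T : HTerm n) : HTerm n :=
  abs 1 (out 0 (shift 2 H) (out 0 (shift 2 T) nil))

/-- Unary notation as a list of empty trees, so that a single case distinction serves numbers and
lists. -/
def num {n : ℕ} : ℕ → HTerm n
  | 0 => leaf
  | k + 1 => node leaf (num k)

def lst {n : ℕ} : List ℕ → HTerm n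
  | [] => leaf
  | a :: l => node (num a) (lst l)

/-- Case distinction on the tree `X`. In `B` the variables `1` and `0` are the subtrees. -/
def mtch {n : ℕ} (X A : HTerm n) (B : HTerm (n + 2)) : HTerm n :=
  res (res (par (app (r := 1) (shift 2 X) (fun i => i.val))
    (par (inp 1 (renameVar Fin.succ (shift 2 A))) (inp 0 (inp 0 (shift 2 B))))))

@[simp] theorem rename_leaf {n : ℕ} (ρ : ℕ → ℕ) : rename ρ (leaf : HTerm n) = leaf := rfl

@[simp] theorem rename_node {n : ℕ} (ρ : ℕ → ℕ) (H T : HTerm n) :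
    rename ρ (node H T) = node (rename ρ H) (rename ρ T) := by
  simp only [node, rename, Nat.reduceAdd, rename_shift]
  rfl

@[simp] theorem rename_num {n : ℕ} (ρ : ℕ → ℕ) (k : ℕ) : rename ρ (num k : HTerm n) = num k := by
  induction k with
  | zero => rfl
  | succ k ih => simp [num, ih]

@[simp] theorem rename_lst {n : ℕ} (ρ : ℕ → ℕ) (l : List ℕ) :
    rename ρ (lst l : HTerm n) = lst l := by
  induction l with
  | nil => rfl
  | cons a l ih => simp [lst, ih]

@[simp] theorem subst_leaf {n m : ℕ} (θ : Fin n → HTerm m) : subst θ leaf = leaf := rfl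

@[simp] theorem subst_node {n m : ℕ} (θ : Fin n → HTerm m) (H T : HTerm n) :
    subst θ (node H T) = node (subst θ H) (subst θ T) := by
  simp only [node, subst, shift_subst]

theorem rename_mtch {n : ℕ} (ρ : ℕ → ℕ) (X A : HTerm n) (B : HTerm (n + 2)) :
    rename ρ (mtch X A B) = mtch (rename ρ X) (rename ρ A) (rename ρ B) := by
  simp only [mtch, rename, liftName_liftName, Nat.reduceAdd, rename_renameVar, rename_shift]
  congr 5
  funext i
  simp [liftName, i.isLt]

theorem subst_mtch {n m : ℕ} (θ : Fin n → HTerm m) (X A : HTerm n) (B : HTerm (n + 2)) :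
    subst θ (mtch X A B) = mtch (subst θ X) (subst θ A) (subst (up (up θ)) B) := by
  simp only [mtch, subst, shift_shift, Nat.reduceAdd, shift_subst, subst_renameVar,
    renameVar_subst]
  congr 8
  funext i
  refine Fin.cases rfl (fun i => ?_) i
  refine Fin.cases rfl (fun i => ?_) i
  simp only [up_succ, shift_renameVar]
  rfl

/-! ### Deterministic communications -/

theorem cIn_resN {k : ℕ} {E : HTerm 0} {a : ℕ} {G : HTerm 1} (h : CIn (resN k E) a G) :
    ∃ G', CIn E (a + k) G' := by
  induction k generalizing a G with
  | zero => exact ⟨G, h⟩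
  | succ k ih =>
    obtain ⟨G', h1, -⟩ := cIn_res.1 h
    obtain ⟨G'', h2⟩ := ih h1
    exact ⟨G'', by rwa [Nat.add_assoc, Nat.add_comm 1 k] at h2⟩

theorem cOut_resN {k : ℕ} {E : HTerm 0} {a : ℕ} {κ : HTerm 1 → HTerm 0}
    (h : COut (resN k E) a κ) : ∃ κ', COut E (a + k) κ' := by
  induction k generalizing a κ with
  | zero => exact ⟨κ, h⟩
  | succ k ih =>
    obtain ⟨κ', h1, -⟩ := cOut_res.1 h
    obtain ⟨κ'', h2⟩ := ih h1
    exact ⟨κ'', by rwa [Nat.add_assoc, Nat.add_comm 1 k] at h2⟩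

theorem cTau_resN {k : ℕ} {E E' : HTerm 0} :
    CTau (resN k E) E' ↔ ∃ E₁, CTau E E₁ ∧ Cong E' (resN k E₁) := by
  induction k generalizing E' with
  | zero =>
    exact ⟨fun h => ⟨E', h, .refl _⟩, fun ⟨E₁, h1, h2⟩ => h1.of_cong (.refl _) h2.symm⟩
  | succ k ih =>
    refine cTau_res.trans ⟨?_, ?_⟩
    · rintro ⟨E₁, h1, h2⟩
      obtain ⟨E₂, h3, h4⟩ := ih.1 h1
      exact ⟨E₂, h3, h2.trans h4.res⟩
    · rintro ⟨E₁, h1, h2⟩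
      exact ⟨_, ih.2 ⟨E₁, h1, .refl _⟩, h2⟩

theorem noVis_resN {k : ℕ} {E : HTerm 0} (h : ∀ a G, CIn E a G → a < k)
    (h' : ∀ a κ, COut E a κ → a < k) : NoVis (resN k E) := by
  constructor
  · intro a G hG
    obtain ⟨G', h1⟩ := cIn_resN hG
    have := h _ _ h1
    omega
  · intro a G hG
    obtain ⟨G', h1⟩ := cOut_resN hG
    have := h' _ _ h1
    omega

/-- All actions of `W` are inputs, on names below `k` other than `c`. -/
def Awaits (k c : ℕ) (W : HTerm 0) : Prop :=
  (∀ a G, CIn W a G → a < k ∧ a ≠ c) ∧ (∀ a κ, ¬ COut W a κ) ∧ ∀ W', ¬ CTau W W'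

theorem Awaits.inp {k c a : ℕ} (h : a < k) (h' : a ≠ c) (F : HTerm 1) : Awaits k c (inp a F) :=
  ⟨fun b G hG => by obtain ⟨rfl, -⟩ := cIn_inp.1 hG; exact ⟨h, h'⟩, fun _ _ => not_cOut_inp,
    fun _ => not_cTau_inp⟩

theorem Awaits.dead {k c : ℕ} {W : HTerm 0} (h : Awaits k c W) : Dead (resN k W) := by
  refine ⟨noVis_resN (fun a G hG => (h.1 a G hG).1) fun a κ hκ => absurd hκ (h.2.1 a κ), ?_⟩
  intro E' hE'
  obtain ⟨E₁, h1, -⟩ := cTau_resN.1 hE'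
  exact h.2.2 _ h1

theorem Dead.awaits {D : HTerm 0} (h : Dead D) (k c : ℕ) : Awaits k c D :=
  ⟨fun a G hG => absurd hG (h.1.1 a G), h.1.2, h.2⟩

/-- The channel is private and `W` neither listens on it nor acts by itself, so the output has
exactly one partner and nothing is visible outside. -/
theorem det_com {k c : ℕ} (hc : c < k) (F : HTerm 1) (M C : HTerm 0) {W : HTerm 0}
    (hW : Awaits k c W) :
    Det (resN k (par (par (inp c F) (out c M C)) W)) (resN k (par (par (inst F M) C) W)) := by
  have hin : ∀ a G, CIn (par (inp c F) (out c M C)) a G → a = c := by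
    intro a G hG
    rcases cIn_par.1 hG with ⟨G', h1, -⟩ | ⟨G', h1, -⟩
    · exact (cIn_inp.1 h1).1
    · exact absurd h1 not_cIn_out
  have hout : ∀ a κ, COut (par (inp c F) (out c M C)) a κ → a = c := by
    intro a G hG
    rcases cOut_par.1 hG with ⟨G', h1, -⟩ | ⟨G', h1, -⟩
    · exact absurd h1 not_cOut_inp
    · exact (cOut_out.1 h1).1
  refine ⟨noVis_resN ?_ ?_, cTau_resN.2 ⟨_, cTau_par.2 (.inl ⟨_, cTau_par.2 (.inr (.inr (.inl
    ⟨c, F, fun G => par (inst G M) C, cIn_inp.2 ⟨rfl, .refl _⟩,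
      cOut_out.2 ⟨rfl, fun _ => .refl _⟩, .refl _⟩))), .refl _⟩), .refl _⟩, ?_⟩
  · intro a G hG
    rcases cIn_par.1 hG with ⟨G', h1, -⟩ | ⟨G', h1, -⟩
    · rwa [hin _ _ h1]
    · exact (hW.1 _ _ h1).1
  · intro a κ hκ
    rcases cOut_par.1 hκ with ⟨G', h1, -⟩ | ⟨G', h1, -⟩
    · rwa [hout _ _ h1]
    · exact absurd h1 (hW.2.1 _ _)
  · intro E' hE'
    obtain ⟨E₁, h1, h2⟩ := cTau_resN.1 hE'
    refine h2.trans (Cong.resN ?_ k)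
    rcases cTau_par.1 h1 with ⟨E₂, h3, h4⟩ | ⟨E₂, h3, h4⟩ | ⟨a, G, κ, h3, h4, h5⟩ |
      ⟨a, G, κ, h3, h4, h5⟩
    · refine h4.trans (.parL ?_ _)
      rcases cTau_par.1 h3 with ⟨E₃, h5, -⟩ | ⟨E₃, h5, -⟩ | ⟨a, G, κ, h5, h6, h7⟩ |
        ⟨a, G, κ, h5, h6, h7⟩
      · exact absurd h5 not_cTau_inp
      · exact absurd h5 not_cTau_out
      · exact h7.trans (((cOut_out.1 h6).2 G).trans (.parL ((cIn_inp.1 h5).2.inst (.refl _)) _))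
      · exact absurd h5 not_cOut_inp
    · exact absurd h3 (hW.2.2 _)
    · exact absurd h4 (hW.2.1 _ _)
    · exact absurd (hout _ _ h3) (hW.1 _ _ h4).2

theorem cong_res_res_shift (A W : HTerm 0) :
    Cong (resN 2 (par (par (shift 2 A) nil) W)) (par A (resN 2 W)) :=
  (((Cong.par_nil _).parL _).resN 2).trans (.resN_par' 2 _ _)

theorem app_leaf {n : ℕ} : Cong (app (r := 1) (leaf : HTerm n) (fun i => i.val)) (out 1 nil nil) :=
  .beta _ _

theorem app_node {n : ℕ} (H T : HTerm n) :
    Cong (app (r := 1) (node H T) (fun i => i.val)) (out 0 H (out 0 T nil)) := by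
  refine (Cong.beta _ _).trans ?_
  have : ∀ E : HTerm n, rename (instName (r := 1) fun i => i.val) (shift 2 E) = E := fun E => by
    rw [rename_shift_of (l := 0) (instName_add _), shift_zero]
  simp only [rename, this]
  exact .refl _

/-- The branch not taken waits forever on the private name `0`; it is the dead garbage. -/
theorem mtch_leaf (A : HTerm 0) (B : HTerm 2) : Evolves (mtch leaf A B) A := by
  have h := det_com (k := 2) (c := 1) (by omega) (renameVar Fin.succ (shift 2 A)) nil nil
    (Awaits.inp (k := 2) (c := 1) (a := 0) (by omega) (by omega) (inp 0 (shift 2 B)))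
  rw [inst, subst_renameVar, subst_closed] at h
  refine .of_det (h.of_cong ?_ (cong_res_res_shift _ _)) (Awaits.dead (c := 1) ?_)
  · refine Cong.resN ?_ 2
    refine (Cong.par_assoc _ _ _).trans ((Cong.par_left_comm _ _ _).trans ?_)
    exact .parL app_leaf.symm _
  · exact Awaits.inp (by omega) (by omega) _

/-- The substitution of two closed terms. -/
def pairSubst (H T : HTerm 0) : Fin 2 → HTerm 0 := Fin.cases T (fun _ => H)

theorem mtch_node (H T A : HTerm 0) (B : HTerm 2) :
    Evolves (mtch (node H T) A B) (subst (pairSubst H T) B) := by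
  set A' := renameVar (Fin.succ : Fin 0 → Fin 1) (shift 2 A)
  have hA : Awaits 2 0 (inp 1 A') := .inp (by omega) (by omega) _
  have h1 := det_com (k := 2) (c := 0) (by omega) (inp 0 (shift 2 B)) (shift 2 H)
    (out 0 (shift 2 T) nil) hA
  have h2 := det_com (k := 2) (c := 0) (by omega)
    (subst (up fun _ => shift 2 H) (shift 2 B)) (shift 2 T) nil hA
  have e : inst (subst (up fun _ => shift 2 H) (shift 2 B)) (shift 2 T) =
      shift 2 (subst (pairSubst H T) B) := by
    rw [inst, subst_subst, shift_subst]
    congr 1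
    funext i
    refine Fin.cases rfl (fun i => ?_) i
    rw [up_succ, subst_renameVar, subst_closed]
    rfl
  rw [e] at h2
  -- One step for each subtree. The garbage is the branch for `leaf`, waiting on the private name
  -- `1`.
  refine ⟨2, _, hA.dead, ?_⟩
  refine DetN.cong_left (E := resN 2 (par (par (inp 0 (inp 0 (shift 2 B)))
    (out 0 (shift 2 H) (out 0 (shift 2 T) nil))) (inp 1 A'))) ?_ ?_
  · exact ⟨_, h1, _, h2, cong_res_res_shift _ _⟩
  · refine Cong.resN ?_ 2
    refine ((Cong.par_comm _ _).parL _).trans ((Cong.par_assoc _ _ _).trans ?_)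
    refine .par ?_ (.par_comm _ _)
    rw [show shift 2 (node H T) = node (shift 2 H) (shift 2 T) from rename_node _ _ _]
    exact (app_node _ _).symm

end HTerm

open Turing.ToPartrec (Code)

namespace HTerm

/-! ## Compilation of the partial recursive functions -/

/-- The instance `κ[t]` of a continuation, in a larger context. -/
def instAt {n m : ℕ} (κ : HTerm (n + 1)) (t : HTerm m) (ξ : Fin n → Fin m) : HTerm m :=
  subst (Fin.cases t (fun i => var (ξ i))) κ

theorem rename_instAt {n m : ℕ} (ρ : ℕ → ℕ) (κ : HTerm (n + 1)) (t : HTerm m)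
    (ξ : Fin n → Fin m) : rename ρ (instAt κ t ξ) = instAt (rename ρ κ) (rename ρ t) ξ := by
  rw [instAt, rename_subst, instAt]
  congr 1
  funext i
  refine Fin.cases rfl (fun i => ?_) i
  rfl

theorem subst_instAt {n n' m m' : ℕ} (κ : HTerm (n + 1)) (t : HTerm m) (ξ : Fin n → Fin m)
    (θ : Fin m → HTerm m') (η : Fin n → HTerm n') (ξ' : Fin n' → Fin m')
    (h : ∀ i, θ (ξ i) = renameVar ξ' (η i)) :
    subst θ (instAt κ t ξ) = instAt (subst (up η) κ) (subst θ t) ξ' := by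
  rw [instAt, subst_subst, instAt, subst_subst]
  congr 1
  funext i
  refine Fin.cases rfl (fun i => ?_) i
  simp only [Fin.cases_succ, up_succ, subst_renameVar]
  rw [subst, h, renameVar_eq_subst]

/-- Extension of a substitution by the value of the innermost variable. -/
def consSubst {n m : ℕ} (A : HTerm m) (θ : Fin n → HTerm m) : Fin (n + 1) → HTerm m :=
  Fin.cases A θ

@[simp] theorem consSubst_succ {n m : ℕ} (A : HTerm m) (θ : Fin n → HTerm m) (i : Fin n) :
    consSubst A θ i.succ = θ i := rfl

theorem subst_consSubst_up {n m l : ℕ} (E : HTerm (n + 1)) (A : HTerm l) (η : Fin m → HTerm l)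
    (θ : Fin n → HTerm m) : subst (consSubst A η) (subst (up θ) E) =
      subst (consSubst A fun i => subst η (θ i)) E := by
  rw [subst_subst]
  congr 1
  funext i
  refine Fin.cases rfl (fun i => ?_) i
  simp only [up_succ, subst_renameVar, consSubst_succ]

theorem inst_subst_up {n : ℕ} (K : HTerm (n + 1)) (A : HTerm 0) (θ : Fin n → HTerm 0) :
    inst (subst (up θ) K) A = subst (consSubst A θ) K := by
  have : (fun _ => A : Fin 1 → HTerm 0) = consSubst A Fin.elim0 := by
    funext i
    rw [Fin.fin_one_eq_zero i]
    rfl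
  rw [inst, this, subst_consSubst_up]
  simp only [subst_closed]

theorem subst_pairSubst_up {n : ℕ} (B : HTerm (n + 2)) (H T : HTerm 0) (θ : Fin n → HTerm 0) :
    subst (pairSubst H T) (subst (up (up θ)) B) = subst (consSubst T (consSubst H θ)) B := by
  have : pairSubst H T = consSubst T (consSubst H Fin.elim0) := by
    funext i
    refine Fin.cases rfl (fun i => ?_) i
    rw [Fin.fin_one_eq_zero i]
    rfl
  rw [this, subst_consSubst_up]
  congr 2
  funext i
  refine Fin.cases rfl (fun i => ?_) i
  simp only [up_succ, subst_renameVar, consSubst_succ, subst_closed]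

theorem subst_instAt_closed {m : ℕ} (κ : HTerm 1) (t : HTerm m) (ξ : Fin 0 → Fin m)
    (θ : Fin m → HTerm 0) : subst θ (instAt κ t ξ) = inst κ (subst θ t) := by
  rw [instAt, subst_subst, inst]
  congr 1
  funext i
  rw [Fin.fin_one_eq_zero i]
  rfl

/-- A continuation that was merely carried into a larger context is recovered once that context is
closed. -/
theorem subst_up_instAt_var {m : ℕ} (κ : HTerm 1) (ξ : Fin 0 → Fin (m + 1))
    (θ : Fin m → HTerm 0) : subst (up θ) (instAt κ (var 0) ξ) = κ := by
  rw [instAt, subst_subst]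
  conv_rhs => rw [← subst_var κ]
  congr 1
  funext i
  rw [Fin.fin_one_eq_zero i]
  rfl

/-- The continuation of the body of a loop. The variables `0`, `1` and `2` are the result of the
body, the loop and the argument of the body. -/
def loopCont {n : ℕ} (κ : HTerm (n + 1)) : HTerm (n + 3) :=
  mtch (var 0) (instAt κ leaf fun i => i.succ.succ.succ)
    (mtch (var (Fin.succ 0)) (instAt κ (var 0) fun i => i.succ.succ.succ.succ.succ)
      (par (var (Fin.succ 0).succ.succ.succ.succ)
        (out 0 (var (Fin.succ 0).succ) (out 0 (var (Fin.succ 0).succ.succ.succ.succ) nil))))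

/-- The process that runs the program `c` on the list `X` and continues with `κ`, applied to the
result. -/
def run : Code → {n : ℕ} → HTerm (n + 1) → HTerm n → HTerm n
  | .zero', _, κ, X => instAt κ (node leaf X) fun i => i
  | .succ, _, κ, X =>
    mtch X (instAt κ (node (node leaf leaf) leaf) fun i => i)
      (instAt κ (node (node leaf (var (Fin.succ 0))) leaf) fun i => i.succ.succ)
  | .tail, _, κ, X => mtch X (instAt κ leaf fun i => i) (instAt κ (var 0) fun i => i.succ.succ)
  | .cons f fs, _, κ, X =>
    run f (mtch (var 0)
      (run fs (instAt κ (node leaf (var 0)) fun i => i.succ.succ) (renameVar Fin.succ X))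
      (run fs (instAt κ (node (var (Fin.succ 0).succ) (var 0)) fun i => i.succ.succ.succ.succ)
        (renameVar (fun i => i.succ.succ.succ) X))) X
  | .comp f g, _, κ, X => run g (run f (instAt κ (var 0) fun i => i.succ.succ) (var 0)) X
  | .case f g, _, κ, X =>
    mtch X (run f κ leaf)
      (mtch (var (Fin.succ 0)) (run f (instAt κ (var 0) fun i => i.succ.succ.succ) (var 0))
        (run g (instAt κ (var 0) fun i => i.succ.succ.succ.succ.succ)
          (node (var 0) (var (Fin.succ 0).succ))))
  | .fix f, _, κ, X =>
    res (par (inp 0 (inp 0 (run f (loopCont (shift 1 κ)) (var (Fin.succ 0)))))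
      (out 0 (shift 1 X) (out 0 (inp 0 (inp 0
        (run f (loopCont (shift 1 κ)) (var (Fin.succ 0))))) nil)))

theorem rename_loopCont {n : ℕ} (ρ : ℕ → ℕ) (κ : HTerm (n + 1)) :
    rename (liftName 1 ρ) (loopCont κ) = loopCont (rename (liftName 1 ρ) κ) := by
  simp only [loopCont, rename_mtch, rename_instAt, rename, rename_leaf]
  rfl

theorem subst_loopCont {n m : ℕ} (θ : Fin n → HTerm m) (κ : HTerm (n + 1)) :
    subst (up (up (up θ))) (loopCont κ) = loopCont (subst (up θ) κ) := by
  simp only [loopCont, subst_mtch]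
  rw [subst_instAt (η := θ) (ξ' := fun i => i.succ.succ.succ),
    subst_instAt (η := θ) (ξ' := fun i => i.succ.succ.succ.succ.succ)]
  · rfl
  · intro i; simp only [up_succ, renameVar_renameVar]
  · intro i; simp only [up_succ, renameVar_renameVar]

theorem rename_run (c : Code) {n : ℕ} (ρ : ℕ → ℕ) (κ : HTerm (n + 1)) (X : HTerm n) :
    rename ρ (run c κ X) = run c (rename ρ κ) (rename ρ X) := by
  induction c generalizing n ρ with
  | zero' => simp only [run, rename_instAt, rename_node, rename_leaf]
  | succ => simp only [run, rename_mtch, rename_instAt, rename_node, rename_leaf, rename]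
  | tail => simp only [run, rename_mtch, rename_instAt, rename_leaf, rename]
  | cons f fs ih1 ih2 =>
    simp only [run, ih1, ih2, rename_mtch, rename_instAt, rename_node, rename_leaf,
      rename_renameVar, rename]
  | comp f g ih1 ih2 => simp only [run, ih1, ih2, rename_instAt, rename]
  | case f g ih1 ih2 =>
    simp only [run, ih1, ih2, rename_mtch, rename_instAt, rename_node, rename_leaf, rename]
  | fix f ih =>
    simp only [run, rename, ih, rename_loopCont, rename_shift]
    rfl

theorem subst_run (c : Code) {n m : ℕ} (θ : Fin n → HTerm m) (κ : HTerm (n + 1)) (X : HTerm n) :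
    subst θ (run c κ X) = run c (subst (up θ) κ) (subst θ X) := by
  induction c generalizing n m with
  | zero' =>
    simp only [run]
    rw [subst_instAt (η := θ) (ξ' := fun i => i)]
    · simp
    · intro i; simp [renameVar_eq_subst, subst_var]
  | succ =>
    simp only [run, subst_mtch]
    rw [subst_instAt (η := θ) (ξ' := fun i => i), subst_instAt (η := θ) (ξ' := fun i => i.succ.succ)]
    · rfl
    · intro i; simp only [up_succ, renameVar_renameVar]
    · intro i; simp [renameVar_eq_subst, subst_var]
  | tail =>
    simp only [run, subst_mtch]
    rw [subst_instAt (η := θ) (ξ' := fun i => i), subst_instAt (η := θ) (ξ' := fun i => i.succ.succ)]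
    · rfl
    · intro i; simp only [up_succ, renameVar_renameVar]
    · intro i; simp [renameVar_eq_subst, subst_var]
  | cons f fs ih1 ih2 =>
    simp only [run, subst_mtch, ih1, ih2]
    rw [subst_instAt (η := θ) (ξ' := fun i => i.succ.succ),
      subst_instAt (η := θ) (ξ' := fun i => i.succ.succ.succ.succ)]
    · simp only [subst_renameVar, renameVar_subst, up_succ, renameVar_renameVar]
      rfl
    · intro i; simp only [up_succ, renameVar_renameVar]
    · intro i; simp only [up_succ, renameVar_renameVar]
  | comp f g ih1 ih2 =>
    simp only [run, ih1, ih2]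
    rw [subst_instAt (η := θ) (ξ' := fun i => i.succ.succ)]
    · rfl
    · intro i; simp only [up_succ, renameVar_renameVar]
  | case f g ih1 ih2 =>
    simp only [run, subst_mtch, ih1, ih2]
    rw [subst_instAt (η := θ) (ξ' := fun i => i.succ.succ.succ),
      subst_instAt (η := θ) (ξ' := fun i => i.succ.succ.succ.succ.succ)]
    · simp only [subst_node]
      rfl
    · intro i; simp only [up_succ, renameVar_renameVar]
    · intro i; simp only [up_succ, renameVar_renameVar]
  | fix f ih =>
    have h : up (fun i => shift 1 (θ i)) = fun i => shift 1 (up θ i) := by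
      funext i
      refine Fin.cases rfl (fun i => ?_) i
      simp only [up_succ, shift_renameVar]
    simp only [run, subst, ← shift_subst]
    change res (par (inp 0 (inp 0 (subst (up (up _)) _)))
      (out 0 _ (out 0 (inp 0 (inp 0 (subst (up (up _)) _))) nil))) = _
    simp only [ih, subst_loopCont]
    rw [h, ← shift_subst]
    rfl

/-- Garbage of one round of a loop stays inside the loop's restriction, where it accumulates. -/
theorem Evolves.res_par {E F D : HTerm 0} (h : Evolves E F) (hD : Dead D) :
    ∃ n D', Dead D' ∧ DetN n (HTerm.res (HTerm.par E D)) (HTerm.res (HTerm.par F D')) := by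
  obtain ⟨n, D₁, h1, h2⟩ := h
  exact ⟨n, _, h1.par hD, (h2.par hD).res.cong_right (Cong.par_assoc _ _ _).res⟩

/-- The running loop on the list `v`, next to garbage. -/
theorem loop_body (f : Code) (κ : HTerm 1) (v : List ℕ) {D : HTerm 0} (hD : Dead D) :
    let L : HTerm 0 := inp 0 (inp 0 (run f (loopCont κ) (var (Fin.succ 0))))
    DetN 2 (res (par (par L (out 0 (lst v) (out 0 L nil))) D))
      (res (par (run f (subst (up (pairSubst (lst v) L)) (loopCont κ)) (lst v)) D)) := by
  intro L
  -- The body receives first the list and then a copy of the loop, both on the same private name.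
  have h1 := det_com (k := 1) (c := 0) (by omega)
    (inp 0 (run f (loopCont κ) (var (Fin.succ 0)))) (lst v) (out 0 L nil) (hD.awaits 1 0)
  have h2 := det_com (k := 1) (c := 0) (by omega)
    (subst (up fun _ => lst v) (run f (loopCont κ) (var (Fin.succ 0)))) L nil (hD.awaits 1 0)
  refine ⟨_, h1, _, h2, ?_⟩
  refine Cong.resN (Cong.parL ((Cong.par_nil _).trans ?_) _) 1
  rw [inst_subst_up, subst_run]
  exact .refl _

theorem loopCont_halt (κ : HTerm 1) (θ : Fin 2 → HTerm 0) {w : List ℕ} (hw : w.headI = 0) :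
    Evolves (inst (subst (up θ) (loopCont κ)) (lst w)) (inst κ (lst w.tail)) := by
  rw [inst_subst_up, loopCont, subst_mtch]
  match w, hw with
  -- The empty list has default head `0`, so the loop halts; its tail is again empty.
  | [], _ =>
    refine (mtch_leaf _ _).trans (.of_cong ?_)
    rw [subst_instAt_closed]
    exact .refl _
  | 0 :: w, _ =>
    refine (mtch_node _ _ _ _).trans ?_
    rw [subst_pairSubst_up, subst_mtch]
    refine (mtch_leaf _ _).trans (.of_cong ?_)
    rw [subst_instAt_closed]
    exact .refl _

/-- The copy of the loop received with the argument is used twice, as the next receiver and as the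
next message. This restores the initial state with a new list. -/
theorem loopCont_continue (κ : HTerm 1) (X L : HTerm 0) {w : List ℕ} (hw : w.headI ≠ 0) :
    Evolves (inst (subst (up (pairSubst X L)) (loopCont κ)) (lst w))
      (par L (out 0 (lst w.tail) (out 0 L nil))) := by
  rw [inst_subst_up, loopCont, subst_mtch]
  match w, hw with
  | (a + 1) :: w, _ =>
    refine (mtch_node _ _ _ _).trans ?_
    rw [subst_pairSubst_up, subst_mtch]
    refine (mtch_node _ _ _ _).trans ?_
    rw [subst_pairSubst_up]
    exact .of_cong (.refl _)

/-! ### Correctness of the compiled programs -/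

/-- What `run` has to do for a given program. -/
def RunSpec (c : Code) : Prop := ∀ (κ : HTerm 1) (v : List ℕ),
  (∀ w ∈ c.eval v, Evolves (run c κ (lst v)) (inst κ (lst w))) ∧
    (¬ (c.eval v).Dom → Inf (run c κ (lst v)))

/-- Between rounds the state is the loop about to receive its argument and itself, next to dead
garbage, under one restriction. Termination is an induction on the fixed point; for nontermination
runs of every finite length are built, since each round has positive length. -/
theorem RunSpec.fix {f : Code} (hf : RunSpec f) : RunSpec (.fix f) := by
  intro κ v
  set κ' := shift 1 κ
  set L : HTerm 0 := inp 0 (inp 0 (run f (loopCont κ') (var (Fin.succ 0)))) with hL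
  have hstart : ∀ v, run (.fix f) κ (lst v) = res (par L (out 0 (lst v) (out 0 L nil))) := by
    intro v
    rw [run, show shift 1 (lst v : HTerm 0) = lst v from rename_lst _ _]
  have hstart' : ∀ v, Cong (res (par (par L (out 0 (lst v) (out 0 L nil))) nil))
      (run (.fix f) κ (lst v)) := fun v => by rw [hstart]; exact (Cong.par_nil _).res
  have hbody : ∀ v D, Dead D → DetN 2 (res (par (par L (out 0 (lst v) (out 0 L nil))) D))
      (res (par (run f (subst (up (pairSubst (lst v) L)) (loopCont κ')) (lst v)) D)) :=
    fun v D hD => loop_body f κ' v hD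
  rw [Code.fix_eval]
  set F : List ℕ →. List ℕ ⊕ List ℕ := fun v => (f.eval v).map fun v =>
      if v.headI = 0 then Sum.inl v.tail else Sum.inr v.tail with hF
  have hhalt : ∀ v w, Sum.inl w ∈ F v → ∀ D, Dead D →
      ∃ n D', Dead D' ∧ DetN n (res (par (par L (out 0 (lst v) (out 0 L nil))) D))
        (par (inst κ (lst w)) D') := by
    intro v w hw D hD
    obtain ⟨u, hu, hw⟩ := (Part.mem_map_iff _).1 hw
    split_ifs at hw with h0
    cases hw
    obtain ⟨n, D', hD', h1⟩ := (((hf _ v).1 u hu).trans (loopCont_halt κ' _ h0)).res_par hD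
    refine ⟨_, _, hD'.res, ((hbody v D hD).trans h1).cong_right ?_⟩
    -- The outer continuation does not use the private name of the loop, so on halting it leaves the
    -- scope.
    rw [show inst κ' (lst u.tail) = shift 1 (inst κ (lst u.tail)) by
      rw [shift_inst, show shift 1 (lst u.tail : HTerm 0) = lst u.tail from rename_lst _ _]]
    exact .res_par' _ _
  have hcont : ∀ v w, Sum.inr w ∈ F v → ∀ D, Dead D →
      ∃ n D', Dead D' ∧ DetN (n + 1) (res (par (par L (out 0 (lst v) (out 0 L nil))) D))
        (res (par (par L (out 0 (lst w) (out 0 L nil))) D')) := by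
    intro v w hw D hD
    obtain ⟨u, hu, hw⟩ := (Part.mem_map_iff _).1 hw
    split_ifs at hw with h0
    cases hw
    obtain ⟨n, D', hD', h1⟩ := (((hf _ v).1 u hu).trans (loopCont_continue κ' _ L h0)).res_par hD
    -- One of the two communications that open a round provides the `+ 1`.
    refine ⟨1 + n, D', hD', ?_⟩
    have := (hbody v D hD).trans h1
    rwa [show 2 + n = 1 + n + 1 by omega] at this
  constructor
  · intro w hw
    suffices ∀ D, Dead D → ∃ n D', Dead D' ∧
        DetN n (res (par (par L (out 0 (lst v) (out 0 L nil))) D)) (par (inst κ (lst w)) D') by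
      obtain ⟨n, D, hD, h⟩ := this nil dead_nil
      exact ⟨n, D, hD, h.cong_left (hstart' v)⟩
    refine PFun.fixInduction' (C := fun v => ∀ D, Dead D → ∃ n D', Dead D' ∧
        DetN n (res (par (par L (out 0 (lst v) (out 0 L nil))) D)) (par (inst κ (lst w)) D')) hw
      (fun v hv => hhalt v w hv) ?_
    intro v v' _ hv ih D hD
    obtain ⟨n, D', hD', h1⟩ := hcont v v' hv D hD
    obtain ⟨m, D'', hD'', h2⟩ := ih D' hD'
    exact ⟨_, D'', hD'', h1.trans h2⟩
  · intro hv
    -- The list and the garbage both change from round to round and are generalized.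
    suffices ∀ n v D, ¬ (PFun.fix F v).Dom → Dead D →
        ∃ E, DetN n (res (par (par L (out 0 (lst v) (out 0 L nil))) D)) E by
      exact Inf.of_cong (fun n => this n v nil hv dead_nil) (hstart' v)
    intro n
    induction n with
    | zero => exact fun v D _ _ => ⟨_, Cong.refl _⟩
    | succ n ih =>
      intro v D hv hD
      by_cases hfv : (f.eval v).Dom
      · have hmem : (f.eval v).get hfv ∈ f.eval v := Part.get_mem hfv
        by_cases h0 : ((f.eval v).get hfv).headI = 0
        · have : Sum.inl ((f.eval v).get hfv).tail ∈ F v :=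
            (Part.mem_map_iff _).2 ⟨_, hmem, if_pos h0⟩
          exact absurd (Part.dom_iff_mem.2 ⟨_, PFun.fix_stop this⟩) hv
        · have h1 : Sum.inr ((f.eval v).get hfv).tail ∈ F v :=
            (Part.mem_map_iff _).2 ⟨_, hmem, if_neg h0⟩
          rw [PFun.fix_fwd_eq h1] at hv
          obtain ⟨m, D', hD', h2⟩ := hcont v _ h1 D hD
          obtain ⟨E, hE⟩ := ih _ D' hv hD'
          exact (h2.trans hE).of_le (by omega)
      · have h1 := ((hf (subst (up (pairSubst (lst v) L)) (loopCont κ')) v).2 hfv).par hD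
        exact (h1.res.of_detN (hbody v D hD)) (n + 1)

/-- The specification quantifies over all continuations, so the induction hypothesis for a
subprogram applies to the continuation that contains the rest of the computation. -/
theorem runSpec (c : Code) : RunSpec c := by
  induction c with
  | zero' =>
    intro κ v
    rw [Code.zero'_eval]
    refine ⟨fun w hw => ?_, fun h => absurd trivial h⟩
    obtain rfl := Part.mem_some_iff.1 hw
    refine .of_cong ?_
    rw [run, ← subst_closed Fin.elim0 (instAt _ _ _), subst_instAt_closed, subst_closed]
    exact .refl _
  | succ =>
    intro κ v
    rw [Code.succ_eval]
    refine ⟨fun w hw => ?_, fun h => absurd trivial h⟩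
    obtain rfl := Part.mem_some_iff.1 hw
    rw [run]
    cases v with
    | nil =>
      refine (mtch_leaf _ _).trans (.of_cong ?_)
      rw [← subst_closed Fin.elim0 (instAt _ _ _), subst_instAt_closed, subst_closed]
      exact .refl _
    | cons a v =>
      refine (mtch_node _ _ _ _).trans (.of_cong ?_)
      rw [subst_instAt_closed]
      simp only [subst_node, subst_leaf]
      exact .refl _
  | tail =>
    intro κ v
    rw [Code.tail_eval]
    refine ⟨fun w hw => ?_, fun h => absurd trivial h⟩
    obtain rfl := Part.mem_some_iff.1 hw
    rw [run]
    cases v with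
    | nil =>
      refine (mtch_leaf _ _).trans (.of_cong ?_)
      rw [← subst_closed Fin.elim0 (instAt _ _ _), subst_instAt_closed, subst_closed]
      exact .refl _
    | cons a v =>
      refine (mtch_node _ _ _ _).trans (.of_cong ?_)
      rw [subst_instAt_closed]
      exact .refl _
  | cons f fs ihf ihfs =>
    intro κ v
    rw [Code.cons_eval, run]
    -- `K` is the continuation of `fs` in which the head of the result `w` of `f` is already stored.
    -- For empty `w` the default head `0` is the leaf.
    have key : ∀ w : List ℕ, ∃ K : HTerm 1,
        (∀ u, inst K (lst u) = inst κ (lst (w.headI :: u))) ∧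
        Evolves (inst (mtch (var 0)
          (run fs (instAt κ (node leaf (var 0)) fun i => i.succ.succ)
            (renameVar Fin.succ (lst v)))
          (run fs (instAt κ (node (var (Fin.succ 0).succ) (var 0)) fun i => i.succ.succ.succ.succ)
            (renameVar (fun i => i.succ.succ.succ) (lst v)))) (lst w)) (run fs K (lst v)) := by
      intro w
      rw [inst, subst_mtch]
      cases w with
      | nil =>
        refine ⟨subst (up fun _ => lst []) (instAt κ (node leaf (var 0)) fun i => i.succ.succ),
          fun u => ?_, (mtch_leaf _ _).trans (.of_cong ?_)⟩
        · rw [inst_subst_up, subst_instAt_closed, subst_node]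
          rfl
        · rw [subst_run, subst_renameVar, subst_closed]
          exact .refl _
      | cons a w =>
        refine ⟨subst (up (consSubst (lst w) (consSubst (num a) fun _ => lst (a :: w))))
          (instAt κ (node (var (Fin.succ 0).succ) (var 0)) fun i => i.succ.succ.succ.succ),
          fun u => ?_, (mtch_node _ _ _ _).trans (.of_cong ?_)⟩
        · rw [inst_subst_up, subst_instAt_closed, subst_node]
          rfl
        · rw [subst_pairSubst_up, subst_run, subst_renameVar, subst_closed]
          exact .refl _
    constructor
    · intro w hw
      simp only [Part.bind_eq_bind, Part.mem_bind_iff, Part.pure_eq_some, Part.mem_some_iff] at hw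
      obtain ⟨n, hn, ns, hns, rfl⟩ := hw
      obtain ⟨K, hK, hE⟩ := key n
      refine ((ihf _ v).1 n hn).trans (hE.trans ?_)
      rw [← hK]
      exact (ihfs K v).1 ns hns
    · intro hv
      by_cases hf : (f.eval v).Dom
      · obtain ⟨K, -, hE⟩ := key ((f.eval v).get hf)
        refine (((ihf _ v).1 _ (Part.get_mem hf)).trans hE).inf ((ihfs K v).2 fun hfs => hv ?_)
        exact ⟨hf, hfs, trivial⟩
      · exact (ihf _ v).2 hf
  | comp f g ihf ihg =>
    intro κ v
    rw [Code.comp_eval, run]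
    have key : ∀ w, inst (run f (instAt κ (var 0) fun i => i.succ.succ) (var 0)) (lst w) =
        run f κ (lst w) := by
      intro w
      rw [inst, subst_run, subst_up_instAt_var]
      rfl
    constructor
    · intro w hw
      obtain ⟨u, hu, hw⟩ := Part.mem_bind_iff.1 hw
      refine ((ihg _ v).1 u hu).trans ?_
      rw [key]
      exact (ihf κ u).1 w hw
    · intro hv
      by_cases hg : (g.eval v).Dom
      · refine ((ihg _ v).1 _ (Part.get_mem hg)).inf ?_
        rw [key]
        refine (ihf κ _).2 fun hf => hv ?_
        exact ⟨hg, hf⟩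
      · exact (ihg _ v).2 hg
  | case f g ihf ihg =>
    intro κ v
    rw [Code.case_eval, run]
    match v with
    | [] =>
      have h := mtch_leaf (run f κ (lst []))
        (mtch (var (Fin.succ 0)) (run f (instAt κ (var 0) fun i => i.succ.succ.succ) (var 0))
          (run g (instAt κ (var 0) fun i => i.succ.succ.succ.succ.succ)
            (node (var 0) (var (Fin.succ 0).succ))))
      exact ⟨fun w hw => h.trans ((ihf κ []).1 w hw), fun hv => h.inf ((ihf κ []).2 hv)⟩
    | 0 :: v =>
      have h := mtch_node leaf (lst v) (run f κ leaf)
        (mtch (var (Fin.succ 0)) (run f (instAt κ (var 0) fun i => i.succ.succ.succ) (var 0))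
          (run g (instAt κ (var 0) fun i => i.succ.succ.succ.succ.succ)
            (node (var 0) (var (Fin.succ 0).succ))))
      rw [subst_mtch, subst_run, subst_up_instAt_var] at h
      replace h := h.trans (mtch_leaf _ _)
      exact ⟨fun w hw => h.trans ((ihf κ v).1 w hw), fun hv => h.inf ((ihf κ v).2 hv)⟩
    | (y + 1) :: v =>
      have h := mtch_node (num (y + 1)) (lst v) (run f κ leaf)
        (mtch (var (Fin.succ 0)) (run f (instAt κ (var 0) fun i => i.succ.succ.succ) (var 0))
          (run g (instAt κ (var 0) fun i => i.succ.succ.succ.succ.succ)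
            (node (var 0) (var (Fin.succ 0).succ))))
      rw [subst_mtch] at h
      replace h := h.trans (mtch_node _ _ _ _)
      rw [subst_pairSubst_up, subst_run, subst_up_instAt_var] at h
      exact ⟨fun w hw => h.trans ((ihg κ (y :: v)).1 w hw),
        fun hv => h.inf ((ihg κ (y :: v)).2 hv)⟩
  | fix f ih => exact ih.fix

end HTerm

/-! ## The encoding -/

theorem CompFun.exists_code (f : CompFun) :
    ∃ c : Code, ∀ m, c.eval [m] = (f.1 m).map fun n => [n] := by
  obtain ⟨c, hc⟩ := Code.exists_code (Nat.Partrec'.part_iff₁.2 (Partrec.nat_iff.2 f.2))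
  exact ⟨c, fun m => hc ⟨[m], rfl⟩⟩

/-- A program for a computable function. -/
noncomputable def CompFun.code (f : CompFun) : Code := f.exists_code.choose

theorem CompFun.eval_code (f : CompFun) (m : ℕ) :
    f.code.eval [m] = (f.1 m).map fun n => [n] := f.exists_code.choose_spec m

namespace HTerm

/-- Outputs the head of the list `0` on `b`. -/
def sendHead (b : ℕ) {n : ℕ} : HTerm (n + 1) :=
  mtch (var 0) nil (out b (var (Fin.succ 0)) nil)

/-- The process that receives a number `X`, runs `c` on it and outputs the result on `b`. The
application of `X` to `b` is inert if `X` is a number. -/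
def server (c : Code) (b : ℕ) : HTerm 1 :=
  par (app (r := 0) (var 0) fun _ => b)
    (mtch (var 0) (run c (sendHead b) (node leaf leaf))
      (run c (sendHead b) (node (node (var (Fin.succ 0)) (var 0)) leaf)))

/-- The process that never stops, by sending itself to itself. -/
def loop : HTerm 0 :=
  res (par (inp 0 (par (var 0) (out 0 (var 0) nil)))
    (out 0 (inp 0 (par (var 0) (out 0 (var 0) nil))) nil))

/-- An input for `server` that makes it reveal its output name. -/
def probe : HTerm 0 := abs 0 (out 0 (num 0) nil)

theorem rename_sendHead (ρ : ℕ → ℕ) (b n : ℕ) :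
    rename ρ (sendHead b : HTerm (n + 1)) = sendHead (ρ b) := rename_mtch _ _ _ _

theorem subst_sendHead {n m : ℕ} (θ : Fin n → HTerm m) (b : ℕ) :
    subst (up θ) (sendHead b) = sendHead b := subst_mtch _ _ _ _

theorem rename_server (ρ : ℕ → ℕ) (c : Code) (b : ℕ) :
    rename ρ (server c b) = server c (ρ b) := by
  simp only [server, rename, rename_mtch, rename_run, rename_sendHead, rename_node, rename_leaf]

theorem inst_sendHead (b n : ℕ) :
    Evolves (inst (sendHead b) (lst [n])) (out b (num n) nil) := by
  rw [inst, sendHead, subst_mtch]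
  exact (mtch_node _ _ _ _).trans (.of_cong (.refl _))

theorem inst_server (c : Code) (b : ℕ) (M : HTerm 0) : inst (server c b) M =
    par (app (r := 0) M fun _ => b) (mtch M (run c (sendHead b) (node leaf leaf))
      (run c (sendHead b) (node (node (var (Fin.succ 0)) (var 0)) leaf))) := by
  rw [inst, server, subst, subst_mtch, subst_run, subst_run, subst_sendHead, subst_sendHead]
  rfl

/-- Numbers abstract two names, so an application to one name does not contract and has no
commitments. -/
theorem dead_app_num (m b : ℕ) : Dead (app (r := 0) (num m) fun _ => b) := by
  have : nf (app (r := 0) (num m : HTerm 0) fun _ => b) = app (r := 0) (nf (num m)) fun _ => b := by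
    cases m <;> rfl
  refine ⟨⟨?_, ?_⟩, ?_⟩
  · rintro a G ⟨_, h, -⟩
    rw [this] at h
    cases h
  · rintro a κ ⟨_, _, _, h, -⟩
    rw [this] at h
    cases h
  · rintro E ⟨_, h, -⟩
    rw [this] at h
    cases h

theorem Evolves.dead_par {D E F : HTerm 0} (h : Evolves E F) (hD : Dead D) :
    Evolves (HTerm.par D E) F := by
  obtain ⟨n, D', hD', h1⟩ := h
  exact ⟨n, _, hD'.par hD, ((h1.par hD).cong_left (.par_comm _ _)).cong_right (.par_assoc _ _ _)⟩

/-- On the input of a number, the server runs its program. -/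
theorem server_num (c : Code) (b m : ℕ) :
    Evolves (inst (server c b) (num m)) (run c (sendHead b) (lst [m])) := by
  rw [inst_server]
  refine .dead_par ?_ (dead_app_num m b)
  cases m with
  | zero => exact mtch_leaf _ _
  | succ m =>
    refine (mtch_node _ _ _ _).trans (.of_cong ?_)
    rw [subst_run, subst_sendHead, subst_node, subst_node]
    exact .refl _

theorem server_defined {f : CompFun} {m n : ℕ} (h : n ∈ f.1 m) (b : ℕ) :
    Evolves (inst (server f.code b) (num m)) (out b (num n) nil) := by
  refine (server_num _ _ _).trans (((runSpec f.code _ [m]).1 [n] ?_).trans (inst_sendHead b n))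
  rw [f.eval_code]
  exact Part.mem_map _ h

theorem server_undefined {f : CompFun} {m : ℕ} (h : ¬ (f.1 m).Dom) (b : ℕ) :
    Inf (inst (server f.code b) (num m)) := by
  refine (server_num _ _ _).inf ((runSpec f.code _ [m]).2 ?_)
  rw [f.eval_code]
  exact h

/-- The unary application contracts to the output. The case distinction applies the probe to two
names and is stuck before the program starts; without this guard a program that ignores its argument
could run on. -/
theorem server_probe (c : Code) (b : ℕ) :
    ∃ D, Dead D ∧ Cong (inst (server c b) probe) (par (out b (num 0) nil) D) := by
  rw [inst_server]
  refine ⟨_, ?_, .parL (.beta _ _) _⟩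
  rw [mtch]
  set A := inp 1 (renameVar (Fin.succ : Fin 0 → Fin 1)
    (shift 2 (run c (sendHead b) (node leaf leaf) : HTerm 0)))
  set B := shift 2 (run c (sendHead b) (node (node (var (Fin.succ 0)) (var 0)) leaf) : HTerm 2)
  have hp : nf (app (r := 1) (shift 2 probe) fun i => i.val) =
      app (r := 1) (nf (shift 2 probe)) fun i => i.val := rfl
  have hA : Dead (app (r := 1) (shift 2 probe) fun i => i.val) := by
    refine ⟨⟨?_, ?_⟩, ?_⟩
    · rintro a G ⟨_, h, -⟩
      rw [hp] at h
      cases h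
    · rintro a κ ⟨_, _, _, h, -⟩
      rw [hp] at h
      cases h
    · rintro E ⟨_, h, -⟩
      rw [hp] at h
      cases h
  -- The excluded name `2` is a dummy: all inputs here are on names below `2`.
  have hAB : Awaits 2 2 (par A (inp 0 (inp 0 B))) := by
    refine ⟨fun a G hG => ?_, fun a κ hκ => ?_, fun E hE => ?_⟩
    · rcases cIn_par.1 hG with ⟨_, h, -⟩ | ⟨_, h, -⟩ <;> obtain ⟨rfl, -⟩ := cIn_inp.1 h <;> omega
    · rcases cOut_par.1 hκ with ⟨_, h, -⟩ | ⟨_, h, -⟩ <;> exact not_cOut_inp h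
    · rcases cTau_par.1 hE with ⟨_, h, -⟩ | ⟨_, h, -⟩ | ⟨_, _, _, -, h, -⟩ | ⟨_, _, _, h, -, -⟩
      · exact not_cTau_inp h
      · exact not_cTau_inp h
      · exact not_cOut_inp h
      · exact not_cOut_inp h
  refine Awaits.dead (k := 2) (c := 2) ⟨fun a G hG => ?_, fun a κ hκ => ?_, fun E hE => ?_⟩
  · rcases cIn_par.1 hG with ⟨_, h, -⟩ | ⟨_, h, -⟩
    exacts [absurd h (hA.1.1 _ _), hAB.1 _ _ h]
  · rcases cOut_par.1 hκ with ⟨_, h, -⟩ | ⟨_, h, -⟩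
    exacts [hA.1.2 _ _ h, hAB.2.1 _ _ h]
  · rcases cTau_par.1 hE with ⟨_, h, -⟩ | ⟨_, h, -⟩ | ⟨_, _, _, h, -, -⟩ | ⟨_, _, _, h, -, -⟩
    exacts [hA.2 _ h, hAB.2.2 _ h, hA.1.1 _ _ h, hA.1.2 _ _ h]

/-- Its only step reproduces it: the received copy becomes the receiver and is sent once more. -/
theorem inf_loop : Inf loop := by
  have step : Det loop loop :=
    (det_com (k := 1) (c := 0) (by omega) (par (var 0) (out 0 (var 0) nil))
      (inp 0 (par (var 0) (out 0 (var 0) nil))) nil (dead_nil.awaits 1 0)).of_cong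
      (Cong.par_nil _).res ((Cong.par_nil _).trans (Cong.par_nil _)).res
  intro n
  refine ⟨loop, ?_⟩
  induction n with
  | zero => exact Cong.refl _
  | succ n ih => exact ⟨_, step, ih⟩

end HTerm

/-- The encoding of `ℂ`. -/
noncomputable def CProc.enc : CProc → HTerm 0
  | nil => .nil
  | omega => .loop
  | out a i => .out a (.num i) .nil
  | fn a b f => .inp a (.server f.code b)
  | par P Q => .par (enc P) (enc Q)

/-! ## Configurations

A configuration consists of the atoms that run in parallel, and of the information whether there
is a divergent component. -/

/-- The processes of `ℂ` with a visible action. -/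
inductive Atom : Type
  | out (a i : ℕ) : Atom
  | fn (a b : ℕ) (f : CompFun) : Atom

namespace Atom

noncomputable def term : Atom → HTerm 0
  | out a i => .out a (.num i) .nil
  | fn a b f => .inp a (.server f.code b)

/-- A bound on the number of visible actions that an atom can be made to perform. -/
def weight : Atom → ℕ
  | out _ _ => 1
  | fn _ _ _ => 2

theorem weight_pos (x : Atom) : 0 < x.weight := by cases x <;> simp [weight]

/-- The configuration `A`, `o` becomes `A'`, `o'` if the result of `f` at `m` is added, to be output
on `b`. -/
def Adds (f : CompFun) (m b : ℕ) (A : Multiset Atom) (o : Prop) (A' : Multiset Atom)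
    (o' : Prop) : Prop :=
  (∃ n ∈ f.1 m, A' = out b n ::ₘ A ∧ o' = o) ∨ (¬ (f.1 m).Dom ∧ A' = A ∧ o' = True)

/-- A communication in a configuration. -/
def Comm (A : Multiset Atom) (o : Prop) (A' : Multiset Atom) (o' : Prop) : Prop :=
  ∃ a m b f B, A = out a m ::ₘ fn a b f ::ₘ B ∧ Adds f m b B o A' o'

/-- The weight of a configuration. -/
def size (A : Multiset Atom) : ℕ := (A.map weight).sum

@[simp] theorem size_cons (x : Atom) (A : Multiset Atom) : size (x ::ₘ A) = x.weight + size A := by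
  simp [size]

theorem size_eq_zero {A : Multiset Atom} : size A = 0 ↔ A = 0 := by
  constructor
  · intro h
    induction A using Multiset.induction_on with
    | empty => rfl
    | cons x A =>
      rw [size_cons] at h
      have := x.weight_pos
      omega
  · rintro rfl; rfl

/-- The configuration `B`, `p` is `A`, `o` or lighter. -/
def Below (B : Multiset Atom) (p : Prop) (A : Multiset Atom) (o : Prop) : Prop :=
  B = A ∧ p = o ∨ size B < size A

theorem Below.size_le {A B : Multiset Atom} {o p : Prop} (h : Below B p A o) :
    size B ≤ size A := by
  rcases h with ⟨rfl, -⟩ | h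
  exacts [le_rfl, h.le]

/-- This is how equality of weights shows that no communication has taken place. -/
theorem Below.eq {A B : Multiset Atom} {o p : Prop} (h : Below B p A o) (h' : size A ≤ size B) :
    B = A ∧ p = o := by
  rcases h with h | h
  exacts [h, absurd h (by omega)]

theorem Below.trans {A B C : Multiset Atom} {o p q : Prop} (h : Below C q B p)
    (h' : Below B p A o) : Below C q A o := by
  rcases h with ⟨rfl, rfl⟩ | h
  · exact h'
  · exact .inr (h.trans_le h'.size_le)

theorem exists_adds (f : CompFun) (m b : ℕ) (A : Multiset Atom) (o : Prop) :
    ∃ A' o', Adds f m b A o A' o' := by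
  by_cases h : (f.1 m).Dom
  · exact ⟨_, _, .inl ⟨_, Part.get_mem h, rfl, rfl⟩⟩
  · exact ⟨_, _, .inr ⟨h, rfl, rfl⟩⟩

theorem Adds.cons {f : CompFun} {m b : ℕ} {A A' : Multiset Atom} {o o' : Prop}
    (h : Adds f m b A o A' o') (x : Atom) : Adds f m b (x ::ₘ A) o (x ::ₘ A') o' := by
  rcases h with ⟨n, hn, rfl, rfl⟩ | ⟨hn, rfl, rfl⟩
  · exact .inl ⟨n, hn, Multiset.cons_swap _ _ _, rfl⟩
  · exact .inr ⟨hn, rfl, rfl⟩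

theorem Adds.size_le {f : CompFun} {m b : ℕ} {A A' : Multiset Atom} {o o' : Prop}
    (h : Adds f m b A o A' o') : size A' ≤ size A + 1 := by
  rcases h with ⟨n, hn, rfl, rfl⟩ | ⟨hn, rfl, rfl⟩
  · simp [weight, add_comm]
  · omega

theorem Comm.cons {A A' : Multiset Atom} {o o' : Prop} (h : Comm A o A' o') (x : Atom) :
    Comm (x ::ₘ A) o (x ::ₘ A') o' := by
  obtain ⟨a, m, b, f, B, rfl, h⟩ := h
  refine ⟨a, m, b, f, x ::ₘ B, ?_, h.cons x⟩
  rw [Multiset.cons_swap x, Multiset.cons_swap x]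

/-- A communication consumes weight `1 + 2` and produces at most the weight `1` of a new output. -/
theorem Comm.size_lt {A A' : Multiset Atom} {o o' : Prop} (h : Comm A o A' o') :
    size A' < size A := by
  obtain ⟨a, m, b, f, B, rfl, h⟩ := h
  have := h.size_le
  simp only [size_cons, weight]
  omega

end Atom

namespace HTerm

open Atom

/-! ### Representation of configurations in `Π^d` -/

/-- `E` evolves to the atom `x` in `k` steps. -/
def Comp (x : Atom) (E : HTerm 0) (k : ℕ) : Prop := ∃ D, Dead D ∧ DetN k E (par x.term D)

/-- `E` represents a configuration, `l` steps of which are pending. -/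
inductive Rep : Multiset Atom → Prop → HTerm 0 → ℕ → Prop
  | silent {o : Prop} {S : HTerm 0} (h : Silent o S) : Rep 0 o S 0
  | cons {x : Atom} {A : Multiset Atom} {o : Prop} {K E : HTerm 0} {k l : ℕ} (hK : Comp x K k)
      (h : Rep A o E l) : Rep (x ::ₘ A) o (par K E) (k + l)
  | cong {A : Multiset Atom} {o : Prop} {E F : HTerm 0} {l : ℕ} (h : Rep A o E l)
      (hE : Cong E F) : Rep A o F l

theorem DetN.noVis {k : ℕ} {E F : HTerm 0} (h : DetN k E F) (hk : k ≠ 0) : NoVis E := by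
  cases k with
  | zero => exact absurd rfl hk
  | succ k =>
    obtain ⟨E', h1, -⟩ := h
    exact h1.1

theorem comp_term (x : Atom) : Comp x x.term 0 := ⟨nil, dead_nil, (Cong.par_nil _).symm⟩

theorem not_cTau_term (x : Atom) (E : HTerm 0) : ¬ CTau x.term E := by
  cases x
  exacts [not_cTau_out, not_cTau_inp]

theorem Comp.cTau {x : Atom} {K K' : HTerm 0} {k : ℕ} (h : Comp x K k) (h' : CTau K K') :
    ∃ k' < k, Comp x K' k' := by
  obtain ⟨D, hD, h⟩ := h
  cases k with
  | zero =>
    rcases hD.1.cTau_par (h'.of_cong h (.refl _)) with ⟨_, h1, -⟩ | ⟨_, h1, -⟩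
    exacts [absurd h1 (not_cTau_term _ _), absurd h1 (hD.2 _)]
  | succ k =>
    obtain ⟨E', h1, h2⟩ := h
    exact ⟨k, by omega, D, hD, h2.cong_left (h1.2.2 _ h').symm⟩

/-- A component with pending steps has no visible action, so it can only be the finished atom that
acts. -/
theorem Comp.cIn {x : Atom} {K : HTerm 0} {G : HTerm 1} {k a : ℕ} (h : Comp x K k)
    (h' : CIn K a G) : ∃ b f D, x = .fn a b f ∧ k = 0 ∧ Dead D ∧
      ∀ M, Cong (inst G M) (par (inst (server f.code b) M) D) := by
  obtain ⟨D, hD, h⟩ := h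
  by_cases hk : k = 0
  · subst hk
    rcases cIn_par.1 (h'.of_cong h (.refl _)) with ⟨G', h1, h2⟩ | ⟨G', h1, -⟩
    · cases x with
      | out b n => exact absurd h1 not_cIn_out
      | fn b c f =>
        obtain ⟨rfl, h3⟩ := cIn_inp.1 h1
        refine ⟨c, f, D, rfl, rfl, hD, fun M => ?_⟩
        have := (h2.trans (h3.parL _)).inst (.refl M)
        rwa [inst_par, inst_const] at this
    · exact absurd h1 (hD.1.1 _ _)
  · exact absurd h' ((h.noVis hk).1 _ _)

theorem Comp.cOut {x : Atom} {K : HTerm 0} {κ : HTerm 1 → HTerm 0} {k a : ℕ} (h : Comp x K k)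
    (h' : COut K a κ) : ∃ n D, x = .out a n ∧ k = 0 ∧ Dead D ∧
      ∀ G, Cong (κ G) (par (inst G (num n)) D) := by
  obtain ⟨D, hD, h⟩ := h
  by_cases hk : k = 0
  · subst hk
    rcases cOut_par.1 (h'.of_cong h fun _ => .refl _) with ⟨κ', h1, h2⟩ | ⟨G', h1, -⟩
    · cases x with
      | out b n =>
        obtain ⟨rfl, h3⟩ := cOut_out.1 h1
        exact ⟨n, D, rfl, rfl, hD, fun G => (h2 G).trans
          (((h3 G).trans (Cong.par_nil _)).parL _)⟩
      | fn b c f => exact absurd h1 not_cOut_inp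
    · exact absurd h1 (hD.1.2 _ _)
  · exact absurd h' ((h.noVis hk).2 _ _)

namespace Rep

variable {A : Multiset Atom} {o : Prop} {E F : HTerm 0} {l : ℕ}

theorem silent_par {p : Prop} {S : HTerm 0} (hS : Silent p S) (h : Rep A o E l) :
    Rep A (p ∨ o) (HTerm.par S E) l := by
  induction h with
  | silent h => exact .silent (hS.par h)
  | cons hK h ih => exact (Rep.cons hK ih).cong (.par_left_comm _ _ _)
  | cong h hE ih => exact ih.cong (hE.parR _)

theorem dead_par {D : HTerm 0} (hD : Dead D) (h : Rep A o E l) : Rep A o (HTerm.par D E) l := by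
  simpa using h.silent_par (p := False) (.inr ⟨id, hD⟩)

theorem par {B : Multiset Atom} {p : Prop} {m : ℕ} (h : Rep A o E l) (h' : Rep B p F m) :
    Rep (A + B) (o ∨ p) (HTerm.par E F) (l + m) := by
  induction h with
  | silent h => rw [zero_add, zero_add]; exact h'.silent_par h
  | cons hK h ih =>
    rw [Multiset.cons_add, add_assoc]
    exact (Rep.cons hK ih).cong (Cong.par_assoc _ _ _).symm
  | cong h hE ih => exact ih.cong (hE.parL _)

theorem split {B : Multiset Atom} {x : Atom} (h : Rep A o E l) (hA : A = x ::ₘ B) :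
    ∃ K k E' l', l = k + l' ∧ Comp x K k ∧ Rep B o E' l' ∧ Cong E (HTerm.par K E') := by
  induction h generalizing B with
  | silent h => exact absurd hA.symm (Multiset.cons_ne_zero)
  | @cons y A o K E k l hK h ih =>
    rcases Multiset.cons_eq_cons.1 hA with ⟨rfl, rfl⟩ | ⟨-, C, h1, h2⟩
    · exact ⟨K, k, E, l, rfl, hK, h, .refl _⟩
    · obtain ⟨K', k', E', l', rfl, h3, h4, h5⟩ := ih h1
      subst h2
      exact ⟨K', k', HTerm.par K E', k + l', by omega, h3, .cons hK h4,
        (h5.parR _).trans (.par_left_comm _ _ _)⟩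
  | cong h hE ih =>
    obtain ⟨K', k', E', l', h2, h3, h4, h5⟩ := ih hA
    exact ⟨K', k', E', l', h2, h3, h4, hE.symm.trans h5⟩

/-- The server adds its result. -/
theorem adds {f : CompFun} {m b : ℕ} {A' : Multiset Atom} {o' : Prop} (h : Rep A o E l)
    (h' : Adds f m b A o A' o') :
    ∃ l', Rep A' o' (HTerm.par (inst (server f.code b) (num m)) E) l' := by
  rcases h' with ⟨n, hn, rfl, rfl⟩ | ⟨hn, rfl, rfl⟩
  · obtain ⟨k, D, hD, h1⟩ := server_defined hn b
    exact ⟨_, .cons ⟨D, hD, h1⟩ h⟩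
  · refine ⟨l, ?_⟩
    simpa using h.silent_par (p := True) (.inl ⟨trivial, (server_undefined hn b).spins⟩)

theorem probe {f : CompFun} {b : ℕ} (h : Rep A o E l) :
    Rep (.out b 0 ::ₘ A) o (HTerm.par (inst (server f.code b) HTerm.probe) E) l := by
  obtain ⟨D, hD, h1⟩ := server_probe f.code b
  rw [← zero_add l]
  exact .cons ⟨D, hD, h1⟩ h

theorem cIn {G : HTerm 1} {a : ℕ} (h : Rep A o E l) (h' : CIn E a G) :
    ∃ b f B E' l', A = .fn a b f ::ₘ B ∧ Rep B o E' l' ∧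
      ∀ M, Cong (inst G M) (HTerm.par (inst (server f.code b) M) E') := by
  induction h generalizing G with
  | silent h => exact absurd h' (h.noVis.1 _ _)
  | @cons y A o K E k l hK h ih =>
    rcases cIn_par.1 h' with ⟨G', h1, h2⟩ | ⟨G', h1, h2⟩
    · obtain ⟨b, f, D, rfl, -, hD, h3⟩ := hK.cIn h1
      refine ⟨b, f, A, HTerm.par D E, l, rfl, h.dead_par hD, fun M => ?_⟩
      refine (h2.inst (.refl M)).trans ?_
      rw [inst_par, inst_const]
      exact ((h3 M).parL _).trans (.par_assoc _ _ _)
    · obtain ⟨b, f, B, E', l', rfl, h3, h4⟩ := ih h1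
      refine ⟨b, f, y ::ₘ B, HTerm.par K E', _, Multiset.cons_swap _ _ _, .cons hK h3,
        fun M => ?_⟩
      refine (h2.inst (.refl M)).trans ?_
      rw [inst_par, inst_const]
      exact ((h4 M).parR _).trans (.par_left_comm _ _ _)
  | cong h hE ih => exact ih (h'.of_cong hE.symm (.refl _))

theorem cOut {κ : HTerm 1 → HTerm 0} {a : ℕ} (h : Rep A o E l) (h' : COut E a κ) :
    ∃ n B E' l', A = .out a n ::ₘ B ∧ Rep B o E' l' ∧
      ∀ G, Cong (κ G) (HTerm.par (inst G (num n)) E') := by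
  induction h generalizing κ with
  | silent h => exact absurd h' (h.noVis.2 _ _)
  | @cons y A o K E k l hK h ih =>
    rcases cOut_par.1 h' with ⟨G', h1, h2⟩ | ⟨G', h1, h2⟩
    · obtain ⟨n, D, rfl, -, hD, h3⟩ := hK.cOut h1
      exact ⟨n, A, HTerm.par D E, l, rfl, h.dead_par hD, fun G => (h2 G).trans
        (((h3 G).parL _).trans (.par_assoc _ _ _))⟩
    · obtain ⟨n, B, E', l', rfl, h3, h4⟩ := ih h1
      exact ⟨n, y ::ₘ B, HTerm.par K E', _, Multiset.cons_swap _ _ _, .cons hK h3,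
        fun G => (h2 G).trans (((h4 G).parR _).trans (.par_left_comm _ _ _))⟩
  | cong h hE ih => exact ih (h'.of_cong hE.symm fun _ => .refl _)

/-- Components act visibly only when finished, and numbers are the only messages they send; hence
internal communications between components are those of `ℂ`. Everything else leaves the
configuration unchanged and uses up a pending step, unless the divergent part moves. -/
theorem cTau {E' : HTerm 0} (h : Rep A o E l) (h' : CTau E E') :
    (∃ l', Rep A o E' l' ∧ (l' < l ∨ o)) ∨ ∃ A' o' l', Comm A o A' o' ∧ Rep A' o' E' l' := by
  induction h generalizing E' with
  | silent h =>
    refine .inl ⟨0, .silent (h.cTau h'), ?_⟩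
    rcases h with ⟨ho, -⟩ | ⟨-, h⟩
    exacts [.inr ho, absurd h' (h.2 _)]
  | @cons x A o K E k l hK h ih =>
    rcases cTau_par.1 h' with ⟨K', h1, h2⟩ | ⟨E₁, h1, h2⟩ | ⟨a, G, κ, h1, h2, h3⟩ |
      ⟨a, G, κ, h1, h2, h3⟩
    · obtain ⟨k', hk, h3⟩ := hK.cTau h1
      exact .inl ⟨_, (Rep.cons h3 h).cong h2.symm, .inl (by omega)⟩
    · rcases ih h1 with ⟨l', h3, h4⟩ | ⟨A', o', l', h3, h4⟩
      · exact .inl ⟨_, (Rep.cons hK h3).cong h2.symm, h4.imp_left (by omega)⟩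
      · exact .inr ⟨_, o', _, h3.cons x, (Rep.cons hK h4).cong h2.symm⟩
    · obtain ⟨b, f, D, rfl, -, hD, h4⟩ := hK.cIn h1
      obtain ⟨n, B, E₁, l', rfl, h5, h6⟩ := h.cOut h2
      obtain ⟨A', o', h7⟩ := exists_adds f n b B o
      obtain ⟨l'', h8⟩ := (h5.dead_par hD).adds h7
      refine .inr ⟨A', o', l'', ⟨a, n, b, f, B, Multiset.cons_swap _ _ _, h7⟩, h8.cong ?_⟩
      exact (h3.trans ((h6 G).trans (((h4 _).parL _).trans (.par_assoc _ _ _)))).symm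
    · obtain ⟨n, D, rfl, -, hD, h4⟩ := hK.cOut h1
      obtain ⟨b, f, B, E₁, l', rfl, h5, h6⟩ := h.cIn h2
      obtain ⟨A', o', h7⟩ := exists_adds f n b B o
      obtain ⟨l'', h8⟩ := (h5.dead_par hD).adds h7
      refine .inr ⟨A', o', l'', ⟨a, n, b, f, B, rfl, h7⟩, h8.cong ?_⟩
      refine (h3.trans ((h4 G).trans (((h6 _).parL _).trans ((Cong.par_assoc _ _ _).trans ?_)))).symm
      exact .parR _ (.par_comm _ _)
  | cong h hE ih => exact ih (h'.of_cong hE.symm (.refl _))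

theorem taus {E' : HTerm 0} (h : Rep A o E l) (h' : Taus E E') :
    ∃ A' o' l', Rep A' o' E' l' ∧ Below A' o' A o := by
  induction h' with
  | refl => exact ⟨A, o, l, h, .inl ⟨rfl, rfl⟩⟩
  | tail _ h1 ih =>
    obtain ⟨A', o', l', h2, h3⟩ := ih
    rcases h2.cTau (step_tau_iff.1 h1) with ⟨l'', h4, -⟩ | ⟨A'', o'', l'', h4, h5⟩
    · exact ⟨A', o', l'', h4, h3⟩
    · exact ⟨A'', o'', l'', h5, Below.trans (.inr h4.size_lt) h3⟩

theorem tausC {E' : HTerm 0} (h : Rep A o E l) (h' : TausC E E') :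
    ∃ A' o' l', Rep A' o' E' l' ∧ Below A' o' A o := by
  obtain ⟨F, h1, h2⟩ := h'
  obtain ⟨A', o', l', h3, h4⟩ := h.taus h1
  exact ⟨A', o', l', h3.cong h2, h4⟩

/-- The pending steps can be made. -/
theorem settle (h : Rep A o E l) : ∃ E', TausC E E' ∧ Rep A o E' 0 := by
  induction h with
  | silent h => exact ⟨_, .refl _, .silent h⟩
  | cons hK h ih =>
    obtain ⟨E', h1, h2⟩ := ih
    obtain ⟨D, hD, h3⟩ := hK
    exact ⟨_, (h3.tausC.parL _).trans (h1.parR _), .cons (k := 0) ⟨D, hD, Cong.refl _⟩ h2⟩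
  | cong h hE ih =>
    obtain ⟨E', h1, h2⟩ := ih
    exact ⟨E', (TausC.of_cong hE.symm).trans h1, h2⟩

/-- With nothing pending each component is its atom beside garbage. The atoms form the common part,
and the garbage is added to the silent part, whose divergence it does not affect. -/
theorem exists_silent (h : Rep A o E 0) (h' : Rep A o F 0) :
    ∃ C S T, Silent o S ∧ Silent o T ∧ Cong E (HTerm.par C S) ∧ Cong F (HTerm.par C T) := by
  have base : ∀ {A : Multiset Atom} {o F} {m : ℕ}, Rep A o F m → A = 0 → Silent o F := by
    intro A o F m h
    induction h with
    | silent h => exact fun _ => h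
    | cons => exact fun h => absurd h Multiset.cons_ne_zero
    | cong h hE ih =>
      intro hA
      rcases ih hA with ⟨h1, h2⟩ | ⟨h1, h2⟩
      exacts [.inl ⟨h1, h2.of_cong hE⟩, .inr ⟨h1, h2.of_cong hE⟩]
  -- The index must be a variable for the induction on the representation.
  obtain ⟨l, hl, hE⟩ : ∃ l, 0 = l ∧ Rep A o E l := ⟨0, rfl, h⟩
  clear h
  induction hE generalizing F with
  | @silent o S h =>
    exact ⟨nil, S, F, h, base h' rfl, (Cong.nil_par _).symm, (Cong.nil_par _).symm⟩
  | @cons x A o K E k l hK h ih =>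
    obtain ⟨K', k', F', l', h1, h2, h3, h4⟩ := h'.split rfl
    obtain ⟨rfl, rfl⟩ : k = 0 ∧ l = 0 := by omega
    obtain ⟨rfl, rfl⟩ : k' = 0 ∧ l' = 0 := by omega
    obtain ⟨C, S, T, hS, hT, h5, h6⟩ := ih h3 rfl
    have key : ∀ {K E S : HTerm 0}, Comp x K 0 → Silent o S → Cong E (HTerm.par C S) →
        ∃ S', Silent o S' ∧ Cong (HTerm.par K E) (HTerm.par (HTerm.par x.term C) S') := by
      rintro K E S ⟨D, hD, hK⟩ hS hE
      refine ⟨HTerm.par D S, ?_, (Cong.par hK hE).trans (.par_par_par_comm _ _ _ _)⟩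
      simpa using Silent.par (b := False) (.inr ⟨id, hD⟩) hS
    obtain ⟨S', h7, h8⟩ := key hK hS h5
    obtain ⟨T', h9, h10⟩ := key h2 hT h6
    exact ⟨_, S', T', h7, h9, h8, h4.trans h10⟩
  | cong h hE ih =>
    obtain ⟨C, S, T, hS, hT, h5, h6⟩ := ih h' hl
    exact ⟨C, S, T, hS, hT, hE.symm.trans h5, h6⟩

theorem bisimilar (h : Rep A o E 0) (h' : Rep A o F 0) : Bisimilar E F := by
  obtain ⟨C, S, T, hS, hT, h1, h2⟩ := h.exists_silent h'
  exact bisimilar_of_silent hS hT h1 h2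

theorem diverges (h : Rep A o E l) (ho : o) : Diverges Tau E := by
  induction h with
  | silent h =>
    rcases h with ⟨-, h⟩ | ⟨h, -⟩
    exacts [h.diverges, absurd ho h]
  | cons hK h ih => exact Diverges.parR _ (ih ho)
  | cong h hE ih => exact diverges_cong (ih ho) hE

/-- Without a divergent part every other step lowers the number of pending ones, so an infinite run
comes to a communication. -/
theorem comm_of_diverges (h : Rep A o E l) (hE : Diverges Tau E) (ho : ¬ o) :
    ∃ A' o' E' l', Comm A o A' o' ∧ Rep A' o' E' l' ∧ Diverges Tau E' := by
  induction l using Nat.strong_induction_on generalizing E with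
  | _ l ih =>
    obtain ⟨E', h1, h2⟩ := hE.exists_step
    rcases h.cTau (step_tau_iff.1 h1) with ⟨l', h3, h4 | h4⟩ | ⟨A', o', l', h3, h4⟩
    · exact ih l' h4 h3 h2
    · exact absurd h4 ho
    · exact ⟨A', o', E', l', h3, h4, h2⟩

/-! ### Transitions of represented configurations -/

theorem exists_inp {a b : ℕ} {f : CompFun} (h : Rep (.fn a b f ::ₘ A) o E l) :
    ∃ E' l', Rep A o E' l' ∧ ∃ E₁, Taus E E₁ ∧ ∀ M, Step E₁ (.inp a M)
      (HTerm.par (inst (server f.code b) M) E') := by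
  obtain ⟨K, k, E', l', -, ⟨D, hD, hK⟩, h1, h2⟩ := h.split rfl
  obtain ⟨E₁, h3, h4⟩ := (TausC.of_cong h2).trans (hK.tausC.parL _)
  refine ⟨HTerm.par D E', l', h1.dead_par hD, E₁, h3, fun M => ?_⟩
  refine Step.of_cong ?_ ((Cong.par_assoc _ _ _).symm.trans h4.symm) (.refl _)
  have := Step.parL (HTerm.par D E') (Step.inp a (server f.code b) M)
  simpa only [HAct.bound, shift_zero, Atom.term] using this

theorem exists_out {a n : ℕ} (h : Rep (.out a n ::ₘ A) o E l) :
    ∃ E' l', Rep A o E' l' ∧ ∃ E₁, Taus E E₁ ∧ Step E₁ (.out 0 a (num n)) E' := by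
  obtain ⟨K, k, E', l', -, ⟨D, hD, hK⟩, h1, h2⟩ := h.split rfl
  obtain ⟨E₁, h3, h4⟩ := (TausC.of_cong h2).trans (hK.tausC.parL _)
  refine ⟨HTerm.par D E', l', h1.dead_par hD, E₁, h3, ?_⟩
  refine Step.of_cong ?_ ((Cong.par_assoc _ _ _).symm.trans h4.symm) (.nil_par _)
  have := Step.parL (HTerm.par D E') (Step.out a (num n) nil)
  simpa only [HAct.bound, shift_zero, Atom.term] using this

theorem exists_comm {A' : Multiset Atom} {o' : Prop} (h : Rep A o E l) (h' : Comm A o A' o') :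
    ∃ E' l', Rep A' o' E' l' ∧ Weak E .tau E' := by
  obtain ⟨a, m, b, f, B, rfl, h'⟩ := h'
  obtain ⟨K, k, E₁, l₁, -, ⟨D, hD, hK⟩, h1, h2⟩ := h.split rfl
  obtain ⟨K', k', E₂, l₂, -, ⟨D', hD', hK'⟩, h3, h4⟩ := h1.split rfl
  have h5 : TausC E (HTerm.par (HTerm.par (out a (num m) nil) D)
      (HTerm.par (HTerm.par (inp a (server f.code b)) D') E₂)) :=
    (TausC.of_cong (h2.trans (h4.parR _))).trans
      ((hK.tausC.parL _).trans ((hK'.tausC.parL _).parR _))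
  obtain ⟨E₃, h6, h7⟩ := h5
  obtain ⟨l', h8⟩ := ((h3.dead_par hD').dead_par hD).adds h'
  have h9 : CTau E₃ (HTerm.par (inst (server f.code b) (num m))
      (HTerm.par D (HTerm.par D' E₂))) := by
    have h10 : CTau (HTerm.par (out a (num m) nil) (inp a (server f.code b)))
        (inst (server f.code b) (num m)) :=
      cTau_par.2 (.inr (.inr (.inr ⟨a, _, fun G => inst G (num m),
        cOut_out.2 ⟨rfl, fun G => (Cong.par_nil _).symm⟩, cIn_inp.2 ⟨rfl, .refl _⟩, .refl _⟩)))
    refine CTau.of_cong (cTau_par.2 (.inl ⟨_, h10, .refl _⟩)) ?_ (.refl _)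
    exact h7.symm |> fun h => (((Cong.par_par_par_comm _ _ _ _).symm.trans
      (.parR _ (Cong.par_assoc _ _ _).symm)).trans h)
  exact ⟨_, l', h8, E₃, _, h6, h9.step, .refl⟩

theorem exists_omega (h : Rep A o E l) (ho : o) : ∃ E' l', Rep A o E' l' ∧ Step E .tau E' := by
  induction h with
  | silent h =>
    rcases id h with ⟨-, h1⟩ | ⟨h1, -⟩
    · obtain ⟨E', h2, -⟩ := h1.diverges.exists_step
      exact ⟨E', 0, .silent (h.cTau (step_tau_iff.1 h2)), h2⟩
    · exact absurd ho h1
  | cons hK h ih =>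
    obtain ⟨E', l', h1, h2⟩ := ih ho
    exact ⟨_, _, .cons hK h1, h2.tau_parR _⟩
  | cong h hE ih =>
    obtain ⟨E', l', h1, h2⟩ := ih ho
    exact ⟨E', l', h1, h2.of_cong hE (.refl _)⟩

end Rep

end HTerm

/-! ## Bisimilar configurations -/

/-- The function that is defined at `n` only. -/
def CompFun.only (n : ℕ) : CompFun :=
  ⟨fun m => cond (m == n) (Part.some 0) Part.none, Partrec.nat_iff.1 (Partrec.cond
    (Primrec.beq.comp Primrec.id (Primrec.const n)).to_comp (Computable.const 0) Partrec.none)⟩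

theorem CompFun.mem_only (n : ℕ) : 0 ∈ (only n).1 n := by
  simp [only]

theorem CompFun.not_dom_only {m n : ℕ} (h : m ≠ n) : ¬ ((only n).1 m).Dom := by
  simp [only, beq_eq_false_iff_ne.2 h]

namespace HTerm

open Atom

namespace Rep

variable {A B : Multiset Atom} {o p : Prop} {E F : HTerm 0} {l m : ℕ}

/-- Steps before the input can only lower the configuration. Those after it are kept as `TausC`,
since `M` is arbitrary and the result need not represent a configuration. -/
theorem weak_inp {a : ℕ} {M F' : HTerm 0} (h : Rep B p F m) (h' : Weak F (.inp a M) F') :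
    ∃ b f C q F₁ m₁, Rep C q F₁ m₁ ∧ Below (.fn a b f ::ₘ C) q B p ∧
      TausC (HTerm.par (inst (server f.code b) M) F₁) F' := by
  obtain ⟨F₁, F₂, h1, h2, h3⟩ := h'
  obtain ⟨B₁, p₁, l₁, h4, h5⟩ := h.taus h1
  obtain ⟨G, h6, h7⟩ := step_inp_iff.1 h2
  obtain ⟨b, f, C, F₃, l₂, rfl, h8, h9⟩ := h4.cIn h6
  exact ⟨b, f, C, p₁, F₃, l₂, h8, h5, h3.cong_left ((h9 M).symm.trans h7.symm)⟩

theorem weak_out {a k : ℕ} {N F' : HTerm 0} (h : Rep B p F m) (h' : Weak F (.out k a N) F') :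
    ∃ n C q F₁ m₁, Rep C q F₁ m₁ ∧ Below (.out a n ::ₘ C) q B p ∧
      ∀ G, TausC (HTerm.par (inst G (num n)) F₁) (plug G k N F') := by
  obtain ⟨F₁, F₂, h1, h2, h3⟩ := h'
  obtain ⟨B₁, p₁, l₁, h4, h5⟩ := h.taus h1
  obtain ⟨n, C, F₃, l₂, rfl, h8, h9⟩ := h4.cOut h2.cOut
  exact ⟨n, C, p₁, F₃, l₂, h8, h5, fun G => (h3.plug G k N).cong_left (h9 G).symm⟩

/-- The pending steps of the challenger are matched first; by transitivity of `Below` they cost the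
partner nothing that is not accounted for. -/
theorem match_inp {a b : ℕ} {f : CompFun} (h : Rep (.fn a b f ::ₘ A) o E l) (h' : Rep B p F m)
    (hEF : Bisimilar E F) (M : HTerm 0) :
    ∃ E₁ l₁ b' f' C q F₁ m₁ F', Rep A o E₁ l₁ ∧ Rep C q F₁ m₁ ∧ Below (.fn a b' f' ::ₘ C) q B p ∧
      TausC (HTerm.par (inst (server f'.code b') M) F₁) F' ∧
      Bisimilar (HTerm.par (inst (server f.code b) M) E₁) F' := by
  obtain ⟨E₁, l₁, h1, E₂, h2, h3⟩ := h.exists_inp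
  obtain ⟨F₂, h4, h5⟩ := hEF.taus h2
  obtain ⟨F', h6, h7⟩ := h5.inp (h3 M)
  obtain ⟨B₁, p₁, m₁, h8, h9⟩ := h'.taus h4
  obtain ⟨b', f', C, q, F₁, m₂, h10, h11, h12⟩ := h8.weak_inp h6
  exact ⟨E₁, l₁, b', f', C, q, F₁, m₂, F', h1, h10, h11.trans h9, h12, h7⟩

theorem match_out {a n : ℕ} (h : Rep (.out a n ::ₘ A) o E l) (h' : Rep B p F m)
    (hEF : Bisimilar E F) :
    ∃ E₁ l₁ n' C q F₁ m₁, Rep A o E₁ l₁ ∧ Rep C q F₁ m₁ ∧ Below (.out a n' ::ₘ C) q B p ∧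
      ∀ G, ∃ F', TausC (HTerm.par (inst G (num n')) F₁) F' ∧
        Bisimilar (HTerm.par (inst G (num n)) E₁) F' := by
  obtain ⟨E₁, l₁, h1, E₂, h2, h3⟩ := h.exists_out
  obtain ⟨F₂, h4, h5⟩ := hEF.taus h2
  obtain ⟨k, N, F', h6, h7⟩ := h5.out h3
  obtain ⟨B₁, p₁, m₁, h8, h9⟩ := h'.taus h4
  obtain ⟨n', C, q, F₁, m₂, h10, h11, h12⟩ := h8.weak_out h6
  refine ⟨E₁, l₁, n', C, q, F₁, m₂, h1, h10, h11.trans h9, fun G => ⟨_, h12 G, ?_⟩⟩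
  rw [← plug_zero]
  exact h7 G

/-- Every atom can be forced to spend its weight: an output is discarded by a receiver, a function
is turned into an output by `probe`. The partner must spend at least as much in reply. -/
theorem size_le (h : Rep A o E l) (h' : Rep B p F m) (hEF : Bisimilar E F) :
    size A ≤ size B := by
  induction hs : size A using Nat.strong_induction_on generalizing A o E l B p F m with
  | _ s ih =>
    induction A using Multiset.induction_on with
    | empty => rw [← hs]; exact Nat.zero_le _
    | cons x A =>
      rw [size_cons] at hs
      cases x with
      | out a n =>
        obtain ⟨E₁, l₁, n', C, q, F₁, m₁, h1, h2, h3, h4⟩ := h.match_out h' hEF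
        obtain ⟨F', h5, h6⟩ := h4 nil
        obtain ⟨C', q', m', h7, h8⟩ := (h2.dead_par dead_nil).tausC h5
        have h9 := ih (size A) (by simp [weight] at hs; omega) (h1.dead_par dead_nil) h7 h6 rfl
        have h10 := h3.size_le
        have h11 := h8.size_le
        simp only [size_cons, weight] at hs h10
        omega
      | fn a b f =>
        obtain ⟨E₁, l₁, b', f', C, q, F₁, m₁, F', h1, h2, h3, h4, h5⟩ := h.match_inp h' hEF HTerm.probe
        obtain ⟨C', q', m', h7, h8⟩ := h2.probe.tausC h4
        have h9 := ih _ (by simp [weight] at hs ⊢; omega) h1.probe h7 h5 rfl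
        have h10 := h3.size_le
        have h11 := h8.size_le
        simp only [size_cons, weight] at hs h9 h10 h11
        omega

/-- On input `i` the challenger acquires an output. The weights force the partner's server to
acquire one as well and leave it no communication; as `A` contains no outputs, the two outputs must
be the same. -/
theorem mem_of_bisimilar {a b i n : ℕ} {f g : CompFun} (hA : ∀ b n, .out b n ∉ A)
    (h : Rep (.fn a b f ::ₘ A) o E l) (h' : Rep (.fn a b g ::ₘ A) p F m) (hEF : Bisimilar E F)
    (ih : ∀ {B C : Multiset Atom} {q r : Prop} {E F : HTerm 0} {l m : ℕ}, size B < size A + 2 →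
      Rep B q E l → Rep C r F m → Bisimilar E F → B = C) (hn : n ∈ f.1 i) : n ∈ g.1 i := by
  obtain ⟨E₁, l₁, b', g', C, q, F₁, m₁, F', h1, h2, h3, h4, h5⟩ := h.match_inp h' hEF (num i)
  obtain ⟨C', q', h6⟩ := exists_adds g' i b' C q
  obtain ⟨m₂, h7⟩ := h2.adds h6
  obtain ⟨B₃, p₃, m₃, h8, h9⟩ := h7.tausC h4
  obtain ⟨l₂, h10⟩ := h1.adds (.inl ⟨n, hn, rfl, rfl⟩)
  obtain rfl := ih (by simp [weight]; omega) h10 h8 h5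
  have h11 := h3.size_le
  have h12 := h9.size_le
  have h13 := h6.size_le
  simp only [size_cons, weight] at h11 h12
  obtain ⟨h14, -⟩ := h3.eq (by simp only [size_cons, weight]; omega)
  obtain ⟨h15, -⟩ := h9.eq (by simp only [size_cons, weight]; omega)
  rcases h6 with ⟨n', hn', rfl, -⟩ | ⟨-, rfl, -⟩
  · have h16 : Atom.out b' n' ∈ Atom.out b n ::ₘ A := h15 ▸ Multiset.mem_cons_self _ _
    rcases Multiset.mem_cons.1 h16 with h16 | h16
    · cases h16
      rw [Multiset.cons_inj_right] at h15
      subst h15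
      rw [Multiset.cons_inj_left] at h14
      cases h14
      exact hn'
    · exact absurd h16 (hA _ _)
  · omega

/-- By induction on the weight. Outputs are removed first; a function is probed only when no output
is present, so that the output it then produces can be identified. -/
theorem eq_of_bisimilar (h : Rep A o E l) (h' : Rep B p F m) (hEF : Bisimilar E F) :
    A = B ∧ (o ↔ p) := by
  induction hs : size A using Nat.strong_induction_on generalizing A o E l B p F m with
  | _ s ih =>
    subst hs
    have hsize : size A = size B := le_antisymm (h.size_le h' hEF) (h'.size_le h hEF.symm)
    by_cases hout : ∃ a n, Atom.out a n ∈ A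
    · obtain ⟨a, n, hA⟩ := hout
      obtain ⟨A, rfl⟩ := Multiset.exists_cons_of_mem hA
      obtain ⟨E₁, l₁, n', C, q, F₁, m₁, h1, h2, h3, h4⟩ := h.match_out h' hEF
      -- A receiver that discards the message leaves the smaller configurations to be compared.
      obtain ⟨F', h5, h6⟩ := h4 nil
      obtain ⟨C', q', m', h7, h8⟩ := (h2.dead_par dead_nil).tausC h5
      obtain ⟨rfl, h9⟩ := ih (size A) (by simp [weight]) (h1.dead_par dead_nil) h7 h6 rfl
      have h10 := h3.size_le
      have h11 := h8.size_le
      simp only [size_cons, weight] at hsize h10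
      obtain ⟨rfl, rfl⟩ := h3.eq (by simp only [size_cons, weight]; omega)
      obtain ⟨rfl, rfl⟩ := h8.eq (by omega)
      refine ⟨?_, h9⟩
      by_contra hn
      have hn : n' ≠ n := by rintro rfl; exact hn rfl
      -- This receiver gains an output on `n` but only diverges on `n'`, so the weights would
      -- differ.
      obtain ⟨F'', h12, h13⟩ := h4 (server (CompFun.only n).code 0)
      obtain ⟨l₃, h14⟩ := h1.adds (b := 0) (.inl ⟨0, CompFun.mem_only n, rfl, rfl⟩)
      obtain ⟨m₃, h15⟩ := h2.adds (b := 0) (.inr ⟨CompFun.not_dom_only hn, rfl, rfl⟩)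
      obtain ⟨C'', q'', m'', h16, h17⟩ := h15.tausC h12
      have h18 := h14.size_le h16 h13
      have h19 := h17.size_le
      simp only [size_cons, weight] at h18
      omega
    · push Not at hout
      induction A using Multiset.induction_on with
      | empty =>
        obtain rfl : B = 0 := size_eq_zero.1 hsize.symm
        -- Without atoms there are no communications, so divergence can only come from the divergent
        -- part.
        have key : ∀ {o p : Prop} {E F : HTerm 0} {l m : ℕ}, Rep 0 o E l → Rep 0 p F m →
            Bisimilar E F → o → p := by
          intro o p E F l m h h' hEF ho
          by_contra hp
          obtain ⟨A', o', E', l', ⟨a, m, b, f, C, h1, -⟩, -⟩ :=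
            h'.comm_of_diverges (hEF.symm.diverges (h.diverges ho)) hp
          exact Multiset.cons_ne_zero h1.symm
        exact ⟨rfl, key h h' hEF, key h' h hEF.symm⟩
      | cons x A =>
        cases x with
        | out a n => exact absurd (Multiset.mem_cons_self _ _) (hout a n)
        | fn a b f =>
          have hA : ∀ b n, Atom.out b n ∉ A := fun b n hb =>
            hout b n (Multiset.mem_cons_of_mem hb)
          obtain ⟨E₁, l₁, b', g, C, q, F₁, m₁, F', h1, h2, h3, h4, h5⟩ :=
            h.match_inp h' hEF HTerm.probe
          obtain ⟨C', q', m', h7, h8⟩ := h2.probe.tausC h4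
          obtain ⟨rfl, h9⟩ := ih _ (by simp [weight]) h1.probe h7 h5 rfl
          have h10 := h3.size_le
          have h11 := h8.size_le
          simp only [size_cons, weight] at hsize h10 h11
          obtain ⟨rfl, rfl⟩ := h3.eq (by simp only [size_cons, weight]; omega)
          obtain ⟨h12, rfl⟩ := h8.eq (by simp only [size_cons, weight]; omega)
          -- As `A` has no outputs, the one revealed by the partner must be the one on `b`.
          have h13 : Atom.out b' 0 ∈ Atom.out b 0 ::ₘ A := h12 ▸ Multiset.mem_cons_self _ _
          rcases Multiset.mem_cons.1 h13 with h13 | h13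
          · cases h13
            rw [Multiset.cons_inj_right] at h12
            subst h12
            have ih' : ∀ {B C : Multiset Atom} {q r : Prop} {E F : HTerm 0} {l m : ℕ},
                size B < size A + 2 → Rep B q E l → Rep C r F m → Bisimilar E F → B = C :=
              fun hB hE hF hEF => (ih _ (by simpa [weight, add_comm] using hB) hE hF hEF rfl).1
            have hfg : f = g := Subtype.ext <| PFun.ext fun i n =>
              ⟨mem_of_bisimilar hA h h' hEF ih', mem_of_bisimilar hA h' h hEF.symm ih'⟩
            exact ⟨by rw [hfg], h9⟩
          · exact absurd h13 (hA _ _)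

end Rep

end HTerm

/-! ### Communications in composed configurations -/

open Atom

namespace Atom

theorem Adds.add {f : CompFun} {m b : ℕ} {A A' : Multiset Atom} {o o' : Prop}
    (h : Adds f m b A o A' o') (C : Multiset Atom) (p : Prop) :
    Adds f m b (A + C) (o ∨ p) (A' + C) (o' ∨ p) := by
  rcases h with ⟨n, hn, rfl, rfl⟩ | ⟨hn, rfl, rfl⟩
  · exact .inl ⟨n, hn, Multiset.cons_add _ _ _, rfl⟩
  · exact .inr ⟨hn, rfl, by simp⟩

theorem Adds.add' {f : CompFun} {m b : ℕ} {A A' : Multiset Atom} {o o' : Prop}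
    (h : Adds f m b A o A' o') (C : Multiset Atom) (p : Prop) :
    Adds f m b (C + A) (p ∨ o) (C + A') (p ∨ o') := by
  rw [add_comm C, add_comm C, or_comm, @or_comm p]
  exact h.add C p

theorem Adds.unique {f : CompFun} {m b : ℕ} {A A' A'' : Multiset Atom} {o o' o'' : Prop}
    (h : Adds f m b A o A' o') (h' : Adds f m b A o A'' o'') : A' = A'' ∧ o' = o'' := by
  rcases h with ⟨n, hn, rfl, rfl⟩ | ⟨hn, rfl, rfl⟩ <;>
    rcases h' with ⟨n', hn', rfl, rfl⟩ | ⟨hn', rfl, rfl⟩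
  · rw [Part.mem_unique hn hn']; exact ⟨rfl, rfl⟩
  · exact absurd (Part.dom_iff_mem.2 ⟨_, hn⟩) hn'
  · exact absurd (Part.dom_iff_mem.2 ⟨_, hn'⟩) hn
  · exact ⟨rfl, rfl⟩

theorem Comm.add {A A' : Multiset Atom} {o o' : Prop} (h : Comm A o A' o') (C : Multiset Atom)
    (p : Prop) : Comm (A + C) (o ∨ p) (A' + C) (o' ∨ p) := by
  obtain ⟨a, m, b, f, B, rfl, h⟩ := h
  exact ⟨a, m, b, f, B + C, by simp only [Multiset.cons_add], h.add C p⟩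

theorem Comm.add' {A A' : Multiset Atom} {o o' : Prop} (h : Comm A o A' o') (C : Multiset Atom)
    (p : Prop) : Comm (C + A) (p ∨ o) (C + A') (p ∨ o') := by
  rw [add_comm C, add_comm C, or_comm, @or_comm p]
  exact h.add C p

def proc : Atom → CProc
  | out a i => .out a i
  | fn a b f => .fn a b f

end Atom

namespace CProc

/-! ## Configurations of the processes of `ℂ` -/

def atoms : CProc → Multiset Atom
  | nil => 0
  | omega => 0
  | out a i => {.out a i}
  | fn a b f => {.fn a b f}
  | par P Q => atoms P + atoms Q

def HasOmega : CProc → Prop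
  | omega => True
  | par P Q => HasOmega P ∨ HasOmega Q
  | _ => False

theorem rep_enc (P : CProc) : HTerm.Rep P.atoms P.HasOmega P.enc 0 := by
  have atom (x : Atom) : HTerm.Rep {x} False x.term 0 :=
    .cong (.cons (k := 0) (l := 0) (HTerm.comp_term x) (.silent (.inr ⟨id, HTerm.dead_nil⟩)))
      (HTerm.Cong.par_nil _)
  induction P with
  | nil => exact .silent (.inr ⟨id, HTerm.dead_nil⟩)
  | omega => exact .silent (.inl ⟨trivial, HTerm.inf_loop.spins⟩)
  | out a i => exact atom (.out a i)
  | fn a b f => exact atom (.fn a b f)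
  | par P Q ihP ihQ => exact ihP.par ihQ

/-! ### Structural congruence -/

theorem Cong.par_nil (P : CProc) : Cong (CProc.par P CProc.nil) P :=
  (Cong.par_comm _ _).trans (.nil_par P)

theorem Cong.atoms_eq {P Q : CProc} (h : Cong P Q) :
    P.atoms = Q.atoms ∧ (P.HasOmega ↔ Q.HasOmega) := by
  induction h with
  | refl => exact ⟨rfl, Iff.rfl⟩
  | symm _ ih => exact ⟨ih.1.symm, ih.2.symm⟩
  | trans _ _ ih ih' => exact ⟨ih.1.trans ih'.1, ih.2.trans ih'.2⟩
  | par _ _ ih ih' => exact ⟨congrArg₂ _ ih.1 ih'.1, or_congr ih.2 ih'.2⟩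
  | nil_par P => exact ⟨zero_add _, iff_of_eq (false_or _)⟩
  | par_comm P Q => exact ⟨add_comm _ _, or_comm⟩
  | par_assoc P Q R => exact ⟨add_assoc _ _ _, or_assoc⟩
  | omega_omega => exact ⟨rfl, or_self_iff⟩

theorem exists_cong_of_mem {P : CProc} {x : Atom} (h : x ∈ P.atoms) :
    ∃ P', Cong P (par x.proc P') ∧ P.atoms = x ::ₘ P'.atoms ∧ (P.HasOmega ↔ P'.HasOmega) := by
  induction P with
  | nil => exact absurd h (Multiset.notMem_zero _)
  | omega => exact absurd h (Multiset.notMem_zero _)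
  | out a i =>
    obtain rfl := Multiset.mem_singleton.1 h
    exact ⟨nil, (Cong.par_nil _).symm, rfl, Iff.rfl⟩
  | fn a b f =>
    obtain rfl := Multiset.mem_singleton.1 h
    exact ⟨nil, (Cong.par_nil _).symm, rfl, Iff.rfl⟩
  | par P Q ihP ihQ =>
    rcases Multiset.mem_add.1 h with h | h
    · obtain ⟨P', h1, h2, h3⟩ := ihP h
      refine ⟨par P' Q, (h1.par (.refl Q)).trans (.par_assoc _ _ _), ?_, or_congr_left h3⟩
      rw [atoms, atoms, h2, Multiset.cons_add]
    · obtain ⟨Q', h1, h2, h3⟩ := ihQ h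
      refine ⟨par P Q', ?_, ?_, or_congr_right h3⟩
      · exact (Cong.par (.refl P) h1).trans ((Cong.par_assoc _ _ _).symm.trans
          (((Cong.par_comm _ _).par (.refl _)).trans (.par_assoc _ _ _)))
      · rw [atoms, atoms, h2, Multiset.add_cons]

theorem cong_of_atoms_eq {P Q : CProc} (h : P.atoms = Q.atoms)
    (h' : P.HasOmega ↔ Q.HasOmega) : Cong P Q := by
  -- Without atoms only copies of `0` and `Ω` remain, and the law `Ω | Ω ≡ Ω` merges the latter.
  -- This is why a truth value suffices to record them.
  have base : ∀ P : CProc, P.atoms = 0 →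
      (P.HasOmega → Cong P omega) ∧ (¬ P.HasOmega → Cong P nil) := by
    intro P hP
    induction P with
    | nil => exact ⟨False.elim, fun _ => .refl _⟩
    | omega => exact ⟨fun _ => .refl _, fun h => absurd trivial h⟩
    | out a i => exact absurd hP (Multiset.singleton_ne_zero _)
    | fn a b f => exact absurd hP (Multiset.singleton_ne_zero _)
    | par P Q ihP ihQ =>
      obtain ⟨h1, h2⟩ := add_eq_zero.1 hP
      obtain ⟨p1, p2⟩ := ihP h1
      obtain ⟨q1, q2⟩ := ihQ h2
      by_cases hp : P.HasOmega <;> by_cases hq : Q.HasOmega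
      · exact ⟨fun _ => ((p1 hp).par (q1 hq)).trans .omega_omega, fun h => absurd (.inl hp) h⟩
      · exact ⟨fun _ => ((p1 hp).par (q2 hq)).trans (.par_nil _), fun h => absurd (.inl hp) h⟩
      · exact ⟨fun _ => ((p2 hp).par (q1 hq)).trans (.nil_par _), fun h => absurd (.inr hq) h⟩
      · exact ⟨fun h => absurd h (not_or.2 ⟨hp, hq⟩),
          fun _ => ((p2 hp).par (q2 hq)).trans (.nil_par _)⟩
  generalize hA : P.atoms = A at h
  induction A using Multiset.induction_on generalizing P Q with
  | empty =>
    by_cases hP : P.HasOmega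
    · exact ((base P hA).1 hP).trans ((base Q h.symm).1 (h'.1 hP)).symm
    · exact ((base P hA).2 hP).trans ((base Q h.symm).2 (mt h'.2 hP)).symm
  | cons x A ih =>
    obtain ⟨P', h1, h2, h3⟩ := exists_cong_of_mem (hA ▸ Multiset.mem_cons_self x A)
    obtain ⟨Q', h4, h5, h6⟩ := exists_cong_of_mem (h ▸ Multiset.mem_cons_self x A)
    rw [hA, Multiset.cons_inj_right] at h2
    rw [← h, Multiset.cons_inj_right] at h5
    exact h1.trans ((Cong.par (.refl _) (ih (h3.symm.trans (h'.trans h6)) h2.symm h5)).trans h4.symm)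

/-! ### Transitions -/

theorem Step.atoms_out {P P' : CProc} {a n : ℕ} (h : Step P (.out a n) P') :
    P.atoms = .out a n ::ₘ P'.atoms ∧ P'.HasOmega = P.HasOmega := by
  generalize hl : CAct.out a n = l at h
  induction h with
  | out => cases hl; exact ⟨rfl, rfl⟩
  | parL Q _ ih =>
    obtain ⟨h1, h2⟩ := ih hl
    exact ⟨by rw [atoms, h1, Multiset.cons_add, atoms], by rw [HasOmega, h2, HasOmega]⟩
  | parR Q _ ih =>
    obtain ⟨h1, h2⟩ := ih hl
    exact ⟨by rw [atoms, h1, Multiset.add_cons, atoms], by rw [HasOmega, h2, HasOmega]⟩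
  | _ => cases hl

theorem Step.atoms_inp {P P' : CProc} {a m : ℕ} (h : Step P (.inp a m) P') :
    ∃ b f B, P.atoms = .fn a b f ::ₘ B ∧ Adds f m b B P.HasOmega P'.atoms P'.HasOmega := by
  generalize hl : CAct.inp a m = l at h
  induction h with
  | fnDef a b f m n h => cases hl; exact ⟨b, f, 0, rfl, .inl ⟨n, h, rfl, rfl⟩⟩
  | fnUndef a b f m h => cases hl; exact ⟨b, f, 0, rfl, .inr ⟨h, rfl, rfl⟩⟩
  | parL Q _ ih =>
    obtain ⟨b, f, B, h1, h2⟩ := ih hl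
    exact ⟨b, f, B + Q.atoms, by rw [atoms, h1, Multiset.cons_add], h2.add _ _⟩
  | parR Q _ ih =>
    obtain ⟨b, f, B, h1, h2⟩ := ih hl
    exact ⟨b, f, Q.atoms + B, by rw [atoms, h1, Multiset.add_cons], h2.add' _ _⟩
  | _ => cases hl

theorem Step.atoms_tau {P P' : CProc} (h : Step P .tau P') :
    (P.HasOmega ∧ P'.atoms = P.atoms ∧ P'.HasOmega = P.HasOmega) ∨
      Comm P.atoms P.HasOmega P'.atoms P'.HasOmega := by
  generalize hl : CAct.tau = l at h
  induction h with
  | omega => exact .inl ⟨trivial, rfl, rfl⟩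
  | @comL P P' Q Q' a i hP hQ =>
    obtain ⟨h1, h2⟩ := hP.atoms_out
    obtain ⟨b, f, B, h3, h4⟩ := hQ.atoms_inp
    refine .inr ⟨a, i, b, f, P'.atoms + B, ?_, ?_⟩
    rotate_left
    · rw [HasOmega, ← h2]
      exact h4.add' _ _
    · rw [atoms, h1, h3, Multiset.cons_add, Multiset.add_cons]
  | @comR P P' Q Q' a i hP hQ =>
    obtain ⟨h1, h2⟩ := hQ.atoms_out
    obtain ⟨b, f, B, h3, h4⟩ := hP.atoms_inp
    refine .inr ⟨a, i, b, f, B + Q'.atoms, ?_, ?_⟩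
    rotate_left
    · rw [HasOmega, ← h2]
      exact h4.add _ _
    · rw [atoms, h1, h3, Multiset.cons_add, Multiset.add_cons, Multiset.cons_swap]
  | parL Q _ ih =>
    rcases ih hl with ⟨h1, h2, h3⟩ | h
    · exact .inl ⟨.inl h1, by rw [atoms, h2, atoms], by rw [HasOmega, h3, HasOmega]⟩
    · exact .inr (h.add _ _)
  | parR P _ ih =>
    rcases ih hl with ⟨h1, h2, h3⟩ | h
    · exact .inl ⟨.inr h1, by rw [atoms, h2, atoms], by rw [HasOmega, h3, HasOmega]⟩
    · exact .inr (h.add' _ _)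
  | _ => cases hl

theorem exists_step_out {P : CProc} {a n : ℕ} (h : Atom.out a n ∈ P.atoms) :
    ∃ P', Step P (.out a n) P' := by
  induction P with
  | nil => exact absurd h (Multiset.notMem_zero _)
  | omega => exact absurd h (Multiset.notMem_zero _)
  | out b i => cases Multiset.mem_singleton.1 h; exact ⟨_, .out _ _⟩
  | fn => cases Multiset.mem_singleton.1 h
  | par P Q ihP ihQ =>
    rcases Multiset.mem_add.1 h with h | h
    · obtain ⟨P', h1⟩ := ihP h
      exact ⟨_, .parL _ h1⟩
    · obtain ⟨Q', h1⟩ := ihQ h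
      exact ⟨_, .parR _ h1⟩

/-- Quantifying over `B` is harmless, the rest of a multiset being unique, and it spares a choice of
the rest in the induction. -/
theorem exists_step_inp {P : CProc} {a b : ℕ} {f : CompFun} (h : Atom.fn a b f ∈ P.atoms)
    (m : ℕ) : ∃ P', Step P (.inp a m) P' ∧ ∀ B, P.atoms = .fn a b f ::ₘ B →
      Adds f m b B P.HasOmega P'.atoms P'.HasOmega := by
  induction P with
  | nil => exact absurd h (Multiset.notMem_zero _)
  | omega => exact absurd h (Multiset.notMem_zero _)
  | out => cases Multiset.mem_singleton.1 h
  | fn c d g =>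
    cases Multiset.mem_singleton.1 h
    have key : ∀ B, (fn a b f).atoms = .fn a b f ::ₘ B → 0 = B := fun B hB =>
      (Multiset.cons_inj_right _).1 hB
    by_cases hm : (f.1 m).Dom
    · refine ⟨_, .fnDef _ _ _ _ _ (Part.get_mem hm), fun B hB => ?_⟩
      obtain rfl := key B hB
      exact .inl ⟨_, Part.get_mem hm, rfl, rfl⟩
    · refine ⟨_, .fnUndef _ _ _ _ hm, fun B hB => ?_⟩
      obtain rfl := key B hB
      exact .inr ⟨hm, rfl, rfl⟩
  | par P Q ihP ihQ =>
    rcases Multiset.mem_add.1 h with h | h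
    · obtain ⟨P', h1, h2⟩ := ihP h
      refine ⟨_, .parL Q h1, fun B hB => ?_⟩
      obtain ⟨C, hC⟩ := Multiset.exists_cons_of_mem h
      rw [atoms, hC, Multiset.cons_add, Multiset.cons_inj_right] at hB
      subst hB
      exact (h2 C hC).add _ _
    · obtain ⟨Q', h1, h2⟩ := ihQ h
      refine ⟨_, .parR P h1, fun B hB => ?_⟩
      obtain ⟨C, hC⟩ := Multiset.exists_cons_of_mem h
      rw [atoms, hC, Multiset.add_cons, Multiset.cons_inj_right] at hB
      subst hB
      exact (h2 C hC).add' _ _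

/-- If sender and receiver lie on the same side of a composition, induction applies; otherwise the
two sides communicate. -/
theorem exists_step_tau {P : CProc} {a b m : ℕ} {f : CompFun} (h : Atom.out a m ∈ P.atoms)
    (h' : Atom.fn a b f ∈ P.atoms) : ∃ P', Step P .tau P' ∧
      ∀ B, P.atoms = .out a m ::ₘ .fn a b f ::ₘ B →
        Adds f m b B P.HasOmega P'.atoms P'.HasOmega := by
  have decompose : ∀ A : Multiset Atom, Atom.out a m ∈ A → Atom.fn a b f ∈ A →
      ∃ C, A = .out a m ::ₘ .fn a b f ::ₘ C := by
    intro A h h'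
    obtain ⟨A, rfl⟩ := Multiset.exists_cons_of_mem h
    rcases Multiset.mem_cons.1 h' with h' | h'
    · cases h'
    · obtain ⟨C, rfl⟩ := Multiset.exists_cons_of_mem h'
      exact ⟨C, rfl⟩
  induction P with
  | nil => exact absurd h (Multiset.notMem_zero _)
  | omega => exact absurd h (Multiset.notMem_zero _)
  | out => cases Multiset.mem_singleton.1 h'
  | fn => cases Multiset.mem_singleton.1 h
  | par P Q ihP ihQ =>
    rcases Multiset.mem_add.1 h with h | h <;> rcases Multiset.mem_add.1 h' with h' | h'
    · obtain ⟨P', h1, h2⟩ := ihP h h'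
      refine ⟨_, .parL Q h1, fun B hB => ?_⟩
      obtain ⟨C, hC⟩ := decompose _ h h'
      rw [atoms, hC, Multiset.cons_add, Multiset.cons_add, Multiset.cons_inj_right,
        Multiset.cons_inj_right] at hB
      subst hB
      exact (h2 C hC).add _ _
    · obtain ⟨P', h1⟩ := exists_step_out h
      obtain ⟨Q', h2, h3⟩ := exists_step_inp h' m
      refine ⟨_, .comL h1 h2, fun B hB => ?_⟩
      obtain ⟨C, hC⟩ := Multiset.exists_cons_of_mem h'
      obtain ⟨h4, h5⟩ := h1.atoms_out
      rw [atoms, h4, hC, Multiset.cons_add, Multiset.add_cons, Multiset.cons_inj_right,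
        Multiset.cons_inj_right] at hB
      subst hB
      rw [HasOmega, ← h5]
      exact (h3 C hC).add' _ _
    · obtain ⟨Q', h1⟩ := exists_step_out h
      obtain ⟨P', h2, h3⟩ := exists_step_inp h' m
      refine ⟨_, .comR h2 h1, fun B hB => ?_⟩
      obtain ⟨C, hC⟩ := Multiset.exists_cons_of_mem h'
      obtain ⟨h4, h5⟩ := h1.atoms_out
      rw [atoms, h4, hC, Multiset.cons_add, Multiset.add_cons, Multiset.cons_swap,
        Multiset.cons_inj_right, Multiset.cons_inj_right] at hB
      subst hB
      rw [HasOmega, ← h5]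
      exact (h3 C hC).add _ _
    · obtain ⟨Q', h1, h2⟩ := ihQ h h'
      refine ⟨_, .parR P h1, fun B hB => ?_⟩
      obtain ⟨C, hC⟩ := decompose _ h h'
      rw [atoms, hC, Multiset.add_cons, Multiset.add_cons, Multiset.cons_inj_right,
        Multiset.cons_inj_right] at hB
      subst hB
      exact (h2 C hC).add' _ _

theorem exists_step_of_comm {P : CProc} {A : Multiset Atom} {o : Prop}
    (h : Comm P.atoms P.HasOmega A o) : ∃ P', Step P .tau P' ∧ P'.atoms = A ∧ P'.HasOmega = o := by
  obtain ⟨a, m, b, f, B, h1, h2⟩ := h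
  obtain ⟨P', h3, h4⟩ := exists_step_tau (P := P) (h1 ▸ Multiset.mem_cons_self _ _)
    (h1 ▸ Multiset.mem_cons_of_mem (Multiset.mem_cons_self _ _))
  exact ⟨P', h3, (h4 B h1).unique h2⟩

theorem HasOmega.step {P : CProc} (h : P.HasOmega) : Step P .tau P := by
  induction P with
  | omega => exact .omega
  | par P Q ihP ihQ =>
    rcases h with h | h
    exacts [.parL _ (ihP h), .parR _ (ihQ h)]
  | _ => exact h.elim

/-! ### The encoding and the transitions -/

/-- `E` represents `P`. -/
def RepBy (P : CProc) (E : HTerm 0) : Prop := ∃ l, HTerm.Rep P.atoms P.HasOmega E l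

theorem repBy_enc (P : CProc) : RepBy P P.enc := ⟨0, rep_enc P⟩

theorem RepBy.tau {P P' : CProc} {E : HTerm 0} (h : RepBy P E) (h' : Step P .tau P') :
    ∃ E', HTerm.Weak E .tau E' ∧ RepBy P' E' := by
  obtain ⟨l, h⟩ := h
  rcases h'.atoms_tau with ⟨h1, h2, h3⟩ | h1
  · obtain ⟨E', l', h4, h5⟩ := h.exists_omega h1
    exact ⟨E', h5.weak, l', by rwa [h2, h3]⟩
  · obtain ⟨E', l', h2, h3⟩ := h.exists_comm h1
    exact ⟨E', h3, l', h2⟩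

theorem RepBy.taus {P P' : CProc} {E : HTerm 0} (h : RepBy P E) (h' : Taus P P') :
    ∃ E', HTerm.Taus E E' ∧ RepBy P' E' := by
  induction h' with
  | refl => exact ⟨E, .refl, h⟩
  | tail _ h1 ih =>
    obtain ⟨E', h2, h3⟩ := ih
    obtain ⟨E'', ⟨F, F', h4, h5, h6⟩, h7⟩ := h3.tau h1
    exact ⟨E'', h2.trans (h4.trans (.head h5 h6)), h7⟩

theorem RepBy.step {P P' : CProc} {E : HTerm 0} {l : CAct} (h : RepBy P E) (h' : Step P l P') :
    ∃ l' E', l'.subject = l.subject ∧ l'.bound = 0 ∧ HTerm.Weak E l' E' ∧ RepBy P' E' := by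
  cases l with
  | tau =>
    obtain ⟨E', h1, h2⟩ := h.tau h'
    exact ⟨.tau, E', rfl, rfl, h1, h2⟩
  | inp a m =>
    obtain ⟨l, h⟩ := h
    obtain ⟨b, f, B, h1, h2⟩ := h'.atoms_inp
    rw [h1] at h
    obtain ⟨E', l', h3, E₁, h4, h5⟩ := h.exists_inp
    obtain ⟨l'', h6⟩ := h3.adds h2
    exact ⟨.inp a (.num m), _, rfl, rfl, ⟨E₁, _, h4, h5 _, .refl⟩, l'', h6⟩
  | out a n =>
    obtain ⟨l, h⟩ := h
    obtain ⟨h1, h2⟩ := h'.atoms_out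
    rw [h1, ← h2] at h
    obtain ⟨E', l', h3, E₁, h4, h5⟩ := h.exists_out
    exact ⟨.out 0 a (.num n), E', rfl, rfl, ⟨E₁, _, h4, h5, .refl⟩, l', h3⟩

theorem RepBy.weak {P P' : CProc} {E : HTerm 0} {l : CAct} (h : RepBy P E) (h' : Weak P l P') :
    ∃ l' E', l'.subject = l.subject ∧ l'.bound = 0 ∧ HTerm.Weak E l' E' ∧ RepBy P' E' := by
  obtain ⟨P₁, P₂, h1, h2, h3⟩ := h'
  obtain ⟨E₁, h4, h5⟩ := h.taus h1
  obtain ⟨l', E₂, h6, h7, ⟨F, F', h8, h9, h10⟩, h11⟩ := h5.step h2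
  obtain ⟨E₃, h12, h13⟩ := h11.taus h3
  exact ⟨l', E₃, h6, h7, ⟨F, F', h4.trans h8, h9, h10.trans h12⟩, h13⟩

theorem RepBy.settle {P : CProc} {E : HTerm 0} (h : RepBy P E) :
    ∃ E', HTerm.Taus E E' ∧ HTerm.Bisimilar E' P.enc := by
  obtain ⟨l, h⟩ := h
  obtain ⟨E', ⟨F, h1, h2⟩, h3⟩ := h.settle
  exact ⟨F, h1, (h3.cong h2.symm).bisimilar (rep_enc P)⟩

/-- By induction on the weight: either `Ω` is present and loops, or a communication occurs, which
`P` can imitate. -/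
theorem RepBy.diverges {P : CProc} {E : HTerm 0} (h : RepBy P E)
    (h' : Diverges HTerm.Tau E) : Diverges Tau P := by
  induction hs : size P.atoms using Nat.strong_induction_on generalizing P E with
  | _ s ih =>
    by_cases hP : P.HasOmega
    · exact ⟨fun _ => P, rfl, fun _ => hP.step⟩
    · obtain ⟨l, h⟩ := h
      obtain ⟨A, o, E', l', h1, h2, h3⟩ := h.comm_of_diverges h' hP
      obtain ⟨P', h4, rfl, rfl⟩ := exists_step_of_comm h1
      exact (ih _ (hs ▸ h1.size_lt) ⟨l', h2⟩ h3 rfl).of_step h4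

theorem RepBy.cong_of_bisimilar {P Q : CProc} {E F : HTerm 0} (h : RepBy P E) (h' : RepBy Q F)
    (hEF : HTerm.Bisimilar E F) : Cong P Q := by
  obtain ⟨l, h⟩ := h
  obtain ⟨m, h'⟩ := h'
  obtain ⟨h1, h2⟩ := h.eq_of_bisimilar h' hEF
  exact cong_of_atoms_eq h1 h2

/-! ### The properties of the encoding -/

theorem sound_enc : Encoding.Sound enc := by
  intro P Q h
  obtain ⟨h1, h2⟩ := h.atoms_eq
  have h3 := rep_enc P
  rw [h1, propext h2] at h3
  exact h3.bisimilar (rep_enc Q)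

theorem complete_enc : Encoding.Complete enc := fun P Q h =>
  (repBy_enc P).cong_of_bisimilar (repBy_enc Q) h

theorem compositional_enc : Encoding.Compositional enc := by
  intro op
  cases op with
  | par => exact ⟨.par (.var (0 : Fin 2)) (.var (1 : Fin 2)), fun P => rfl⟩
  | nil => exact ⟨enc nil, fun P => (HTerm.subst_closed _ _).symm⟩
  | omega => exact ⟨enc omega, fun P => (HTerm.subst_closed _ _).symm⟩
  | out a i => exact ⟨enc (out a i), fun P => (HTerm.subst_closed _ _).symm⟩
  | fn a b f => exact ⟨enc (fn a b f), fun P => (HTerm.subst_closed _ _).symm⟩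

theorem enc_rename (σ : ℕ → ℕ) (P : CProc) : enc (P.rename σ) = (enc P).rename σ := by
  induction P with
  | nil => rfl
  | omega => rfl
  | out a i => simp only [rename, enc, HTerm.rename, HTerm.rename_num]
  | fn a b f => simp only [rename, enc, HTerm.rename, HTerm.rename_server]
  | par P Q ihP ihQ => simp only [rename, enc, HTerm.rename, ihP, ihQ]

theorem forthCorrespondence_enc : Encoding.ForthCorrespondence enc := by
  intro P l P' h
  obtain ⟨l', E', h1, h2, ⟨F, F', h3, h4, h5⟩, h6⟩ := (repBy_enc P).weak h
  -- The computations still pending are completed, so that the target is bisimilar to an encoding.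
  obtain ⟨T, h7, h8⟩ := h6.settle
  refine ⟨l', T, h1, ⟨F, F', h3, h4, h5.trans h7⟩, ?_⟩
  rwa [h2, HTerm.shift_zero]

theorem Taus.eq_of_forall {P P' : CProc} (h : Taus P P') (hP : ∀ Q, ¬ Step P .tau Q) :
    P' = P := by
  rcases Relation.ReflTransGen.cases_head h with h | ⟨Q, h, -⟩
  exacts [h.symm, absurd h (hP Q)]

/-- A process that expects a number need not behave like one of `ℂ` on another input: a constant
function can be made to return another number. -/
theorem not_backCorrespondence_enc : ¬ Encoding.BackCorrespondence enc := by
  intro hback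
  let f : CompFun := ⟨fun _ => Part.some 1, Partrec.nat_iff.1 (Computable.const 1)⟩
  obtain ⟨D, hD, h1⟩ := HTerm.server_probe f.code 1
  have hT : HTerm.Rep (Atom.out 1 0 ::ₘ 0) False (HTerm.inst (HTerm.server f.code 1) HTerm.probe)
      0 := by
    refine .cong (.cons (k := 0) (l := 0) (x := Atom.out 1 0) ⟨D, hD, h1⟩
      (.silent (.inr ⟨id, HTerm.dead_nil⟩))) (HTerm.Cong.par_nil _)
  obtain ⟨P', l, T', h2, ⟨P₁, P₂, h3, h4, h5⟩, h6, h7⟩ :=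
    hback (fn 0 1 f) (.inp 0 HTerm.probe) _ (HTerm.Step.inp _ _ _).weak
  obtain rfl := h3.eq_of_forall fun Q h => nomatch h
  obtain rfl : P₂ = out 1 1 := by
    cases h4 with
    | fnDef _ _ _ m n h => rw [Part.mem_some_iff.1 h]
    | fnUndef _ _ _ m h => exact absurd trivial h
  obtain rfl := h5.eq_of_forall fun Q h => nomatch h
  -- The probed server holds the output of `0`, and any configuration it reaches that weighs as much
  -- is still this one, whereas the process of `ℂ` can only have become the output of `1`.
  obtain ⟨A, o, m, h8, h9⟩ := hT.taus h6
  simp only [HAct.bound, HTerm.shift_zero] at h7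
  obtain ⟨rfl, -⟩ := h8.eq_of_bisimilar (rep_enc (out 1 1)) h7
  obtain ⟨h10, -⟩ := h9.eq le_rfl
  cases Multiset.singleton_inj.1 h10

end CProc

theorem proposition2 :
    ∃ enc : CProc → HTerm 0,
      Encoding.Sound enc ∧
      Encoding.Complete enc ∧
      Encoding.Compositional enc ∧
      Encoding.NameInvariant enc ∧
      Encoding.ForthCorrespondence enc ∧
      Encoding.DivergenceReflecting enc ∧
      ¬ Encoding.BackCorrespondence enc :=
  ⟨CProc.enc, CProc.sound_enc, CProc.complete_enc, CProc.compositional_enc,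
    fun σ _ P => CProc.enc_rename σ P, CProc.forthCorrespondence_enc,
    fun P h => (CProc.repBy_enc P).diverges h, CProc.not_backCorrespondence_enc⟩
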